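/- Let $k$ be an infinite field. A representation of a quiver $Q$ with dimension vector $\mathbf d$ is a family $V=(V_a)_{a}$ of matrices over $k$, one for each arrow $a\colon ta\to ha$, of size $\mathbf d(ta)\times\mathbf d(ha)$; the group $GL(\mathbf d)=\prod_z GL(\mathbf d(z))$ acts by $V\cdot g=(g_{ta}^{-1}V_a g_{ha})_a$, and $V\simeq W$ means that $V$ and $W$ lie in the same orbit. **The quiver $Q^*(n)$ and the rank functions.** For $n\ge 1$ let $Q^*(n)$ be the quiver with vertices $x_0,\dots,x_n,y_0,\dots,y_n,y_0'$ and arrows $\beta_i\colon y_i\to x_i$ ($0\le i\le n$), $\alpha_i\colon y_{i-1}\to x_i$ ($1\le i\le n$), $\alpha_1'\colon y_0'\to x_1$. Let $A$ be the block matrix with rows labelled $y_0,\dots,y_n$ and columns labelled $x_0,\dots,x_n$, having $\beta_i$ at $(y_i,x_i)$, $\alpha_{i+1}$ at $(y_i,x_{i+1})$ and $0$ elsewhere. Let $B$ be the block matrix with rows $y_0',y_1,\dots,y_n$ and columns $x_1,\dots,x_n$, having $\alpha_1'$ at $(y_0',x_1)$, $\beta_i$ at $(y_i,x_i)$ and $\alpha_{i+1}$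 at $(y_i,x_{i+1})$ for $i\ge1$, and $0$ elsewhere. Order the arrows partially by the maximal chains $\beta_0<\alpha_1<\beta_1<\dots<\alpha_n<\beta_n$ and $\alpha_1'<\beta_1<\dots<\alpha_n<\beta_n$. * For $\gamma\le\delta$, $[\gamma,\delta]$ is the rectangular submatrix of $A$ or $B$ with upper left entry $\gamma$ and lower right entry $\delta$. * For $\alpha_1\le\gamma\le\delta$, let $M=[\beta_0,\delta]$ and $N=[\alpha_1',\delta]$ (with $N=[\alpha_1',\alpha_1']$ if $\delta=\alpha_1$). If $\gamma=\alpha_i$, then $$[\![\alpha_i,\delta]\!]=\begin{bmatrix}M_{<}&0&M_{\ge}\\0&N_{<}&N_{\ge}\end{bmatrix},$$ where $<$ selects the columns $x_j$ with $j<i$ and $\ge$ those with $j\ge i$. If $\gamma=\beta_i$ ($i\ge1$), then $$[\![\beta_i,\delta]\!]=\begin{bmatrix}M^{<}&0\\0&N^{<}\\M^{\ge}&N^{\ge}\end{bmatrix},$$ where $<$ selects the rows before $y_i$ and $\ge$ the rows from $y_i$ on. * $[\![\alpha_1,\delta]\!]^0$ is obtained from $[\![\alpha_1,\delta]\!]$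 by replacing $\beta_0$ by $0$. Each such matrix $\Phi$ gives a function $V\mapsto\operatorname{rank}\Phi_V$ on the representations $V$ of $Q^*(n)$ with a given dimension vector, where $\Phi_V$ is obtained by replacing each arrow $a$ by $V_a$ and each $0$ by a zero block. Let $\mathcal D_n$ be the set of the rank functions of all $[\gamma,\delta]$ with $\gamma\le\delta$, $\gamma\ne\alpha_1$; all $[\![\gamma,\delta]\!]$ with $\alpha_1\le\gamma\le\delta$; and all $[\![\alpha_1,\delta]\!]^0$ with $\delta\ge\alpha_1$. **Type $D$ quivers.** A quiver is of type $D$ if its underlying graph is the Dynkin diagram $D_m$ for some $m\ge4$. A *presentation* of a quiver $Q$ by $Q^*(n)$ is a set $S$ of arrows of $Q^*(n)$ containing exactly one of $\alpha_1,\beta_0$, together with an isomorphism of $Q$ with the contraction of $Q^*(n)$ along $S$ (the ends of each arrow in $S$ are identified, and the arrows in $S$ are deleted). Let $\nu$ be the resulting map from the vertices of $Q^*(n)$ to those of $Q$. A dimension vector $\mathbf d$ of $Q$ gives a dimension vector $\mathbf d^*$ of $Q^*(n)$ by $\mathbf d^*(z)=\mathbf d(\nu(z))$, except that $\mathbf d^*(x_0)=0$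 if $\beta_0\in S$. A representation $V$ of $Q$ with dimension vector $\mathbf d$ gives a representation $V*1$ of $Q^*(n)$ with dimension vector $\mathbf d^*$: $(V*1)_a=V_a$ for $a\notin S$, and $(V*1)_a$ is an identity matrix for $a\in S$, except that $(V*1)_{\beta_0}$ is the matrix without columns if $\beta_0\in S$. **Proposition.** Let $Q$ be a quiver of type $D$. 1. For some $n\ge1$, $Q$ or its opposite quiver $Q^{\mathrm{op}}$ has a presentation by $Q^*(n)$. 2. For every $n\ge 1$, every presentation of $Q$ by $Q^*(n)$, every dimension vector $\mathbf d$ of $Q$, and all representations $V,W$ of $Q$ with dimension vector $\mathbf d$: $V\simeq W$ if and only if $f(V*1)=f(W*1)$ for all $f\in\mathcal D_n$. 3. For every $n\ge 1$, every presentation of $Q^{\mathrm{op}}$ by $Q^*(n)$, every dimension vector $\mathbf d$ of $Q$, and all representations $V,W$ of $Q$ with dimension vector $\mathbf d$: $V\simeq W$ if and only if $f(V^T*1)=f(W^T*1)$ for all $f\in\mathcal D_n$, where $V^T=(V_a^T)_a$ is the transposed representation of $Q^{\mathrm{op}}$. -/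

import Mathlib

noncomputable section

namespace TypeD

open Quiver

universe u v w

/-! ### Representations of quivers by matrices -/

section Representations

variable (k : Type w) [Field k] (Q : Type u) [Quiver.{v} Q]

/-- The representation space of the quiver `Q` with dimension vector `d`: a representation assigns
to each arrow `a` a matrix with `d (ta)` rows and `d (ha)` columns (acting on row vectors). -/
abbrev Rep (d : Q → ℕ) : Type (max u v w) :=
  ∀ ⦃p q : Q⦄, (p ⟶ q) → Matrix (Fin (d p)) (Fin (d q)) k

variable {k Q}

/-- `V` and `W` lie in the same orbit of the base change group `∏ GL (d z)`, where `g` acts by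
`(V · g)_a = g_{ta}⁻¹ V_a g_{ha}`. -/
def SameOrbit {d : Q → ℕ} (V W : Rep k Q d) : Prop :=
  ∃ g : ∀ z : Q, GL (Fin (d z)) k, ∀ ⦃p q : Q⦄ (a : p ⟶ q),
    W a = ((g p)⁻¹ : GL (Fin (d p)) k).val * V a * (g q).val

/-- The matrix of a path: the product of the matrices of its arrows. -/
def evalPath {d : Q → ℕ} (V : Rep k Q d) {p : Q} :
    ∀ {q : Q}, Path p q → Matrix (Fin (d p)) (Fin (d q)) k
  | _, .nil => 1
  | _, .cons l a => evalPath V l * V a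

/-- The transposed representation of the opposite quiver. -/
def transposeRep {d : Q → ℕ} (V : Rep k Q d) : Rep k Qᵒᵖ (fun z => d z.unop) :=
  fun _ _ a => (V a.unop).transpose

end Representations

/-- A `Q`-matrix: rows and columns are labelled by vertices of `Q`, and the entry in row `i` and
column `j` is a formal linear combination of paths from the label of `i` to the label of `j`. -/
structure QMatrix (k : Type w) [Field k] (Q : Type u) [Quiver.{v} Q] where
  ι : Type
  κ : Type
  [fintypeRows : Fintype ι]
  [fintypeCols : Fintype κ]
  row : ι → Q
  col : κ → Q
  entry : ∀ i j, Path (row i) (col j) →₀ k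

attribute [instance] QMatrix.fintypeRows QMatrix.fintypeCols

namespace QMatrix

variable {k : Type w} [Field k] {Q : Type u} [Quiver.{v} Q]

/-- The evaluation of a `Q`-matrix at a representation: each entry `∑ λ_l p_l` is replaced by the
block `∑ λ_l V_{p_l}`. -/
def eval (Φ : QMatrix k Q) {d : Q → ℕ} (V : Rep k Q d) :
    Matrix (Σ i : Φ.ι, Fin (d (Φ.row i))) (Σ j : Φ.κ, Fin (d (Φ.col j))) k :=
  Matrix.of fun r c => ((Φ.entry r.1 c.1).sum fun l t => t • evalPath V l) r.2 c.2

/-- The integer valued function `V ↦ rank Φ_V`. -/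
def rankFun (Φ : QMatrix k Q) (d : Q → ℕ) : Rep k Q d → ℤ :=
  fun V => ((Φ.eval V).rank : ℤ)

end QMatrix

/-! ### The quiver `Q^*(n)` -/

/-- The vertices `x_0, …, x_n`, `y_0, …, y_n` and `y_0'` of `Q^*(n)`. -/
inductive StarVertex (n : ℕ) : Type
  | x (i : Fin (n + 1))
  | y (i : Fin (n + 1))
  | yPrime

/-- The arrows of `Q^*(n)`: `alpha i` is `α_{i+1}` (so that `alpha` runs over `α_1, …, α_n`),
`beta i` is `β_i` (for `0 ≤ i ≤ n`), and `alphaPrime` is `α_1'`. -/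
inductive StarArrow (n : ℕ) : Type
  | alpha (i : Fin n)
  | beta (i : Fin (n + 1))
  | alphaPrime

namespace StarArrow

variable {n : ℕ}

/-- `α_i` starts at `y_{i-1}`, `β_i` starts at `y_i`, and `α_1'` starts at `y_0'`. -/
def tail : StarArrow n → StarVertex n
  | alpha i => .y i.castSucc
  | beta i => .y i
  | alphaPrime => .yPrime

/-- `α_i` and `β_i` end at `x_i`, and `α_1'` ends at `x_1`. -/
def head : StarArrow n → StarVertex n
  | alpha i => .x i.succ
  | beta i => .x i
  | alphaPrime => .x 1

/-- Position in the chains `β_0 < α_1 < β_1 < ⋯ < α_n < β_n` and `α_1' < β_1 < ⋯ < α_n < β_n`. -/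
def pos : StarArrow n → ℕ
  | alpha i => 2 * (i : ℕ) + 1
  | beta i => 2 * (i : ℕ)
  | alphaPrime => 1

/-- The row of the block matrices `A`, `B` in which an arrow stands: `i` is the row of
`y_i`, where `y_0` is replaced by `y_0'` in the case of `B`. -/
def rowIdx : StarArrow n → ℕ
  | alpha i => i
  | beta i => i
  | alphaPrime => 0

/-- The column (the index `j` of `x_j`) of the block matrices `A`, `B` in which an arrow stands. -/
def colIdx : StarArrow n → ℕ
  | alpha i => i + 1
  | beta i => i
  | alphaPrime => 1

theorem eq_of_pos_eq {a b : StarArrow n} (h : a.pos = b.pos)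
    (ha : a ≠ alphaPrime) (hb : b ≠ alphaPrime) : a = b := by
  cases a <;> cases b <;> simp_all [pos, Fin.ext_iff] <;> omega

/-- The partial order on arrows whose maximal chains are
`β_0 < α_1 < β_1 < ⋯ < α_n < β_n` and `α_1' < β_1 < ⋯ < α_n < β_n`. -/
instance : PartialOrder (StarArrow n) where
  le a b := a = b ∨ (a.pos < b.pos ∧ ¬ (a = beta 0 ∧ b = alphaPrime))
  le_refl a := Or.inl rfl
  le_trans a b c := by
    rintro (rfl | ⟨h1, h2⟩) (rfl | ⟨h3, h4⟩)
    · exact Or.inl rfl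
    · exact Or.inr ⟨h3, h4⟩
    · exact Or.inr ⟨h1, h2⟩
    · refine Or.inr ⟨by omega, ?_⟩
      rintro ⟨rfl, rfl⟩
      simp only [pos] at h1 h3
      omega
  le_antisymm a b := by
    rintro (rfl | ⟨h1, h2⟩) (h | ⟨h3, h4⟩)
    · rfl
    · rfl
    · exact h.symm
    · omega

end StarArrow

instance (n : ℕ) : Quiver.{0} (StarVertex n) where
  Hom p q := {a : StarArrow n // a.tail = p ∧ a.head = q}

/-! ### Zig-zag matrices -/

section ZigZag

variable (k : Type w) [Field k] {n : ℕ} [NeZero n]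

open StarVertex StarArrow

/-- The entry of the `Q^*(n)`-matrices `A` and `B` in the row labelled `p` and the column labelled
`q`: `β_i` at `(y_i, x_i)`, `α_{i+1}` at `(y_i, x_{i+1})`, `α_1'` at `(y_0', x_1)`, and zero
elsewhere. -/
def arrowEntry : ∀ p q : StarVertex n, Path p q →₀ k
  | .y i, .x j =>
      if h : i = j then
        Finsupp.single (Hom.toPath (V := StarVertex n) ⟨beta i, rfl, by rw [h]; rfl⟩) 1
      else if h : (j : ℕ) = i + 1 then
        Finsupp.single (Hom.toPath (V := StarVertex n)
          ⟨alpha ⟨i, by omega⟩, rfl, congrArg StarVertex.x (Fin.ext h.symm)⟩) 1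
      else 0
  | .yPrime, .x j =>
      if h : j = 1 then
        Finsupp.single (Hom.toPath (V := StarVertex n) ⟨alphaPrime, rfl, by rw [h]; rfl⟩) 1
      else 0
  | _, _ => 0

/-- The row labels `y_0', y_1, …, y_n` of the matrix `B` (those of `A` are `y_0, y_1, …, y_n`). -/
def rowB : Fin (n + 1) → StarVertex n := Fin.cases yPrime fun i => y i.succ

/-- The zig-zag matrix `[γ, δ]`: the submatrix of `B` (if `γ = α_1'`) or of `A` (otherwise) whose
upper left entry is `γ` and whose lower right entry is `δ`. Used for `γ ≤ δ`. -/
def zigzag (γ δ : StarArrow n) : QMatrix k (StarVertex n) where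
  ι := {r : Fin (n + 1) // γ.rowIdx ≤ r ∧ r ≤ δ.rowIdx}
  κ := {c : Fin (n + 1) // γ.colIdx ≤ c ∧ c ≤ δ.colIdx}
  row := fun r => match γ with
    | alphaPrime => rowB r
    | _ => y r
  col := fun c => x c
  entry := fun _ _ => arrowEntry k _ _

/-- The matrix `⟦α_i, δ⟧`, for `i ≥ 1`: the upper block row is `M = [β_0, δ]`, the lower block row
is `N = [α_1', δ]`, the columns of `M` before `x_i` (first summand of `κ`) and those of `N` before
`x_i` (second summand) are kept apart, and the columns `x_i, x_{i+1}, …` (third summand) are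
shared by `M` and `N`. -/
def doubleAlpha (i : ℕ) (δ : StarArrow n) : QMatrix k (StarVertex n) where
  ι := {r : Fin (n + 1) // (r : ℕ) ≤ δ.rowIdx} ⊕ {r : Fin (n + 1) // (r : ℕ) ≤ δ.rowIdx}
  κ := {c : Fin (n + 1) // (c : ℕ) < i} ⊕ {c : Fin (n + 1) // 1 ≤ (c : ℕ) ∧ (c : ℕ) < i} ⊕
    {c : Fin (n + 1) // i ≤ (c : ℕ) ∧ (c : ℕ) ≤ δ.colIdx}
  row := Sum.elim (fun r => y r) (fun r => rowB r)
  col := Sum.elim (fun c => x c) (Sum.elim (fun c => x c) (fun c => x c))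
  entry
    | .inl _, .inl _ => arrowEntry k _ _
    | .inl _, .inr (.inl _) => 0
    | .inl _, .inr (.inr _) => arrowEntry k _ _
    | .inr _, .inl _ => 0
    | .inr _, .inr (.inl _) => arrowEntry k _ _
    | .inr _, .inr (.inr _) => arrowEntry k _ _

/-- The matrix `⟦β_i, δ⟧`, for `i ≥ 1`: the left block column is `M = [β_0, δ]`, the right block
column is `N = [α_1', δ]`, the rows of `M` before `y_i` (first summand of `ι`) and those of `N`
before `y_i` (second summand) are kept apart, and the rows `y_i, y_{i+1}, …` (third summand) are
shared by `M` and `N`. -/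
def doubleBeta (i : ℕ) (δ : StarArrow n) : QMatrix k (StarVertex n) where
  ι := {r : Fin (n + 1) // (r : ℕ) < i} ⊕ {r : Fin (n + 1) // (r : ℕ) < i} ⊕
    {r : Fin (n + 1) // i ≤ (r : ℕ) ∧ (r : ℕ) ≤ δ.rowIdx}
  κ := {c : Fin (n + 1) // (c : ℕ) ≤ δ.colIdx} ⊕
    {c : Fin (n + 1) // 1 ≤ (c : ℕ) ∧ (c : ℕ) ≤ δ.colIdx}
  row := Sum.elim (fun r => y r) (Sum.elim (fun r => rowB r) (fun r => y r))
  col := Sum.elim (fun c => x c) (fun c => x c)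
  entry
    | .inl _, .inl _ => arrowEntry k _ _
    | .inl _, .inr _ => 0
    | .inr (.inl _), .inl _ => 0
    | .inr (.inl _), .inr _ => arrowEntry k _ _
    | .inr (.inr _), .inl _ => arrowEntry k _ _
    | .inr (.inr _), .inr _ => arrowEntry k _ _

/-- The matrix `⟦γ, δ⟧`, used only for `α_1 ≤ γ ≤ δ` (so the value at `γ = α_1'` is irrelevant). -/
def double (γ δ : StarArrow n) : QMatrix k (StarVertex n) :=
  match γ with
  | alpha i => doubleAlpha k ((i : ℕ) + 1) δ
  | beta i => doubleBeta k i δ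
  | alphaPrime => zigzag k alphaPrime δ

variable {k}

open Classical in
/-- Replace the entries `β_0` of a `Q^*(n)`-matrix by `0` (the arrow `β_0` is the only path from
`y_0` to `x_0`). -/
def eraseBetaZero (Φ : QMatrix k (StarVertex n)) : QMatrix k (StarVertex n) where
  ι := Φ.ι
  κ := Φ.κ
  row := Φ.row
  col := Φ.col
  entry := fun i j => if Φ.row i = y 0 ∧ Φ.col j = x 0 then 0 else Φ.entry i j

variable (k)

/-- The set `𝒟_n` of rank functions on the representation space of `Q^*(n)` with dimension
vector `d`. -/
def rankFunctions (n : ℕ) [NeZero n] (d : StarVertex n → ℕ) :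
    Set (Rep k (StarVertex n) d → ℤ) :=
  {f | ∃ γ δ : StarArrow n, γ ≤ δ ∧ γ ≠ alpha 0 ∧ f = (zigzag k γ δ).rankFun d} ∪
  {f | ∃ γ δ : StarArrow n, alpha 0 ≤ γ ∧ γ ≤ δ ∧ f = (double k γ δ).rankFun d} ∪
  {f | ∃ δ : StarArrow n, alpha 0 ≤ δ ∧ f = (eraseBetaZero (double k (alpha 0) δ)).rankFun d}

end ZigZag

/-! ### Type `D` quivers as contractions of `Q^*(n)` -/

/-- The Dynkin diagram `D_m` on the vertices `0, …, m - 1`: the chain `1 — 2 — 3 — ⋯ — (m - 1)`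
together with the edge `0 — 2`. -/
def dynkinD (m : ℕ) : SimpleGraph (Fin m) :=
  SimpleGraph.fromRel fun i j =>
    (1 ≤ (i : ℕ) ∧ (j : ℕ) = (i : ℕ) + 1) ∨ ((i : ℕ) = 0 ∧ (j : ℕ) = 2)

/-- A quiver is of type `D` if its underlying graph is the Dynkin diagram `D_m` for some `m ≥ 4`:
there is exactly one arrow, in one of the two directions, between the ends of each edge of the
diagram, and there are no other arrows. -/
def IsTypeD (Q : Type u) [Quiver.{v} Q] : Prop :=
  ∃ m : ℕ, 4 ≤ m ∧ ∃ e : Fin m ≃ Q, ∀ i j : Fin m,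
    ((dynkinD m).Adj i j → Nonempty (Unique ((e i ⟶ e j) ⊕ (e j ⟶ e i)))) ∧
    (¬ (dynkinD m).Adj i j → IsEmpty (e i ⟶ e j))

/-- The vertices of the contraction of `Q^*(n)` along a set `A` of arrows: the two ends of each
arrow of `A` are identified. (Every `A` is admissible for contraction as `Q^*(n)` is a tree.) -/
def Contracted {n : ℕ} (A : Set (StarArrow n)) : Type :=
  Quot fun p q : StarVertex n => ∃ a ∈ A, a.tail = p ∧ a.head = q

/-- The arrows of the contraction of `Q^*(n)` along `A` are the arrows of `Q^*(n)` not in `A`. -/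
instance {n : ℕ} (A : Set (StarArrow n)) : Quiver.{0} (Contracted A) where
  Hom p q := {a : StarArrow n // a ∉ A ∧
    (Quot.mk _ a.tail : Contracted A) = p ∧ (Quot.mk _ a.head : Contracted A) = q}

/-- A way in which the quiver `Q` arises from `Q^*(n)`: a set `A` of arrows, and an isomorphism of
the contraction of `Q^*(n)` along `A` with `Q`, such that exactly one of the arrows `α_1`, `β_0`
is contracted. If `α_1` is contracted, then `Q` has composable arrows `β_0` and `α_1'` in its
length one branches; if `β_0` is contracted, then `Q` has the arrows `α_1` and `α_1'` in its length
one branches, both pointing towards the branch point. -/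
structure StarContraction (n : ℕ) [NeZero n] (Q : Type u) [Quiver.{v} Q] where
  A : Set (StarArrow n)
  vert : Contracted A ≃ Q
  arr : ∀ {p q : Contracted A}, (p ⟶ q) ≃ (vert p ⟶ vert q)
  shape : Xor (StarArrow.alpha 0 ∈ A) (StarArrow.beta 0 ∈ A)

namespace StarContraction

variable {n : ℕ} [NeZero n] {Q : Type u} [Quiver.{v} Q] (c : StarContraction n Q)

/-- The map from the vertices of `Q^*(n)` to those of `Q`. -/
def ν (z : StarVertex n) : Q := c.vert (Quot.mk _ z)

open Classical in
/-- The dimension vector `d^*` of `Q^*(n)`: the pullback of `d`, except that `d^*(x_0) = 0` if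
`β_0` is contracted. -/
def starDim (d : Q → ℕ) (z : StarVertex n) : ℕ :=
  if StarArrow.beta 0 ∈ c.A ∧ z = StarVertex.x 0 then 0 else d (c.ν z)

theorem starDim_le (d : Q → ℕ) (z : StarVertex n) : c.starDim d z ≤ d (c.ν z) := by
  unfold starDim
  split_ifs <;> simp

open Classical in
/-- The representation `V * 1` of `Q^*(n)`: the contracted arrows act by identity matrices and the
others by the matrices of `V`. If `β_0` is contracted, its matrix has no columns. -/
def extend {k : Type w} [Field k] {d : Q → ℕ} (V : Rep k Q d) :
    Rep k (StarVertex n) (c.starDim d) :=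
  fun p q a => Matrix.of fun i j =>
    if h : a.1 ∈ c.A then (if (i : ℕ) = (j : ℕ) then 1 else 0)
    else V (c.arr (p := Quot.mk _ p) (q := Quot.mk _ q)
        ⟨a.1, h, congrArg (Quot.mk _) a.2.1, congrArg (Quot.mk _) a.2.2⟩)
      (Fin.castLE (c.starDim_le d p) i) (Fin.castLE (c.starDim_le d q) j)

end StarContraction

end TypeD

end

noncomputable section

namespace TypeD

open Module

/-! ### Enumeration of finite chains. -/

section Chains

/-! Acting on row vectors, a representation of `Q^*(n)` is a zigzag X_0 ← Y_0 → X_1 ← Y_1 → ⋯ → X_n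
← Y_n with X_i, Y_i the spaces at x_i, y_i, together with a map g from the space Q at y_0' to X_1.
Ranks are invariant under base change, so the content is that they separate orbits. A rank
determines the dimension of the left kernel, and the left kernel of a zigzag matrix consists of
families of vectors in the Y_i and Q whose components in prescribed X_c cancel.

The arm beyond X_1 leaves a trace on X_1: the chain of subspaces `flag`, obtained from zero or from
a whole space X_{1+j} by going back through preimages under α and images under β. An isomorphism of
X_1 respecting this chain extends along the arm when the relevant dimensions agree
(`exists_equiv_along_arm`). There remain P = ker β_0 and Q, mapping by f and g to X_1 with its
chain. This configuration is classified by the dimensions of F, f⁻¹(F), g⁻¹(F) and of {(p, q) | f p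
+ g q ∈ F, f p ∈ G} for F ≤ G in the chain (`exists_equiv_of_branch`): P carries the two chains
f⁻¹(F) and f⁻¹(F + im g), two chains in one space are determined up to isomorphism by dimensions of
intersections (`exists_equiv_of_two_chains`), and the isomorphism of P then extends to Q and to X_1.
The passage from one space to the next always rests on `exists_relation_lift`, which extends an
isomorphism along a chain of linear relations.

The matrices [γ, δ] yield the dimensions of the flags and of their preimages. The matrices ⟦γ, δ⟧
yield those of the spaces of pairs (`finrank_doubleKer`): for γ = α_i the subspace F comes from δ
and G from i, for γ = β_i it is the other way round.

Using only ker β_0 in place of X_0 ← Y_0 loses nothing. If β_0 is contracted, X_0 is zero and P =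
Y_0; if α_1 is contracted, α_1 is bijective, Y_0 is recovered from X_1, and X_0 from ker β_0
(`exists_equiv_star`). As contracted arrows act by identities, isomorphisms of V*1 and W*1 are the
same as isomorphisms of V and W. The statement for the opposite quiver follows by transposition. A
presentation exists as soon as one short branch points towards the branch point, which holds for the
quiver or for its opposite. -/

theorem exists_monotone_enumeration {α : Type*} [PartialOrder α] [OrderBot α] {C : Set α}
    (hC : C.Finite) (hch : IsChain (· ≤ ·) C) :
    ∃ c : ℕ → α, Monotone c ∧ c 0 = ⊥ ∧ (∀ i, c i = ⊥ ∨ c i ∈ C) ∧ ∀ x ∈ C, ∃ i, c i = x := by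
  suffices H : ∀ m : ℕ, ∀ D : Set α, D.Finite → IsChain (· ≤ ·) D → D.ncard = m →
      ∃ (N : ℕ) (c : ℕ → α), Monotone c ∧ c 0 = ⊥ ∧ (∀ i, c i = ⊥ ∨ c i ∈ D) ∧
        ∀ x ∈ D, ∃ i ≤ N, c i = x by
    obtain ⟨N, c, h1, h2, h3, h4⟩ := H _ C hC hch rfl
    exact ⟨c, h1, h2, h3, fun x hx => let ⟨i, _, hi⟩ := h4 x hx; ⟨i, hi⟩⟩
  intro m
  induction m with
  | zero =>
    intro D hD _ h0
    have : D = ∅ := (Set.ncard_eq_zero hD).1 h0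
    subst this
    exact ⟨0, fun _ => ⊥, monotone_const, rfl, fun _ => Or.inl rfl, by simp⟩
  | succ m ih =>
    intro D hD hch hm
    have hne : D.Nonempty := by
      rw [← Set.ncard_pos hD]; omega
    obtain ⟨M, hM⟩ := hD.exists_maximal hne
    have hmax : ∀ x ∈ D, x ≤ M := fun x hx =>
      (hch.total hx hM.1).elim id (fun h => hM.2 hx h)
    obtain ⟨N, c, h1, h2, h3, h4⟩ := ih (D \ {M}) hD.sdiff (hch.mono Set.sdiff_subset)
      (by rw [Set.ncard_sdiff_singleton_of_mem hM.1, hm]; rfl)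
    have hcM : ∀ i, c i ≤ M := fun i => by
      rcases h3 i with h | h
      · rw [h]; exact bot_le
      · exact hmax _ h.1
    refine ⟨N + 1, fun i => if i ≤ N then c i else M, ?_, by simp [h2], ?_, ?_⟩
    · intro i j hij
      by_cases hj : j ≤ N
      · simp [hj, hij.trans hj, h1 hij]
      · by_cases hi : i ≤ N
        · simp [hi, hj, hcM]
        · simp [hi, hj]
    · intro i
      by_cases hi : i ≤ N
      · simp only [hi, if_true]
        exact (h3 i).imp id (fun h => h.1)
      · simp only [hi, if_false]
        exact Or.inr hM.1
    · intro x hx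
      by_cases hxM : x = M
      · exact ⟨N + 1, le_rfl, by simp [hxM]⟩
      · obtain ⟨i, hi, hix⟩ := h4 x ⟨hx, hxM⟩
        exact ⟨i, by omega, by simp [hi, hix]⟩

end Chains

/-! ### Extending an isomorphism along a chain of linear relations. -/

section LinearAlgebra

variable {k : Type*} [Field k]
variable {X X' Y Y' : Type*} [AddCommGroup X] [Module k X] [AddCommGroup X'] [Module k X']
  [AddCommGroup Y] [Module k Y] [AddCommGroup Y'] [Module k Y']

theorem exists_relative_complement (A B : Submodule k X) :
    ∃ C ≤ B, Disjoint (A ⊓ B) C ∧ (A ⊓ B) ⊔ C = B := by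
  obtain ⟨C, hC⟩ := (A ⊓ B).exists_isCompl
  refine ⟨C ⊓ B, inf_le_right, hC.disjoint.mono_right inf_le_left, ?_⟩
  rw [← sup_inf_assoc_of_le C inf_le_right, hC.sup_eq_top, top_inf_eq]

theorem exists_linearMap_of_disjoint {A C : Submodule k X} (h : Disjoint A C) (f g : X →ₗ[k] X') :
    ∃ l : X →ₗ[k] X', (∀ x ∈ A, l x = f x) ∧ ∀ x ∈ C, l x = g x := by
  obtain ⟨D, hD, hc⟩ := h.exists_isCompl
  refine ⟨LinearMap.ofIsCompl hc (f ∘ₗ D.subtype) (g ∘ₗ C.subtype), fun x hx => ?_, fun x hx => ?_⟩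
  · exact LinearMap.ofIsCompl_apply_left hc (⟨x, hD hx⟩ : D)
  · exact LinearMap.ofIsCompl_apply_right hc (⟨x, hx⟩ : C)

theorem finrank_map_add_finrank_inf_ker [Module.Finite k X] (K : Submodule k X) (f : X →ₗ[k] Y) :
    finrank k (K.map f) + finrank k (K ⊓ f.ker : Submodule k X) = finrank k K := by
  rw [← LinearMap.finrank_range_add_finrank_ker (f.domRestrict K), LinearMap.range_domRestrict,
    LinearMap.ker_domRestrict, ← Submodule.map_comap_subtype,
    LinearEquiv.finrank_eq (Submodule.equivMapOfInjective K.subtype K.injective_subtype _).symm]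

theorem mem_iff_of_forall_mem [Module.Finite k X']
    {B : Submodule k X} {B' : Submodule k X'} (ψ : X ≃ₗ[k] X')
    (hd : finrank k B = finrank k B') (h : B ≤ B'.comap ψ.toLinearMap) (x : X) :
    x ∈ B ↔ ψ x ∈ B' := by
  have : B.map ψ.toLinearMap = B' :=
    Submodule.eq_of_le_of_finrank_eq (Submodule.map_le_iff_le_comap.2 h)
      (by rw [LinearEquiv.finrank_map_eq, hd])
  rw [← this]
  exact ⟨fun hx => ⟨x, hx, rfl⟩, fun ⟨y, hy, e⟩ => ψ.injective e ▸ hy⟩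

theorem finrank_eq_of_mem_iff {B : Submodule k X} {B' : Submodule k X'} (ψ : X ≃ₗ[k] X')
    (h : ∀ x, x ∈ B ↔ ψ x ∈ B') : finrank k B = finrank k B' := by
  have : B = B'.comap ψ.toLinearMap := Submodule.ext h
  rw [this, Submodule.comap_equiv_eq_map_symm, LinearEquiv.finrank_map_eq]

theorem finrank_inf_ker_fst (R : Submodule k (X × Y)) :
    finrank k (R ⊓ (LinearMap.fst k X Y).ker : Submodule k (X × Y)) =
      finrank k (R.comap (LinearMap.inr k X Y)) := by
  rw [LinearEquiv.finrank_eq (Submodule.equivMapOfInjective (LinearMap.inr k X Y)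
    LinearMap.inr_injective (R.comap (LinearMap.inr k X Y))),
    Submodule.map_comap_eq, LinearMap.range_inr, inf_comm]

variable [Module.Finite k X] [Module.Finite k X']

/-- As f is injective on S, complements of S and of f(S) have the same dimension, and any
isomorphism between them completes f. -/
theorem exists_equiv_extending (S : Submodule k X) (f : X →ₗ[k] X')
    (hf : ∀ x ∈ S, f x = 0 → x = 0) (h : finrank k X = finrank k X') :
    ∃ ψ : X ≃ₗ[k] X', ∀ x ∈ S, ψ x = f x := by
  obtain ⟨T, hT⟩ := S.exists_isCompl
  obtain ⟨T', hT'⟩ := (S.map f).exists_isCompl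
  have h1 : finrank k (S.map f) = finrank k S := by
    refine (LinearEquiv.finrank_eq (LinearEquiv.ofBijective (f.submoduleMap S) ⟨?_, ?_⟩)).symm
    · rw [injective_iff_map_eq_zero]
      intro x hx
      exact Subtype.ext (hf x x.2 (congrArg Subtype.val hx))
    · exact f.submoduleMap_surjective S
  have h2 := Submodule.finrank_add_eq_of_isCompl hT
  have h3 := Submodule.finrank_add_eq_of_isCompl hT'
  let e : T ≃ₗ[k] T' := LinearEquiv.ofFinrankEq _ _ (by omega)
  obtain ⟨l, hl, hl'⟩ := exists_linearMap_of_disjoint hT.disjoint f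
    ((LinearMap.exists_extend (T'.subtype ∘ₗ e.toLinearMap)).choose)
  have he : ∀ x (hx : x ∈ T), l x = e ⟨x, hx⟩ := fun x hx => by
    rw [hl' x hx]
    exact LinearMap.congr_fun (LinearMap.exists_extend (T'.subtype ∘ₗ e.toLinearMap)).choose_spec
      ⟨x, hx⟩
  refine ⟨l.linearEquivOfInjective ?_ h, hl⟩
  rw [injective_iff_map_eq_zero]
  intro x hx
  obtain ⟨s, hs, t, ht, rfl⟩ := Submodule.mem_sup.1 (hT.sup_eq_top ▸ Submodule.mem_top : x ∈ S ⊔ T)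
  rw [map_add, hl s hs, he t ht] at hx
  have h0 : f s = 0 := by
    have : f s ∈ S.map f ⊓ T' :=
      ⟨Submodule.mem_map_of_mem hs, by
        rw [SetLike.mem_coe, eq_neg_of_add_eq_zero_left hx]; exact T'.neg_mem (e _).2⟩
    rwa [hT'.inf_eq_bot] at this
  rw [h0, zero_add] at hx
  have : (⟨t, ht⟩ : T) = 0 := e.map_eq_zero_iff.1 (Subtype.ext hx)
  rw [hf s hs h0, zero_add]
  exact congrArg Subtype.val this

/-- Extension of a partial isomorphism to one more subspace. -/
theorem exists_equiv_glue (A B : Submodule k X) (B' : Submodule k X') (ψ : X ≃ₗ[k] X')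
    (h : ∀ x ∈ A, x ∈ B ↔ ψ x ∈ B') (hd : finrank k B = finrank k B') :
    ∃ ψ' : X ≃ₗ[k] X', (∀ x ∈ A, ψ' x = ψ x) ∧ ∀ x, x ∈ B ↔ ψ' x ∈ B' := by
  obtain ⟨C, hCB, hC, hC'⟩ := exists_relative_complement A B
  obtain ⟨D, hDB, hD, hD'⟩ := exists_relative_complement (A.map ψ.toLinearMap) B'
  have hAB : (A ⊓ B).map ψ.toLinearMap = A.map ψ.toLinearMap ⊓ B' := by
    ext y
    constructor
    · rintro ⟨x, ⟨hx, hx'⟩, rfl⟩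
      exact ⟨⟨x, hx, rfl⟩, (h x hx).1 hx'⟩
    · rintro ⟨⟨x, hx, rfl⟩, hx'⟩
      exact ⟨x, ⟨hx, (h x hx).2 hx'⟩, rfl⟩
  have e1 := Submodule.finrank_sup_add_finrank_inf_eq (A ⊓ B) C
  have e2 := Submodule.finrank_sup_add_finrank_inf_eq (A.map ψ.toLinearMap ⊓ B') D
  rw [hC.eq_bot, hC', finrank_bot] at e1
  rw [hD.eq_bot, hD', finrank_bot, ← hAB, LinearEquiv.finrank_map_eq] at e2
  -- C and D complete A ∩ B to B and ψ(A) ∩ B' to B', and have the same dimension. So B is matched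
  -- with B' by ψ on A ∩ B and an arbitrary isomorphism on C.
  let e : C ≃ₗ[k] D := LinearEquiv.ofFinrankEq _ _ (by omega)
  obtain ⟨g, hg⟩ := LinearMap.exists_extend (D.subtype ∘ₗ e.toLinearMap)
  replace hg : ∀ x (hx : x ∈ C), g x = e ⟨x, hx⟩ := fun x hx => LinearMap.congr_fun hg ⟨x, hx⟩
  have hAC : Disjoint A C := by
    rw [Submodule.disjoint_def]
    intro x hA hx
    exact (Submodule.disjoint_def.1 hC) x ⟨hA, hCB hx⟩ hx
  obtain ⟨l, hl, hl'⟩ := exists_linearMap_of_disjoint hAC ψ.toLinearMap g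
  obtain ⟨ψ', hψ'⟩ := exists_equiv_extending (A ⊔ C) l (by
    intro x hx h0
    obtain ⟨s, hs, t, ht, rfl⟩ := Submodule.mem_sup.1 hx
    rw [map_add, hl s hs, hl' t ht, hg t ht] at h0
    have h1 : ((e ⟨t, ht⟩ : D) : X') = 0 := by
      refine (Submodule.disjoint_def.1 hD) _ ⟨⟨-s, A.neg_mem hs, ?_⟩, hDB (e _).2⟩ (e _).2
      rw [map_neg]
      exact neg_eq_of_add_eq_zero_right h0
    have h2 : (⟨t, ht⟩ : C) = 0 := e.map_eq_zero_iff.1 (Subtype.ext h1)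
    rw [h1, add_zero] at h0
    have h3 : s = 0 := ψ.map_eq_zero_iff.1 h0
    rw [h3, zero_add]
    exact congrArg Subtype.val h2) (LinearEquiv.finrank_eq ψ)
  have hA : ∀ x ∈ A, ψ' x = ψ x := fun x hx => by
    rw [hψ' x (Submodule.mem_sup_left hx)]; exact hl x hx
  refine ⟨ψ', hA, mem_iff_of_forall_mem ψ' hd ?_⟩
  rw [← Submodule.map_le_iff_le_comap, ← hC', Submodule.map_sup, sup_le_iff]
  constructor
  · rintro _ ⟨x, hx, rfl⟩
    change ψ' x ∈ B'
    rw [hA x hx.1]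
    exact (h x hx.1).1 hx.2
  · rintro _ ⟨x, hx, rfl⟩
    change ψ' x ∈ B'
    rw [hψ' x (Submodule.mem_sup_right hx), hl' x hx, hg x hx]
    exact hDB (e _).2

variable [Module.Finite k Y] [Module.Finite k Y']

/-- The map ψ may only be changed outside the second projection G of R. The indeterminacy of R₁ is I
= {y | (0, y) ∈ R₁}, and `hM` expresses inside X how I meets G. Once I is matched with I', a vector
y outside G + I goes to any partner of the φ-image of a partner of y. Then `hD` provides such
partners, and `h0` gives injectivity. -/
theorem exists_relation_lift_step {R R₁ : Submodule k (X × Y)} {R' R₁' : Submodule k (X' × Y')}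
    (hR : R ≤ R₁) (hR' : R' ≤ R₁') (φ : X ≃ₗ[k] X') (ψ : Y ≃ₗ[k] Y')
    (hψ : ∀ x y, (x, y) ∈ R ↔ (φ x, ψ y) ∈ R')
    (hM : ∀ x, (∃ y, (x, y) ∈ R ∧ (0, y) ∈ R₁) ↔ ∃ y, (φ x, y) ∈ R' ∧ (0, y) ∈ R₁')
    (hD : ∀ x, (∃ y, (x, y) ∈ R₁) ↔ ∃ y, (φ x, y) ∈ R₁')
    (h0 : ∀ x, (x, 0) ∈ R₁ ↔ (φ x, 0) ∈ R₁')
    (hd : finrank k R₁ = finrank k R₁') :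
    ∃ ψ' : Y ≃ₗ[k] Y', (∀ x y, (x, y) ∈ R → ψ' y = ψ y) ∧
      ∀ x y, (x, y) ∈ R₁ ↔ (φ x, ψ' y) ∈ R₁' := by
  let G : Submodule k Y := R.map (LinearMap.snd k X Y)
  let I : Submodule k Y := R₁.comap (LinearMap.inr k X Y)
  let I' : Submodule k Y' := R₁'.comap (LinearMap.inr k X' Y')
  have hI : finrank k I = finrank k I' := by
    have e1 := finrank_map_add_finrank_inf_ker R₁ (LinearMap.fst k X Y)
    have e2 := finrank_map_add_finrank_inf_ker R₁' (LinearMap.fst k X' Y')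
    have e3 : finrank k (R₁.map (LinearMap.fst k X Y)) =
        finrank k (R₁'.map (LinearMap.fst k X' Y')) := by
      refine finrank_eq_of_mem_iff φ fun x => ?_
      simpa using hD x
    have e4 : finrank k (R₁ ⊓ (LinearMap.fst k X Y).ker : Submodule k (X × Y)) = finrank k I := by
      exact finrank_inf_ker_fst R₁
    have e5 : finrank k (R₁' ⊓ (LinearMap.fst k X' Y').ker : Submodule k (X' × Y')) =
        finrank k I' := by
      exact finrank_inf_ker_fst R₁'
    omega
  have hIm : ∀ y, y ∈ I ↔ (0, y) ∈ R₁ := fun y => Iff.rfl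
  have hIm' : ∀ y, y ∈ I' ↔ (0, y) ∈ R₁' := fun y => Iff.rfl
  -- For y ∈ G ∩ I with partner x, `hM` gives some z ∈ I' which is also a partner of φ x. Then ψ y −
  -- z is related to 0, so ψ y ∈ I'. The converse is symmetric.
  obtain ⟨ψ₁, hψ₁, hψI⟩ := exists_equiv_glue G I I' ψ (by
    rintro y ⟨⟨x, y'⟩, hxy, rfl⟩
    change (0, y') ∈ R₁ ↔ (0, ψ y') ∈ R₁'
    have hxy' := (hψ x y').1 hxy
    constructor
    · intro h
      obtain ⟨z, hz, hz'⟩ := (hM x).1 ⟨y', hxy, h⟩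
      have := R₁'.add_mem (hR' (R'.sub_mem hxy' hz)) hz'
      simpa using this
    · intro h
      obtain ⟨z, hz, hz'⟩ := (hM x).2 ⟨ψ y', hxy', h⟩
      have := R₁.add_mem (hR (R.sub_mem hxy hz)) hz'
      simpa using this) hI
  have section_exists : ∃ σ : Y →ₗ[k] X, ∀ x y, (x, y) ∈ R₁ → (σ y, y) ∈ R₁ := by
    let p := (LinearMap.snd k X Y).submoduleMap R₁
    obtain ⟨s, hs⟩ := p.exists_rightInverse_of_surjective
      (LinearMap.range_eq_top.2 ((LinearMap.snd k X Y).submoduleMap_surjective R₁))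
    obtain ⟨σ, hσ⟩ := LinearMap.exists_extend (LinearMap.fst k X Y ∘ₗ R₁.subtype ∘ₗ s)
    refine ⟨σ, fun x y h => ?_⟩
    let y₁ : R₁.map (LinearMap.snd k X Y) := ⟨y, ⟨(x, y), h, rfl⟩⟩
    have e1 : σ y = (s y₁ : X × Y).1 := LinearMap.congr_fun hσ y₁
    have e2 : (s y₁ : X × Y).2 = y := congrArg Subtype.val (LinearMap.congr_fun hs y₁)
    have : (s y₁ : X × Y) = (σ y, y) := Prod.ext e1.symm e2
    exact this ▸ (s y₁).2
  have section_exists' : ∃ τ : X' →ₗ[k] Y', ∀ x y, (x, y) ∈ R₁' → (x, τ x) ∈ R₁' := by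
    let p := (LinearMap.fst k X' Y').submoduleMap R₁'
    obtain ⟨s, hs⟩ := p.exists_rightInverse_of_surjective
      (LinearMap.range_eq_top.2 ((LinearMap.fst k X' Y').submoduleMap_surjective R₁'))
    obtain ⟨τ, hτ⟩ := LinearMap.exists_extend (LinearMap.snd k X' Y' ∘ₗ R₁'.subtype ∘ₗ s)
    refine ⟨τ, fun x y h => ?_⟩
    let x₁ : R₁'.map (LinearMap.fst k X' Y') := ⟨x, ⟨(x, y), h, rfl⟩⟩
    have e1 : τ x = (s x₁ : X' × Y').2 := LinearMap.congr_fun hτ x₁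
    have e2 : (s x₁ : X' × Y').1 = x := congrArg Subtype.val (LinearMap.congr_fun hs x₁)
    have : (s x₁ : X' × Y') = (x, τ x) := Prod.ext e2 e1.symm
    exact this ▸ (s x₁).2
  obtain ⟨σ, hσ⟩ := section_exists
  obtain ⟨τ, hτ⟩ := section_exists'
  obtain ⟨C, hC⟩ := (G ⊔ I).exists_isCompl
  -- On the complement C the value is chosen through X: σ picks a partner in X, φ moves it, τ picks
  -- a partner in Y'.
  obtain ⟨g, hg, hg'⟩ := exists_linearMap_of_disjoint hC.disjoint ψ₁.toLinearMap
    (τ ∘ₗ φ.toLinearMap ∘ₗ σ)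
  have hgR : ∀ x y, (x, y) ∈ R₁ → (φ x, g y) ∈ R₁' := by
    intro x y hxy
    obtain ⟨y₁, hy₁, c, hc, rfl⟩ :=
      Submodule.mem_sup.1 (hC.sup_eq_top ▸ Submodule.mem_top : y ∈ (G ⊔ I) ⊔ C)
    obtain ⟨z, ⟨⟨q, z'⟩, hqz, rfl⟩, i, hi, rfl⟩ := Submodule.mem_sup.1 hy₁
    have hz' : z' ∈ G := ⟨(q, z'), hqz, rfl⟩
    have h1 : (x - q, c) ∈ R₁ := by
      have := R₁.sub_mem (R₁.sub_mem hxy (hR hqz)) ((hIm i).1 hi)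
      simpa [add_assoc] using this
    have h2 := hσ _ _ h1
    have h3 : (x - q - σ c, (0 : Y)) ∈ R₁ := by
      simpa using R₁.sub_mem h1 h2
    obtain ⟨w, hw⟩ := (hD _).1 ⟨_, h2⟩
    have h4 := R₁'.add_mem (R₁'.add_mem (hR' ((hψ _ _).1 hqz)) ((hIm' _).1 ((hψI i).1 hi)))
      (R₁'.add_mem ((h0 _).1 h3) (hτ _ _ hw))
    have e : g (z' + i + c) = ψ z' + ψ₁ i + τ (φ (σ c)) := by
      rw [map_add, map_add, hg _ (Submodule.mem_sup_left hz'), hg _ (Submodule.mem_sup_right hi),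
        hg' c hc]
      simp [hψ₁ z' hz']
    change (φ x, g (z' + i + c)) ∈ R₁'
    rw [e]
    convert h4 using 1
    simp
  -- If g y = 0 for (x, y) ∈ R₁, then (φ x, 0) ∈ R₁', so (x, 0) ∈ R₁ by `h0` and y ∈ I, where g
  -- agrees with the injective ψ₁.
  obtain ⟨ψ₂, hψ₂⟩ := exists_equiv_extending (R₁.map (LinearMap.snd k X Y)) g (by
    rintro _ ⟨⟨x, y⟩, hxy, rfl⟩ hy
    change g y = 0 at hy
    change y = 0
    have h1 := hgR x y hxy
    rw [hy] at h1
    have h2 := R₁.sub_mem hxy ((h0 x).2 h1)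
    have h3 : y ∈ I := by simpa [hIm] using h2
    rw [hg y (Submodule.mem_sup_right h3)] at hy
    exact ψ₁.map_eq_zero_iff.1 hy) (LinearEquiv.finrank_eq ψ)
  refine ⟨ψ₂, fun x y hxy => ?_, fun x y => ?_⟩
  · have hy : y ∈ G := ⟨(x, y), hxy, rfl⟩
    rw [hψ₂ y ⟨(x, y), hR hxy, rfl⟩, hg y (Submodule.mem_sup_left hy)]
    exact hψ₁ y hy
  · refine mem_iff_of_forall_mem (φ.prodCongr ψ₂) hd ?_ (x, y)
    rintro ⟨x, y⟩ hxy
    change (φ x, ψ₂ y) ∈ R₁'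
    rw [hψ₂ y ⟨(x, y), hxy, rfl⟩]
    exact hgR x y hxy

/-- Lifting of an isomorphism `φ` along a chain of pairs of linear relations. -/
theorem exists_relation_lift (φ : X ≃ₗ[k] X') (hY : finrank k Y = finrank k Y')
    {C : Set (Submodule k (X × Y) × Submodule k (X' × Y'))} (hC : C.Finite)
    (hch : IsChain (· ≤ ·) C)
    (hM : ∀ c ∈ C, ∀ c' ∈ C, c ≤ c' → ∀ x, (∃ y, (x, y) ∈ c.1 ∧ (0, y) ∈ c'.1) ↔
      ∃ y, (φ x, y) ∈ c.2 ∧ (0, y) ∈ c'.2)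
    (hD : ∀ c ∈ C, ∀ x, (∃ y, (x, y) ∈ c.1) ↔ ∃ y, (φ x, y) ∈ c.2)
    (hd : ∀ c ∈ C, finrank k c.1 = finrank k c.2) :
    ∃ ψ : Y ≃ₗ[k] Y', ∀ c ∈ C, ∀ x y, (x, y) ∈ c.1 ↔ (φ x, ψ y) ∈ c.2 := by
  obtain ⟨c, hc, hc0, hcC, hcs⟩ := exists_monotone_enumeration hC hch
  have hbot : ∀ c, (c = ⊥ ∨ c ∈ C) → ∀ x, (∃ y, (x, y) ∈ c.1) ↔ ∃ y, (φ x, y) ∈ c.2 := by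
    rintro c (rfl | h) x
    · simp
    · exact hD c h x
  have hM' : ∀ c c', (c = ⊥ ∨ c ∈ C) → (c' = ⊥ ∨ c' ∈ C) → c ≤ c' →
      ∀ x, (∃ y, (x, y) ∈ c.1 ∧ (0, y) ∈ c'.1) ↔ ∃ y, (φ x, y) ∈ c.2 ∧ (0, y) ∈ c'.2 := by
    rintro c c' (rfl | h) h' hcc x
    · simp only [Prod.fst_bot, Prod.snd_bot, Submodule.mem_bot, Prod.mk_eq_zero,
        LinearEquiv.map_eq_zero_iff]
      constructor
      · rintro ⟨y, ⟨h1, -⟩, -⟩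
        exact ⟨0, ⟨h1, rfl⟩, Submodule.zero_mem _⟩
      · rintro ⟨y, ⟨h1, -⟩, -⟩
        exact ⟨0, ⟨h1, rfl⟩, Submodule.zero_mem _⟩
    · rcases h' with rfl | h'
      · have : c = ⊥ := le_bot_iff.1 hcc
        subst this
        simp
      · exact hM c h c' h' hcc x
  have hd' : ∀ c, (c = ⊥ ∨ c ∈ C) → finrank k c.1 = finrank k c.2 := by
    rintro c (rfl | h)
    · simp
    · exact hd c h
  have main : ∀ N, ∃ ψ : Y ≃ₗ[k] Y', ∀ i ≤ N, ∀ x y, (x, y) ∈ (c i).1 ↔ (φ x, ψ y) ∈ (c i).2 := by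
    intro N
    induction N with
    | zero =>
      refine ⟨LinearEquiv.ofFinrankEq _ _ hY, fun i hi x y => ?_⟩
      obtain rfl : i = 0 := by omega
      simp [hc0]
    | succ N ih =>
      obtain ⟨ψ, hψ⟩ := ih
      have hle := hc (Nat.le_succ N)
      obtain ⟨ψ', h1, h2⟩ := exists_relation_lift_step hle.1 hle.2 φ ψ (hψ N le_rfl)
        (hM' _ _ (hcC _) (hcC _) hle) (hbot _ (hcC _)) (fun x => by
          -- For c = c' the condition in `hM` describes the x with (x, 0) ∈ c: subtract (0, y) from
          -- (x, y).
          have := hM' _ _ (hcC (N + 1)) (hcC (N + 1)) le_rfl x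
          constructor
          · intro h
            obtain ⟨y, hy, hy'⟩ := this.1 ⟨0, h, Submodule.zero_mem _⟩
            simpa using Submodule.sub_mem _ hy hy'
          · intro h
            obtain ⟨y, hy, hy'⟩ := this.2 ⟨0, h, Submodule.zero_mem _⟩
            simpa using Submodule.sub_mem _ hy hy') (hd' _ (hcC _))
      refine ⟨ψ', fun i hi x y => ?_⟩
      rcases Nat.lt_or_ge N i with hi' | hi'
      · obtain rfl : i = N + 1 := by omega
        exact h2 x y
      -- The new ψ' agrees with ψ on the second projection of `c N`, so the smaller relations stay
      -- matched.
      · refine mem_iff_of_forall_mem (φ.prodCongr ψ') (hd' _ (hcC i)) ?_ (x, y)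
        rintro ⟨x, y⟩ hxy
        change (φ x, ψ' y) ∈ (c i).2
        rw [h1 x y ((hc hi').1 hxy)]
        exact (hψ i hi' x y).1 hxy
  rcases C.eq_empty_or_nonempty with rfl | hne
  · exact ⟨LinearEquiv.ofFinrankEq _ _ hY, by simp⟩
  · choose! f hf using hcs
    obtain ⟨N, hN⟩ := (hC.image f).bddAbove
    obtain ⟨ψ, hψ⟩ := main N
    refine ⟨ψ, fun c' hc' => ?_⟩
    have := hψ (f c') (hN ⟨c', hc', rfl⟩)
    rwa [hf c' hc'] at this

end LinearAlgebra

end TypeD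

end

noncomputable section

namespace TypeD

open Module

/-! ### Lifting isomorphisms along linear maps, and pairs of chains. -/

section Lifting

variable {k : Type*} [Field k]
variable {X X' Y Y' : Type*} [AddCommGroup X] [Module k X] [AddCommGroup X'] [Module k X']
  [AddCommGroup Y] [Module k Y] [AddCommGroup Y'] [Module k Y']

theorem IsChain.image_of_monotone {α β : Type*} [PartialOrder α] [PartialOrder β] {C : Set α}
    (h : IsChain (· ≤ ·) C) {f : α → β} (hf : Monotone f) : IsChain (· ≤ ·) (f '' C) := by
  rintro _ ⟨a, ha, rfl⟩ _ ⟨b, hb, rfl⟩ _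
  exact (h.total ha hb).imp (fun h => hf h) (fun h => hf h)

variable [Module.Finite k X] [Module.Finite k X'] [Module.Finite k Y] [Module.Finite k Y']

/-- The relations {(f y, y) | y ∈ c} form a chain with domains f(c). The one for c = ⊤ is the
reversed graph of f, so matching it makes ψ compatible with f and f'. Here (0, y) in a relation
forces f y = 0, so the mixed condition of `exists_relation_lift` only says x = 0. -/
theorem exists_filtered_lift (f : Y →ₗ[k] X) (f' : Y' →ₗ[k] X') (φ : X ≃ₗ[k] X')
    {C : Set (Submodule k Y × Submodule k Y')} (hC : C.Finite) (hch : IsChain (· ≤ ·) C)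
    (htop : ⊤ ∈ C)
    (hf : ∀ c ∈ C, ∀ x, x ∈ c.1.map f ↔ φ x ∈ c.2.map f')
    (hd : ∀ c ∈ C, finrank k c.1 = finrank k c.2) :
    ∃ ψ : Y ≃ₗ[k] Y', (∀ y, f' (ψ y) = φ (f y)) ∧ ∀ c ∈ C, ∀ y, y ∈ c.1 ↔ ψ y ∈ c.2 := by
  let R : Submodule k Y × Submodule k Y' → Submodule k (X × Y) × Submodule k (X' × Y') :=
    fun c => (c.1.map (f.prod LinearMap.id), c.2.map (f'.prod LinearMap.id))
  have hR1 : ∀ c x y, (x, y) ∈ (R c).1 ↔ f y = x ∧ y ∈ c.1 := by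
    intro c x y
    simp only [R, Submodule.mem_map, LinearMap.prod_apply, Function.prod, LinearMap.id_apply,
      Prod.mk.injEq]
    exact ⟨fun ⟨z, hz, h1, h2⟩ => h2 ▸ ⟨h1, hz⟩, fun ⟨h1, h2⟩ => ⟨y, h2, h1, rfl⟩⟩
  have hR2 : ∀ c x y, (x, y) ∈ (R c).2 ↔ f' y = x ∧ y ∈ c.2 := by
    intro c x y
    simp only [R, Submodule.mem_map, LinearMap.prod_apply, Function.prod, LinearMap.id_apply,
      Prod.mk.injEq]
    exact ⟨fun ⟨z, hz, h1, h2⟩ => h2 ▸ ⟨h1, hz⟩, fun ⟨h1, h2⟩ => ⟨y, h2, h1, rfl⟩⟩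
  have hY : finrank k Y = finrank k Y' := by simpa using hd ⊤ htop
  have hmono : Monotone R := fun c c' h => ⟨Submodule.map_mono h.1, Submodule.map_mono h.2⟩
  have hinj : Function.Injective (f.prod (LinearMap.id : Y →ₗ[k] Y)) :=
    fun a b h => congrArg Prod.snd h
  have hinj' : Function.Injective (f'.prod (LinearMap.id : Y' →ₗ[k] Y')) :=
    fun a b h => congrArg Prod.snd h
  obtain ⟨ψ, hψ⟩ := exists_relation_lift φ hY (hC.image R)
    (IsChain.image_of_monotone hch hmono) (by
      rintro _ ⟨c, hc, rfl⟩ _ ⟨c', hc', rfl⟩ - x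
      simp only [hR1, hR2]
      constructor
      · rintro ⟨y, ⟨rfl, -⟩, h, -⟩
        exact ⟨0, by simp [h]⟩
      · rintro ⟨y, ⟨h1, -⟩, h, -⟩
        rw [h1, LinearEquiv.map_eq_zero_iff] at h
        exact ⟨0, by simp [h]⟩) (by
      rintro _ ⟨c, hc, rfl⟩ x
      simp only [hR1, hR2]
      have := hf c hc x
      simpa only [Submodule.mem_map, and_comm] using this) (by
      rintro _ ⟨c, hc, rfl⟩
      simp only [R]
      rw [← LinearEquiv.finrank_eq (Submodule.equivMapOfInjective _ hinj c.1),
        ← LinearEquiv.finrank_eq (Submodule.equivMapOfInjective _ hinj' c.2), hd c hc])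
  have hc : ∀ y, f' (ψ y) = φ (f y) := fun y =>
    ((hR2 ⊤ _ _).1 ((hψ _ ⟨⊤, htop, rfl⟩ (f y) y).1 ((hR1 _ _ _).2 ⟨rfl, trivial⟩))).1
  refine ⟨ψ, hc, fun c hcC y => ?_⟩
  have := hψ _ ⟨c, hcC, rfl⟩ (f y) y
  simpa [hR1, hR2, hc] using this

/-- The relations {(y, x) | x − α y ∈ c} form a chain; the one for c = ⊥ is the graph of α, which
gives compatibility with the maps, and the fibre over 0 is c itself. -/
theorem exists_filtered_colift (α : Y →ₗ[k] X) (α' : Y' →ₗ[k] X') (φ : Y ≃ₗ[k] Y')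
    (hX : finrank k X = finrank k X')
    {C : Set (Submodule k X × Submodule k X')} (hC : C.Finite) (hch : IsChain (· ≤ ·) C)
    (hbot : ⊥ ∈ C)
    (hα : ∀ c ∈ C, ∀ y, α y ∈ c.1 ↔ α' (φ y) ∈ c.2)
    (hd : ∀ c ∈ C, finrank k c.1 = finrank k c.2) :
    ∃ ψ : X ≃ₗ[k] X', (∀ y, ψ (α y) = α' (φ y)) ∧ ∀ c ∈ C, ∀ x, x ∈ c.1 ↔ ψ x ∈ c.2 := by
  let R : Submodule k X × Submodule k X' → Submodule k (Y × X) × Submodule k (Y' × X') :=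
    fun c => (c.1.comap (LinearMap.snd k Y X - α ∘ₗ LinearMap.fst k Y X),
      c.2.comap (LinearMap.snd k Y' X' - α' ∘ₗ LinearMap.fst k Y' X'))
  have hR1 : ∀ c y x, (y, x) ∈ (R c).1 ↔ x - α y ∈ c.1 := fun c y x => Iff.rfl
  have hR2 : ∀ c y x, (y, x) ∈ (R c).2 ↔ x - α' y ∈ c.2 := fun c y x => Iff.rfl
  have hmono : Monotone R := fun c c' h => ⟨Submodule.comap_mono h.1, Submodule.comap_mono h.2⟩
  have hY := LinearEquiv.finrank_eq φ
  obtain ⟨ψ, hψ⟩ := exists_relation_lift φ hX (hC.image R)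
    (IsChain.image_of_monotone hch hmono) (by
      rintro _ ⟨c, hc, rfl⟩ _ ⟨c', hc', rfl⟩ hle y
      have hle' : (R c).1 ≤ (R c').1 ∧ (R c).2 ≤ (R c').2 := hle
      simp only [hR1, hR2, map_zero, sub_zero]
      constructor
      · rintro ⟨x, h1, h2⟩
        have h3 := c'.1.sub_mem h2 (hle'.1 (show (y, x) ∈ (R c).1 from h1))
        exact ⟨α' (φ y), by simp, (hα c' hc' y).1 (by simpa using h3)⟩
      · rintro ⟨x, h1, h2⟩
        have h3 := c'.2.sub_mem h2 (hle'.2 (show (φ y, x) ∈ (R c).2 from h1))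
        exact ⟨α y, by simp, (hα c' hc' y).2 (by simpa using h3)⟩) (by
      rintro _ ⟨c, hc, rfl⟩ y
      simp only [hR1, hR2]
      exact iff_of_true ⟨α y, by simp⟩ ⟨α' (φ y), by simp⟩) (by
      rintro _ ⟨c, hc, rfl⟩
      have e1 := finrank_map_add_finrank_inf_ker (R c).1 (LinearMap.fst k Y X)
      have e2 := finrank_map_add_finrank_inf_ker (R c).2 (LinearMap.fst k Y' X')
      rw [finrank_inf_ker_fst] at e1 e2
      have e3 : (R c).1.map (LinearMap.fst k Y X) = ⊤ :=
        Submodule.eq_top_iff'.2 fun y => ⟨(y, α y), by simp [hR1], rfl⟩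
      have e4 : (R c).2.map (LinearMap.fst k Y' X') = ⊤ :=
        Submodule.eq_top_iff'.2 fun y => ⟨(y, α' y), by simp [hR2], rfl⟩
      have e5 : (R c).1.comap (LinearMap.inr k Y X) = c.1 := by
        ext x; simp [R]
      have e6 : (R c).2.comap (LinearMap.inr k Y' X') = c.2 := by
        ext x; simp [R]
      rw [e3, e5, finrank_top, hd c hc] at e1
      rw [e4, e6, finrank_top] at e2
      omega)
  have hc : ∀ y, ψ (α y) = α' (φ y) := fun y => by
    have := (hψ _ ⟨⊥, hbot, rfl⟩ y (α y)).1 (by simp [hR1])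
    rw [hR2] at this
    exact sub_eq_zero.1 this
  refine ⟨ψ, hc, fun c hcC x => ?_⟩
  have := hψ _ ⟨c, hcC, rfl⟩ 0 x
  simpa [hR1, hR2] using this

/-- Two chains of subspaces are classified by the dimensions of intersections. -/
theorem exists_equiv_of_two_chains {A B : Set (Submodule k X × Submodule k X')}
    (hA : A.Finite) (hA' : IsChain (· ≤ ·) A) (hB : B.Finite) (hB' : IsChain (· ≤ ·) B)
    (hAtop : ⊤ ∈ A) (hBtop : ⊤ ∈ B)
    (hd : ∀ a ∈ A, ∀ b ∈ B, finrank k (a.1 ⊓ b.1 : Submodule k X) =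
      finrank k (a.2 ⊓ b.2 : Submodule k X')) :
    ∃ ψ : X ≃ₗ[k] X', (∀ a ∈ A, ∀ x, x ∈ a.1 ↔ ψ x ∈ a.2) ∧
      ∀ b ∈ B, ∀ x, x ∈ b.1 ↔ ψ x ∈ b.2 := by
  have hX : finrank k X = finrank k X' := by
    have h := hd ⊤ hAtop ⊤ hBtop
    rwa [Prod.fst_top, Prod.snd_top, top_inf_eq, top_inf_eq, finrank_top, finrank_top] at h
  obtain ⟨c, hc, hc0, hcB, hcs⟩ := exists_monotone_enumeration hB hB'
  have hdc : ∀ a ∈ A, ∀ i, finrank k (a.1 ⊓ (c i).1 : Submodule k X) =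
      finrank k (a.2 ⊓ (c i).2 : Submodule k X') := by
    intro a ha i
    rcases hcB i with h | h
    · rw [h, Prod.fst_bot, Prod.snd_bot, inf_bot_eq, inf_bot_eq, finrank_bot, finrank_bot]
    · exact hd a ha _ h
  have main : ∀ N, ∃ ψ : X ≃ₗ[k] X', ∀ i ≤ N, ∀ a ∈ A, ∀ x,
      x ∈ a.1 ⊓ (c i).1 ↔ ψ x ∈ a.2 ⊓ (c i).2 := by
    intro N
    induction N with
    | zero =>
      refine ⟨LinearEquiv.ofFinrankEq _ _ hX, fun i hi a _ x => ?_⟩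
      obtain rfl : i = 0 := by omega
      simp [hc0]
    | succ N ih =>
      obtain ⟨ψ, hψ⟩ := ih
      have hψN : ∀ x, x ∈ (c N).1 ↔ ψ x ∈ (c N).2 := by simpa using hψ N le_rfl ⊤ hAtop
      let e : (c N).1 ≃ₗ[k] (c N).2 := LinearEquiv.ofSubmodules ψ _ _ (by
        ext y
        constructor
        · rintro ⟨x, hx, rfl⟩
          exact (hψN x).1 hx
        · intro hy
          refine ⟨ψ.symm y, (hψN _).2 (by simpa using hy), by simp⟩)
      have he : ∀ x, (e x : X') = ψ x := fun x => rfl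
      -- The isomorphism on c_N is extended along the inclusion c_N → X so as to respect the trace
      -- of A on c_{N+1}; ⊥ is added since the graph itself must be matched.
      let D : Set (Submodule k X × Submodule k X') := insert ⊥ ((fun a => a ⊓ c (N + 1)) '' A)
      obtain ⟨ψ', h1, h2⟩ := exists_filtered_colift (C := D) (c N).1.subtype (c N).2.subtype e hX
        ((hA.image _).insert _) ((IsChain.image_of_monotone hA'
          (fun a b h => inf_le_inf_right _ h)).insert (fun b _ _ => Or.inl bot_le))
        (Set.mem_insert _ _) (by
          rintro d (rfl | ⟨a, ha, rfl⟩) y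
          · simp [he]
          · simp only [Submodule.subtype_apply, he, Prod.fst_inf, Prod.snd_inf, Submodule.mem_inf]
            have h1 := hψ N le_rfl a ha y
            have h2 : (y : X) ∈ (c N).1 := y.2
            have h3 : ψ (y : X) ∈ (c N).2 := (hψN _).1 h2
            have h4 := (hc (Nat.le_succ N)).1 h2
            have h5 := (hc (Nat.le_succ N)).2 h3
            simp only [Submodule.mem_inf, h2, h3, and_true] at h1
            simp only [h1, Nat.succ_eq_add_one] at *
            simp [h4, h5]) (by
          rintro d (rfl | ⟨a, ha, rfl⟩)
          · simp
          · exact hdc a ha _)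
      refine ⟨ψ', fun i hi a ha x => ?_⟩
      rcases Nat.lt_or_ge N i with hi' | hi'
      · obtain rfl : i = N + 1 := by omega
        exact h2 _ (Or.inr ⟨a, ha, rfl⟩) x
      · refine mem_iff_of_forall_mem ψ' (hdc a ha i) ?_ x
        intro x hx
        have hx' : x ∈ (c N).1 := (hc hi').1 hx.2
        have := h1 ⟨x, hx'⟩
        change ψ' x = ψ x at this
        rw [Submodule.mem_comap, LinearEquiv.coe_coe, this]
        exact (hψ i hi' a ha x).1 hx
  choose! f hf using hcs
  obtain ⟨N, hN⟩ := (hB.image f).bddAbove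
  obtain ⟨ψ, hψ⟩ := main N
  have hfin : ∀ a ∈ A, ∀ b ∈ B, ∀ x, x ∈ a.1 ⊓ b.1 ↔ ψ x ∈ a.2 ⊓ b.2 := fun a ha b hb => by
    have := hψ (f b) (hN ⟨b, hb, rfl⟩) a ha
    rwa [hf b hb] at this
  exact ⟨ψ, fun a ha x => by simpa using hfin a ha ⊤ hBtop x,
    fun b hb x => by simpa using hfin ⊤ hAtop b hb x⟩

end Lifting

end TypeD

end

noncomputable section

namespace TypeD

open Module

/-! ### Two maps into a space with a chain of subspaces. -/

section Branch

variable {k : Type*} [Field k]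
variable {P P' Q Q' U U' : Type*} [AddCommGroup P] [Module k P] [AddCommGroup P'] [Module k P']
  [AddCommGroup Q] [Module k Q] [AddCommGroup Q'] [Module k Q']
  [AddCommGroup U] [Module k U] [AddCommGroup U'] [Module k U']

/-- The pairs `(p, q)` with `f p + g q ∈ F` and `f p ∈ G`. -/
def pairSub (f : P →ₗ[k] U) (g : Q →ₗ[k] U) (F G : Submodule k U) : Submodule k (P × Q) :=
  F.comap (f.coprod g) ⊓ G.comap (f ∘ₗ LinearMap.fst k P Q)

theorem mem_pairSub {f : P →ₗ[k] U} {g : Q →ₗ[k] U} {F G : Submodule k U} {p : P} {q : Q} :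
    (p, q) ∈ pairSub f g F G ↔ f p + g q ∈ F ∧ f p ∈ G := by
  simp [pairSub]

theorem mem_comap_sup_range {f : P →ₗ[k] U} {g : Q →ₗ[k] U} {F : Submodule k U} {p : P} :
    p ∈ (F ⊔ LinearMap.range g).comap f ↔ ∃ q, f p + g q ∈ F := by
  rw [Submodule.mem_comap, Submodule.mem_sup]
  constructor
  · rintro ⟨u, hu, _, ⟨q, rfl⟩, h⟩
    exact ⟨-q, by rw [← h]; simpa using hu⟩
  · rintro ⟨q, hq⟩
    exact ⟨_, hq, _, ⟨-q, rfl⟩, by simp⟩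

/-- If f p + g q lies in F, it lies in G as well, so g q ∈ G amounts to f p ∈ G. This splits the
mixed condition of `exists_relation_lift` into one condition for each of the two chains in P. -/
theorem exists_mem_pair_iff (f : P →ₗ[k] U) (g : Q →ₗ[k] U) {F G : Submodule k U}
    (h : F.comap (f.coprod g) ≤ G.comap (f.coprod g)) {p : P} :
    (∃ q, f p + g q ∈ F ∧ f 0 + g q ∈ G) ↔ (∃ q, f p + g q ∈ F) ∧ f p ∈ G := by
  have h' : ∀ q, f p + g q ∈ F → f p + g q ∈ G := fun q hq => by
    simpa using @h (p, q) (by simpa using hq)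
  constructor
  · rintro ⟨q, h1, h2⟩
    exact ⟨⟨q, h1⟩, by simpa using G.sub_mem (h' q h1) h2⟩
  · rintro ⟨⟨q, h1⟩, h2⟩
    exact ⟨q, h1, by simpa using G.sub_mem (h' q h1) h2⟩

variable [Module.Finite k P] [Module.Finite k P'] [Module.Finite k Q] [Module.Finite k Q']

/-- Project to P: the image is the intersection and the fibre is g⁻¹(F). Thus dimensions of pair
spaces give those of the intersections f⁻¹(G) ∩ f⁻¹(F + im g). -/
theorem finrank_pairSub (f : P →ₗ[k] U) (g : Q →ₗ[k] U) (F G : Submodule k U) :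
    finrank k (G.comap f ⊓ (F ⊔ LinearMap.range g).comap f : Submodule k P) +
      finrank k (F.comap g) = finrank k (pairSub f g F G) := by
  rw [← finrank_map_add_finrank_inf_ker (pairSub f g F G) (LinearMap.fst k P Q),
    finrank_inf_ker_fst]
  have e1 : (pairSub f g F G).map (LinearMap.fst k P Q) =
      G.comap f ⊓ (F ⊔ LinearMap.range g).comap f := by
    ext p
    rw [Submodule.mem_inf, mem_comap_sup_range]
    constructor
    · rintro ⟨⟨p, q⟩, hpq, rfl⟩
      exact ⟨(mem_pairSub.1 hpq).2, q, (mem_pairSub.1 hpq).1⟩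
    · rintro ⟨h1, q, hq⟩
      exact ⟨(p, q), mem_pairSub.2 ⟨hq, h1⟩, rfl⟩
  have e2 : (pairSub f g F G).comap (LinearMap.inr k P Q) = F.comap g := by
    ext q
    rw [Submodule.mem_comap, LinearMap.inr_apply, mem_pairSub]
    simp
  rw [e1, e2]

variable [Module.Finite k U] [Module.Finite k U']

/-- Two linear maps to a space with a chain of subspaces are classified by dimensions. -/
theorem exists_equiv_of_branch (f : P →ₗ[k] U) (g : Q →ₗ[k] U) (f' : P' →ₗ[k] U')
    (g' : Q' →ₗ[k] U') {C : Set (Submodule k U × Submodule k U')} (hC : C.Finite)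
    (hch : IsChain (· ≤ ·) C) (hbot : ⊥ ∈ C) (htop : ⊤ ∈ C)
    (hU : ∀ c ∈ C, finrank k c.1 = finrank k c.2)
    (hP : ∀ c ∈ C, finrank k (c.1.comap f) = finrank k (c.2.comap f'))
    (hQ : ∀ c ∈ C, finrank k (c.1.comap g) = finrank k (c.2.comap g'))
    (hPQ : ∀ c ∈ C, ∀ c' ∈ C, c ≤ c' →
      finrank k (pairSub f g c.1 c'.1) = finrank k (pairSub f' g' c.2 c'.2)) :
    ∃ (φP : P ≃ₗ[k] P') (φQ : Q ≃ₗ[k] Q') (φU : U ≃ₗ[k] U'),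
      (∀ p, φU (f p) = f' (φP p)) ∧ (∀ q, φU (g q) = g' (φQ q)) ∧
      ∀ c ∈ C, ∀ u, u ∈ c.1 ↔ φU u ∈ c.2 := by
  let a : Submodule k U × Submodule k U' → Submodule k P × Submodule k P' :=
    fun c => (c.1.comap f, c.2.comap f')
  let b : Submodule k U × Submodule k U' → Submodule k P × Submodule k P' :=
    fun c => ((c.1 ⊔ LinearMap.range g).comap f, (c.2 ⊔ LinearMap.range g').comap f')
  have ha : Monotone a := fun c c' h => ⟨Submodule.comap_mono h.1, Submodule.comap_mono h.2⟩
  have hb : Monotone b := fun c c' h => ⟨Submodule.comap_mono (sup_le_sup_right h.1 _),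
    Submodule.comap_mono (sup_le_sup_right h.2 _)⟩
  have hab : ∀ c c', c ≤ c' → a c ≤ b c' := fun c c' h =>
    ⟨Submodule.comap_mono (h.1.trans le_sup_left), Submodule.comap_mono (h.2.trans le_sup_left)⟩
  obtain ⟨φP, hφa, hφb⟩ := exists_equiv_of_two_chains (A := a '' C) (B := b '' C) (hC.image a)
    (IsChain.image_of_monotone hch ha) (hC.image b) (IsChain.image_of_monotone hch hb)
    ⟨⊤, htop, rfl⟩ ⟨⊤, htop, by simp [b]; rfl⟩ (by
      rintro _ ⟨c, hc, rfl⟩ _ ⟨c', hc', rfl⟩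
      -- For c ≤ c' the intersection is just f⁻¹(c); only the case c' ≤ c uses the pair spaces.
      rcases hch.total hc hc' with h | h
      · have := hab _ _ h
        rw [inf_eq_left.2 this.1, inf_eq_left.2 this.2]
        exact hP c hc
      · have h1 := finrank_pairSub f g c'.1 c.1
        have h2 := finrank_pairSub f' g' c'.2 c.2
        rw [hPQ c' hc' c hc h, ← h2, hQ c' hc'] at h1
        exact Nat.add_right_cancel h1)
  have hφa' : ∀ c ∈ C, ∀ p, f p ∈ c.1 ↔ f' (φP p) ∈ c.2 := fun c hc => hφa _ ⟨c, hc, rfl⟩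
  have hφb' : ∀ c ∈ C, ∀ p, (∃ q, f p + g q ∈ c.1) ↔ ∃ q, f' (φP p) + g' q ∈ c.2 :=
    fun c hc p => by
      have := hφb _ ⟨c, hc, rfl⟩ p
      simp only [b] at this
      rwa [mem_comap_sup_range, mem_comap_sup_range] at this
  have hQtop : finrank k Q = finrank k Q' := by
    have := hQ ⊤ htop
    rwa [Prod.fst_top, Prod.snd_top, Submodule.comap_top, Submodule.comap_top, finrank_top,
      finrank_top] at this
  have hUtop : finrank k U = finrank k U' := by
    have := hU ⊤ htop
    rwa [Prod.fst_top, Prod.snd_top, finrank_top, finrank_top] at this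
  let r : Submodule k U × Submodule k U' → Submodule k (P × Q) × Submodule k (P' × Q') :=
    fun c => (c.1.comap (f.coprod g), c.2.comap (f'.coprod g'))
  have hr : Monotone r := fun c c' h => ⟨Submodule.comap_mono h.1, Submodule.comap_mono h.2⟩
  have hr1 : ∀ c p q, (p, q) ∈ (r c).1 ↔ f p + g q ∈ c.1 := fun c p q => by simp [r]
  have hr2 : ∀ c p q, (p, q) ∈ (r c).2 ↔ f' p + g' q ∈ c.2 := fun c p q => by simp [r]
  obtain ⟨φQ, hφQ⟩ := exists_relation_lift (C := r '' C) φP hQtop (hC.image r)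
    (IsChain.image_of_monotone hch hr) (by
      rintro _ ⟨c, hc, rfl⟩ _ ⟨c', hc', rfl⟩ hle p
      simp only [hr1, hr2]
      rw [exists_mem_pair_iff f g hle.1, exists_mem_pair_iff f' g' hle.2, hφb' c hc,
        hφa' c' hc']) (by
      rintro _ ⟨c, hc, rfl⟩ p
      simpa only [hr1, hr2] using hφb' c hc p) (by
      rintro _ ⟨c, hc, rfl⟩
      have := hPQ c hc ⊤ htop le_top
      rwa [Prod.fst_top, Prod.snd_top, pairSub, pairSub, Submodule.comap_top, Submodule.comap_top,
        inf_top_eq, inf_top_eq] at this)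
  -- The isomorphism φP × φQ is carried to U along (p, q) ↦ f p + g q.
  obtain ⟨φU, hφU, hφC⟩ := exists_filtered_colift (f.coprod g) (f'.coprod g')
    (φP.prodCongr φQ) hUtop hC hch hbot (by
      rintro c hc ⟨p, q⟩
      have := hφQ _ ⟨c, hc, rfl⟩ p q
      rwa [hr1, hr2] at this) hU
  refine ⟨φP, φQ, φU, fun p => ?_, fun q => ?_, hφC⟩
  · simpa using hφU (p, 0)
  · simpa using hφU (0, q)

end Branch

/-! ### The flags of an arm, and extension along the arm. -/

section Arm

variable {k : Type*} [Field k] {X Y : ℕ → Type*} [∀ i, AddCommGroup (X i)] [∀ i, Module k (X i)]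
  [∀ i, AddCommGroup (Y i)] [∀ i, Module k (Y i)]

/-- The subspaces of `X i` cut out by the zigzags `X i ← Y i → X (i + 1) ← Y (i + 1) → ⋯` of
length `j` that end freely (`s = true`) or in zero (`s = false`). -/
def flag (b : ∀ i, Y i →ₗ[k] X i) (a : ∀ i, Y i →ₗ[k] X (i + 1)) (s : Bool) :
    ℕ → ∀ i, Submodule k (X i)
  | 0, _ => if s then ⊤ else ⊥
  | j + 1, i => ((flag b a s j (i + 1)).comap (a i)).map (b i)

/-- The order of the subspaces `flag b a s j i` for fixed `i`. -/
def FlagLE : Bool × ℕ → Bool × ℕ → Prop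
  | (false, j), (false, l) => j ≤ l
  | (false, _), (true, _) => True
  | (true, _), (false, _) => False
  | (true, j), (true, l) => l ≤ j

theorem FlagLE.total (p q : Bool × ℕ) : FlagLE p q ∨ FlagLE q p := by
  obtain ⟨s, j⟩ := p
  obtain ⟨t, l⟩ := q
  cases s <;> cases t <;> simp [FlagLE] <;> omega

/-- Lengthening a zigzag enlarges the subspace if the zigzag ends in zero and shrinks it if it ends
freely. Comparing two flags, a common step can be stripped off until one of them is ⊥ or ⊤. -/
theorem flag_mono (b : ∀ i, Y i →ₗ[k] X i) (a : ∀ i, Y i →ₗ[k] X (i + 1)) {p q : Bool × ℕ}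
    (h : FlagLE p q) (i : ℕ) : flag b a p.1 p.2 i ≤ flag b a q.1 q.2 i := by
  obtain ⟨s, j⟩ := p
  obtain ⟨t, l⟩ := q
  induction j generalizing l i with
  | zero =>
    cases s
    · simp [flag]
    · cases t
      · exact h.elim
      · obtain rfl : l = 0 := by simpa [FlagLE] using h
        exact le_rfl
  | succ j ih =>
    cases l with
    | zero =>
      cases t
      · cases s <;> simp [FlagLE] at h
      · simp [flag]
    | succ l =>
      refine Submodule.map_mono (Submodule.comap_mono (ih (i + 1) l ?_))
      cases s <;> cases t <;> simp_all [FlagLE]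

theorem flag_eq_of_subsingleton (b : ∀ i, Y i →ₗ[k] X i) (a : ∀ i, Y i →ₗ[k] X (i + 1))
    (s t : Bool) (j i : ℕ) (h : Subsingleton (X (i + j))) :
    flag b a s j i = flag b a t j i := by
  induction j generalizing i with
  | zero =>
    have : Subsingleton (X i) := h
    exact Subsingleton.elim _ _
  | succ j ih =>
    simp only [flag]
    rw [ih (i + 1) (by rwa [Nat.add_right_comm])]

/-- The pairs of subspaces `flag b a s j i`, `flag b' a' s j i` with `j ≤ r`. -/
def flagPairs (b b' : ∀ i, Y i →ₗ[k] X i) (a a' : ∀ i, Y i →ₗ[k] X (i + 1)) (r i : ℕ) :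
    Set (Submodule k (X i) × Submodule k (X i)) :=
  (fun p : Bool × ℕ => (flag b a p.1 p.2 i, flag b' a' p.1 p.2 i)) '' {p | p.2 ≤ r}

variable (b b' : ∀ i, Y i →ₗ[k] X i) (a a' : ∀ i, Y i →ₗ[k] X (i + 1))

theorem flagPairs_finite (r i : ℕ) : (flagPairs b b' a a' r i).Finite := by
  refine Set.Finite.image _ ?_
  refine (Set.Finite.prod (Set.finite_univ (α := Bool)) (Set.finite_Iic r)).subset ?_
  rintro ⟨s, j⟩ h
  exact ⟨trivial, h⟩

theorem flagPairs_isChain (r i : ℕ) : IsChain (· ≤ ·) (flagPairs b b' a a' r i) := by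
  rintro _ ⟨p, _, rfl⟩ _ ⟨q, _, rfl⟩ _
  exact (FlagLE.total p q).imp (fun h => ⟨flag_mono b a h i, flag_mono b' a' h i⟩)
    (fun h => ⟨flag_mono b a h i, flag_mono b' a' h i⟩)

theorem bot_mem_flagPairs (r i : ℕ) : ⊥ ∈ flagPairs b b' a a' r i :=
  ⟨(false, 0), Nat.zero_le _, rfl⟩

theorem top_mem_flagPairs (r i : ℕ) : ⊤ ∈ flagPairs b b' a a' r i :=
  ⟨(true, 0), Nat.zero_le _, rfl⟩

variable [∀ i, Module.Finite k (X i)] [∀ i, Module.Finite k (Y i)]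

/-- Isomorphisms which preserve the flags extend along an arm. -/
theorem exists_equiv_along_arm (r i : ℕ) (φ : X i ≃ₗ[k] X i)
    (hφ : ∀ c ∈ flagPairs b b' a a' r i, ∀ x, x ∈ c.1 ↔ φ x ∈ c.2)
    (hX : ∀ s j l, i ≤ l → l + j ≤ i + r →
      finrank k (flag b a s j l) = finrank k (flag b' a' s j l))
    (hY : ∀ s j l, i ≤ l → l + j < i + r →
      finrank k ((flag b a s j (l + 1)).comap (a l)) =
        finrank k ((flag b' a' s j (l + 1)).comap (a' l))) :
    ∃ (φX : ∀ l, X l ≃ₗ[k] X l) (φY : ∀ l, Y l ≃ₗ[k] Y l), φX i = φ ∧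
      ∀ l, i ≤ l → l < i + r → ∀ y, φX l (b l y) = b' l (φY l y) ∧
        φX (l + 1) (a l y) = a' l (φY l y) := by
  induction r generalizing i with
  | zero =>
    refine ⟨Function.update (fun l => LinearEquiv.refl k (X l)) i φ,
      fun l => LinearEquiv.refl k (Y l), by simp, fun l h1 h2 => by omega⟩
  | succ r ih =>
    let G : Submodule k (X (i + 1)) × Submodule k (X (i + 1)) →
        Submodule k (Y i) × Submodule k (Y i) := fun c => (c.1.comap (a i), c.2.comap (a' i))
    have hG : Monotone G := fun c c' h => ⟨Submodule.comap_mono h.1, Submodule.comap_mono h.2⟩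
    -- The image under `b i` of the preimage of a flag of length j in X (i + 1) is the flag of
    -- length j + 1 in X i. Hence flags of length at most r + 1 in X i control those of length at
    -- most r one place further.
    obtain ⟨ψ, h1, h2⟩ := exists_filtered_lift (C := G '' flagPairs b b' a a' r (i + 1))
      (b i) (b' i) φ ((flagPairs_finite b b' a a' r (i + 1)).image G)
      (IsChain.image_of_monotone (flagPairs_isChain b b' a a' r (i + 1)) hG)
      ⟨⊤, top_mem_flagPairs b b' a a' r (i + 1), rfl⟩ (by
        rintro _ ⟨_, ⟨⟨s, j⟩, hj, rfl⟩, rfl⟩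
        exact hφ _ ⟨(s, j + 1), Nat.succ_le_succ hj, rfl⟩) (by
        rintro _ ⟨_, ⟨⟨s, j⟩, hj, rfl⟩, rfl⟩
        have : j ≤ r := hj
        exact hY s j i le_rfl (by omega))
    obtain ⟨φ₁, h3, h4⟩ := exists_filtered_colift (C := flagPairs b b' a a' r (i + 1))
      (a i) (a' i) ψ rfl (flagPairs_finite b b' a a' r (i + 1))
      (flagPairs_isChain b b' a a' r (i + 1)) (bot_mem_flagPairs b b' a a' r (i + 1))
      (fun c hc => h2 _ ⟨c, hc, rfl⟩) (by
        rintro _ ⟨⟨s, j⟩, hj, rfl⟩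
        have : j ≤ r := hj
        exact hX s j (i + 1) (by omega) (by omega))
    obtain ⟨φX, φY, h5, h6⟩ := ih (i + 1) φ₁ h4
      (fun s j l hl hl' => hX s j l (by omega) (by omega))
      (fun s j l hl hl' => hY s j l (by omega) (by omega))
    refine ⟨Function.update φX i φ, Function.update φY i ψ, by simp, fun l hl hl' y => ?_⟩
    rcases hl.eq_or_lt with rfl | hlt
    · simp [h1, h3, h5]
    · rw [Function.update_of_ne (by omega), Function.update_of_ne (by omega),
        Function.update_of_ne (by omega)]
      exact h6 l hlt (by omega) y

end Arm

end TypeD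

end

noncomputable section

namespace TypeD

open Module

theorem finrank_congr {k M : Type*} [Field k] [AddCommGroup M] [Module k M] {A B : Submodule k M}
    (h : A = B) : finrank k A = finrank k B := h ▸ rfl

/-! ### Kernels of zigzag matrices in terms of flags. -/

section ChainKernels

variable {k : Type*} [Field k] {X Y : ℕ → Type*} [∀ i, AddCommGroup (X i)] [∀ i, Module k (X i)]
  [∀ i, AddCommGroup (Y i)] [∀ i, Module k (Y i)]
  (b b' : ∀ i, Y i →ₗ[k] X i) (a a' : ∀ i, Y i →ₗ[k] X (i + 1))

/-- The component at `X c` of the image of a family of vectors of the spaces `Y i`. -/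
def column : ∀ c, (∀ i, Y i) →ₗ[k] X c
  | 0 => b 0 ∘ₗ LinearMap.proj 0
  | c + 1 => a c ∘ₗ LinearMap.proj c + b (c + 1) ∘ₗ LinearMap.proj (c + 1)

@[simp]
theorem column_zero (y : ∀ i, Y i) : column b a 0 y = b 0 (y 0) := rfl

@[simp]
theorem column_succ (c : ℕ) (y : ∀ i, Y i) :
    column b a (c + 1) y = a c (y c) + b (c + 1) (y (c + 1)) := rfl

theorem column_single (i c : ℕ) (u : Y i) :
    column b a c (Pi.single i u) =
      Pi.single (M := X) i (b i u) c + Pi.single (M := X) (i + 1) (a i u) c := by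
  cases c with
  | zero =>
    rcases eq_or_ne i 0 with rfl | h
    · simp
    · simp [Pi.single_eq_of_ne h.symm]
  | succ c =>
    rcases eq_or_ne i c with rfl | h
    · simp
    · rcases eq_or_ne i (c + 1) with rfl | h'
      · simp
      · simp [Pi.single_eq_of_ne h.symm, Pi.single_eq_of_ne h'.symm,
          Pi.single_eq_of_ne (show c + 1 ≠ i + 1 by omega)]

/-- The families with support in `[lo, hi)` whose columns in `[clo, chi)` vanish. -/
def chainKer (lo hi clo chi : ℕ) : Submodule k (∀ i, Y i) where
  carrier := {y | (∀ i, i < lo ∨ hi ≤ i → y i = 0) ∧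
    ∀ c, clo ≤ c → c < chi → column b a c y = 0}
  zero_mem' := by simp
  add_mem' := by
    rintro y z ⟨h1, h2⟩ ⟨h3, h4⟩
    exact ⟨fun i hi => by simp [h1 i hi, h3 i hi],
      fun c hc hc' => by rw [map_add, h2 c hc hc', h4 c hc hc', add_zero]⟩
  smul_mem' := by
    rintro t y ⟨h1, h2⟩
    exact ⟨fun i hi => by simp [h1 i hi],
      fun c hc hc' => by rw [map_smul, h2 c hc hc', smul_zero]⟩

variable {b a}

theorem mem_chainKer {lo hi clo chi : ℕ} {y : ∀ i, Y i} :
    y ∈ chainKer b a lo hi clo chi ↔ (∀ i, i < lo ∨ hi ≤ i → y i = 0) ∧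
      ∀ c, clo ≤ c → c < chi → column b a c y = 0 := Iff.rfl

theorem column_eq_zero {c : ℕ} {y : ∀ i, Y i} (h : y c = 0) (h' : ∀ i, i + 1 = c → y i = 0) :
    column b a c y = 0 := by
  cases c with
  | zero => simp [h]
  | succ c => simp [h, h' c rfl]

/-- The family w records the zigzag starting at x, with alternating signs so that all columns
cancel. A zigzag that ends in zero has one more vanishing column than one that ends freely; this is
the term `(!s).toNat` here and below. -/
theorem mem_flag_iff {s : Bool} {j lo : ℕ} {x : X lo} :
    x ∈ flag b a s j lo ↔ ∃ w : ∀ i, Y i, (∀ i, i < lo ∨ lo + j ≤ i → w i = 0) ∧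
      ∀ c, lo ≤ c → c < lo + j + (!s).toNat →
        column b a c w + Pi.single (M := X) lo x c = 0 := by
  induction j generalizing lo with
  | zero =>
    constructor
    · intro h
      refine ⟨0, by simp, fun c h1 h2 => ?_⟩
      cases s
      · obtain rfl : x = 0 := h
        simp
      · simp at h2; omega
    · rintro ⟨w, h1, h2⟩
      cases s
      · have hw : w = 0 := funext fun i => h1 i (by omega)
        have := h2 lo le_rfl (by simp)
        have hx : x = 0 := by simpa [hw] using this
        exact hx
      · exact trivial
  | succ j ih =>
    constructor
    · rintro ⟨y, hy, rfl⟩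
      obtain ⟨w, h1, h2⟩ := ih.1 hy
      refine ⟨-(w + Pi.single lo y), fun i hi => ?_, fun c hc hc' => ?_⟩
      · have e1 := h1 i (by omega)
        have e2 : (Pi.single lo y : ∀ i, Y i) i = 0 := Pi.single_eq_of_ne (by omega) _
        simp [e1, e2]
      · rw [map_neg, map_add, column_single]
        rcases hc.eq_or_lt with rfl | hlt
        · rw [column_eq_zero (h1 lo (by omega)) (fun i hi => h1 i (by omega)),
            Pi.single_eq_of_ne (show lo ≠ lo + 1 by omega)]
          simp
        · have := h2 c hlt (by omega)
          rw [Pi.single_eq_of_ne (show c ≠ lo by omega), zero_add, this]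
          simp
    · rintro ⟨w, h1, h2⟩
      have hx : b lo (w lo) + x = 0 := by
        have := h2 lo le_rfl (by omega)
        rw [Pi.single_eq_same] at this
        cases lo with
        | zero => simpa using this
        | succ l => simpa [h1 l (by omega)] using this
      refine ⟨-w lo, ih.2 ⟨-(w - Pi.single lo (w lo)), fun i hi => ?_, fun c hc hc' => ?_⟩, ?_⟩
      · rcases eq_or_ne i lo with rfl | hne
        · simp
        · have e1 := h1 i (by omega)
          simp [e1, Pi.single_eq_of_ne hne]
      · have := h2 c (by omega) (by omega)
        rw [Pi.single_eq_of_ne (show c ≠ lo by omega), add_zero] at this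
        rw [map_neg, map_sub, this, column_single, Pi.single_eq_of_ne (show c ≠ lo by omega)]
        simp [Pi.single_neg]
      · rw [map_neg]
        exact neg_eq_of_add_eq_zero_right hx

/-- Together with `map_proj_chainKer` and `chainKer_inf_ker_proj`, rank-nullity for the first
coordinate turns kernel dimensions into dimensions of preimages of flags, alone or intersected with
the kernel of `b lo`. -/
theorem map_proj_chainKer_succ (s : Bool) (j lo : ℕ) :
    (chainKer b a lo (lo + 1 + j) (lo + 1) (lo + 1 + j + (!s).toNat)).map
      (LinearMap.proj lo : (∀ i, Y i) →ₗ[k] Y lo) = (flag b a s j (lo + 1)).comap (a lo) := by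
  ext u
  rw [Submodule.mem_comap, mem_flag_iff]
  constructor
  · rintro ⟨y, ⟨h1, h2⟩, rfl⟩
    refine ⟨y - Pi.single lo (y lo), fun i hi => ?_, fun c hc hc' => ?_⟩
    · rcases eq_or_ne i lo with rfl | hne
      · simp
      · simp [h1 i (by omega), Pi.single_eq_of_ne hne]
    · rw [map_sub, h2 c hc hc', column_single, Pi.single_eq_of_ne (show c ≠ lo by omega)]
      simp
  · rintro ⟨w, h1, h2⟩
    refine ⟨w + Pi.single lo u, ⟨fun i hi => ?_, fun c hc hc' => ?_⟩, ?_⟩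
    · simp [h1 i (by omega), Pi.single_eq_of_ne (show i ≠ lo by omega)]
    · rw [map_add, column_single, Pi.single_eq_of_ne (show c ≠ lo by omega), zero_add]
      exact h2 c hc hc'
    · simp [h1 lo (by omega)]

theorem chainKer_eq_inf {lo hi chi : ℕ} (h : lo < chi) : chainKer b a lo hi lo chi =
    chainKer b a lo hi (lo + 1) chi ⊓ (b lo ∘ₗ LinearMap.proj lo).ker := by
  ext y
  rw [Submodule.mem_inf, LinearMap.mem_ker, mem_chainKer, mem_chainKer]
  have key : (∀ i, i < lo ∨ hi ≤ i → y i = 0) → column b a lo y = b lo (y lo) := by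
    intro h1
    cases lo with
    | zero => rfl
    | succ l => simp [h1 l (by omega)]
  constructor
  · rintro ⟨h1, h2⟩
    refine ⟨⟨h1, fun c hc hc' => h2 c (by omega) hc'⟩, ?_⟩
    rw [LinearMap.comp_apply, LinearMap.proj_apply, ← key h1]
    exact h2 lo le_rfl h
  · rintro ⟨⟨h1, h2⟩, h3⟩
    refine ⟨h1, fun c hc hc' => ?_⟩
    rcases hc.eq_or_lt with rfl | hlt
    · rw [key h1]; exact h3
    · exact h2 c hlt hc'

theorem map_proj_chainKer (s : Bool) (j lo : ℕ) :
    (chainKer b a lo (lo + 1 + j) lo (lo + 1 + j + (!s).toNat)).map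
      (LinearMap.proj lo : (∀ i, Y i) →ₗ[k] Y lo) =
      (flag b a s j (lo + 1)).comap (a lo) ⊓ (b lo).ker := by
  rw [chainKer_eq_inf (by omega), LinearMap.ker_comp, ← Submodule.map_inf_eq_map_inf_comap,
    map_proj_chainKer_succ]

theorem chainKer_inf_ker_proj {lo hi clo chi : ℕ} (h : clo = lo ∨ clo = lo + 1) :
    chainKer b a lo hi clo chi ⊓ (LinearMap.proj lo : (∀ i, Y i) →ₗ[k] Y lo).ker =
      chainKer b a (lo + 1) hi (lo + 1) chi := by
  ext y
  rw [Submodule.mem_inf, LinearMap.mem_ker, mem_chainKer, mem_chainKer, LinearMap.proj_apply]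
  constructor
  · rintro ⟨⟨h1, h2⟩, h3⟩
    refine ⟨fun i hi => ?_, fun c hc hc' => h2 c (by omega) hc'⟩
    rcases eq_or_ne i lo with rfl | hne
    · exact h3
    · exact h1 i (by omega)
  · rintro ⟨h1, h2⟩
    refine ⟨⟨fun i hi => h1 i (by omega), fun c hc hc' => ?_⟩, h1 lo (by omega)⟩
    rcases Nat.lt_or_ge lo c with hlt | hle
    · exact h2 c hlt hc'
    · exact column_eq_zero (h1 c (by omega)) (fun i hi => h1 i (by omega))

/-- Row j meets only the columns j and j + 1. The rows from i on are therefore free as long as only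
columns before i are constrained, and can be set to zero. -/
theorem map_proj_chainKer_of_le {lo hi clo i : ℕ} (h : lo < i) (hi' : i ≤ hi) :
    (chainKer b a lo hi clo i).map (LinearMap.proj lo : (∀ i, Y i) →ₗ[k] Y lo) =
      (chainKer b a lo i clo i).map (LinearMap.proj lo : (∀ i, Y i) →ₗ[k] Y lo) := by
  apply le_antisymm
  · rintro _ ⟨y, ⟨h1, h2⟩, rfl⟩
    refine ⟨fun j => if j < i then y j else 0, ⟨fun j hj => ?_, fun c hc hc' => ?_⟩, by simp [h]⟩
    · dsimp only
      split_ifs with h'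
      · exact h1 j (by omega)
      · rfl
    · have := h2 c hc hc'
      cases c with
      | zero => simpa [hc'] using this
      | succ c => simpa [hc', show c < i by omega] using this
  · refine Submodule.map_mono ?_
    rintro y ⟨h1, h2⟩
    exact ⟨fun j hj => h1 j (by omega), h2⟩

theorem chainKer_of_subsingleton {lo hi clo chi : ℕ} (h : Subsingleton (X chi)) :
    chainKer b a lo hi clo (chi + 1) = chainKer b a lo hi clo chi := by
  ext y
  rw [mem_chainKer, mem_chainKer]
  refine and_congr_right fun _ => ⟨fun h2 c hc hc' => h2 c hc (by omega), fun h2 c hc hc' => ?_⟩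
  rcases Nat.lt_or_ge c chi with hlt | hge
  · exact h2 c hc hlt
  · obtain rfl : c = chi := by omega
    exact Subsingleton.elim _ _

/-- Rows to the right of all columns of a zigzag matrix do not matter. -/
theorem finrank_chainKer_congr_of_le [Module.Finite k (∀ i, Y i)] {lo hi clo i : ℕ} (h : lo ≤ i)
    (hi' : i ≤ hi)
    (hd : finrank k (chainKer b a lo i clo i) = finrank k (chainKer b' a' lo i clo i)) :
    finrank k (chainKer b a lo hi clo i) = finrank k (chainKer b' a' lo hi clo i) := by
  -- Truncation to the rows before i maps the kernel onto the smaller one; what it kills are the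
  -- free rows, a space which does not depend on the maps.
  let T : (∀ i, Y i) →ₗ[k] (∀ i, Y i) :=
    LinearMap.pi fun j => if j < i then LinearMap.proj j else 0
  have hT : ∀ y j, T y j = if j < i then y j else 0 := by
    intro y j
    simp only [T, LinearMap.pi_apply]
    split_ifs <;> rfl
  have e1 : ∀ (b : ∀ i, Y i →ₗ[k] X i) (a : ∀ i, Y i →ₗ[k] X (i + 1)),
      (chainKer b a lo hi clo i).map T = chainKer b a lo i clo i := by
    intro b a
    have hcol : ∀ y c, c < i → column b a c (T y) = column b a c y := by
      intro y c hc
      cases c with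
      | zero => simp [hT, hc]
      | succ c => simp [hT, hc, show c < i by omega]
    ext y
    constructor
    · rintro ⟨y, ⟨h1, h2⟩, rfl⟩
      refine ⟨fun j hj => ?_, fun c hc hc' => (hcol y c hc').trans (h2 c hc hc')⟩
      rw [hT]
      split_ifs
      · exact h1 j (by omega)
      · rfl
    · rintro ⟨h1, h2⟩
      refine ⟨y, ⟨fun j hj => h1 j (by omega), h2⟩, funext fun j => ?_⟩
      rw [hT]
      split_ifs
      · rfl
      · rw [h1 j (by omega)]
  have e2 : ∀ (b : ∀ i, Y i →ₗ[k] X i) (a : ∀ i, Y i →ₗ[k] X (i + 1)) y,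
      y ∈ chainKer b a lo hi clo i ⊓ T.ker ↔ ∀ j, j < i ∨ hi ≤ j → y j = 0 := by
    intro b a y
    rw [Submodule.mem_inf, LinearMap.mem_ker, mem_chainKer]
    constructor
    · rintro ⟨⟨h1, -⟩, h3⟩ j hj
      rcases Nat.lt_or_ge j i with hlt | hge
      · have := congrFun h3 j
        simpa [hT, hlt] using this
      · exact h1 j (by omega)
    · intro h1
      refine ⟨⟨fun j hj => h1 j (by omega), fun c hc hc' => ?_⟩, funext fun j => ?_⟩
      · exact column_eq_zero (h1 c (by omega)) (fun j hj => h1 j (by omega))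
      · rw [hT]
        split_ifs with hj
        · exact h1 j (by omega)
        · rfl
  rw [← finrank_map_add_finrank_inf_ker _ T, ← finrank_map_add_finrank_inf_ker
    (chainKer b' a' lo hi clo i) T, e1, e1, hd,
    (Submodule.ext fun y => (e2 b a y).trans (e2 b' a' y).symm :
      chainKer b a lo hi clo i ⊓ T.ker = chainKer b' a' lo hi clo i ⊓ T.ker)]

section Branch

variable {Q : Type*} [AddCommGroup Q] [Module k Q] (b a) (g : Q →ₗ[k] X 1)

/-- The families with support in `[1, hi)` and a vector in `Q` whose columns in `[1, chi)`
vanish. -/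
def primeKer (hi chi : ℕ) : Submodule k (Q × ∀ i, Y i) where
  carrier := {p | (∀ i, i < 1 ∨ hi ≤ i → p.2 i = 0) ∧
    ∀ c, 1 ≤ c → c < chi → column b a c p.2 + Pi.single (M := X) 1 (g p.1) c = 0}
  zero_mem' := by simp
  add_mem' := by
    rintro ⟨q, y⟩ ⟨r, z⟩ ⟨h1, h2⟩ ⟨h3, h4⟩
    refine ⟨fun i hi => by simpa using congrArg₂ (· + ·) (h1 i hi) (h3 i hi), fun c hc hc' => ?_⟩
    have e1 := h2 c hc hc'
    have e2 := h4 c hc hc'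
    simp only [Prod.mk_add_mk, map_add, Pi.single_add, Pi.add_apply] at *
    rw [add_add_add_comm, e1, e2, add_zero]
  smul_mem' := by
    rintro t ⟨q, y⟩ ⟨h1, h2⟩
    refine ⟨fun i hi => by simpa using congrArg (t • ·) (h1 i hi), fun c hc hc' => ?_⟩
    have e1 := h2 c hc hc'
    simp only [Prod.smul_mk, map_smul, Pi.single_smul, Pi.smul_apply, ← smul_add] at *
    rw [e1, smul_zero]

/-- Two families which are coupled at `X 1` and by a vector in `Q`. -/
def doubleKer (h₁ c₁ h₂ c₂ : ℕ) : Submodule k ((Q × ∀ i, Y i) × ∀ i, Y i) where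
  carrier := {p | p.1.2 ∈ chainKer b a 0 h₁ 0 c₁ ∧ (∀ i, i < 1 ∨ h₂ ≤ i → p.2 i = 0) ∧
    ∀ c, 1 ≤ c → c < c₂ →
      column b a c p.2 + Pi.single (M := X) 1 (a 0 (p.1.2 0) + g p.1.1) c = 0}
  zero_mem' := by simp
  add_mem' := by
    rintro ⟨⟨q, u⟩, y⟩ ⟨⟨r, v⟩, z⟩ ⟨h0, h1, h2⟩ ⟨h0', h3, h4⟩
    refine ⟨Submodule.add_mem _ h0 h0',
      fun i hi => by simpa using congrArg₂ (· + ·) (h1 i hi) (h3 i hi),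
      fun c hc hc' => ?_⟩
    have e1 := h2 c hc hc'
    have e2 := h4 c hc hc'
    simp only [Prod.mk_add_mk, map_add, Pi.single_add, Pi.add_apply] at *
    calc _ = (column b a c y + (Pi.single (M := X) 1 (a 0 (u 0)) c +
          Pi.single (M := X) 1 (g q) c)) + (column b a c z + (Pi.single (M := X) 1 (a 0 (v 0)) c +
          Pi.single (M := X) 1 (g r) c)) := by abel
      _ = 0 := by rw [e1, e2, add_zero]
  smul_mem' := by
    rintro t ⟨⟨q, u⟩, y⟩ ⟨h0, h1, h2⟩
    refine ⟨Submodule.smul_mem _ t h0, fun i hi => by simpa using congrArg (t • ·) (h1 i hi),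
      fun c hc hc' => ?_⟩
    have e1 := h2 c hc hc'
    simp only [Prod.smul_mk, Pi.smul_apply, map_smul, ← smul_add, Pi.single_smul] at *
    rw [e1, smul_zero]

variable {b a g}

theorem mem_primeKer {hi chi : ℕ} {q : Q} {y : ∀ i, Y i} :
    (q, y) ∈ primeKer b a g hi chi ↔ (∀ i, i < 1 ∨ hi ≤ i → y i = 0) ∧
      ∀ c, 1 ≤ c → c < chi → column b a c y + Pi.single (M := X) 1 (g q) c = 0 := Iff.rfl

theorem mem_doubleKer {h₁ c₁ h₂ c₂ : ℕ} {q : Q} {u w : ∀ i, Y i} :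
    ((q, u), w) ∈ doubleKer b a g h₁ c₁ h₂ c₂ ↔ u ∈ chainKer b a 0 h₁ 0 c₁ ∧
      (∀ i, i < 1 ∨ h₂ ≤ i → w i = 0) ∧ ∀ c, 1 ≤ c → c < c₂ →
      column b a c w + Pi.single (M := X) 1 (a 0 (u 0) + g q) c = 0 := Iff.rfl

variable [Module.Finite k (∀ i, Y i)] [Module.Finite k Q]

/-- Project to Q: by `mem_flag_iff`, q is the first component of an element of the kernel if and
only if g q lies in the flag. -/
theorem finrank_primeKer (s : Bool) (j : ℕ) :
    finrank k (primeKer b a g (1 + j) (1 + j + (!s).toNat)) =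
      finrank k ((flag b a s j 1).comap g) +
        finrank k (chainKer b a 1 (1 + j) 1 (1 + j + (!s).toNat)) := by
  rw [← finrank_map_add_finrank_inf_ker _ (LinearMap.fst k Q (∀ i, Y i)), finrank_inf_ker_fst]
  congr 1
  · refine finrank_congr (Submodule.ext fun q => ?_)
    rw [Submodule.mem_comap, mem_flag_iff]
    constructor
    · rintro ⟨⟨q, w⟩, h, rfl⟩
      exact ⟨w, h⟩
    · rintro ⟨w, h⟩
      exact ⟨(q, w), h, rfl⟩
  · refine finrank_congr (Submodule.ext fun w => ?_)
    rw [Submodule.mem_comap, LinearMap.inr_apply, mem_primeKer, mem_chainKer]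
    simp

/-- Forgetting w has fibre the second `chainKer`, and then forgetting all of u but u_0 has fibre the
first. What is left are the pairs (u_0, q) with u_0 ∈ ker b_0, a_0 u_0 ∈ G and a_0 u_0 + g q in the
flag. -/
theorem finrank_doubleKer [∀ i, Module.Finite k (Y i)] {h₁ c₁ : ℕ} {G : Submodule k (X 1)}
    (hG : (chainKer b a 0 h₁ 0 c₁).map (LinearMap.proj 0 : (∀ i, Y i) →ₗ[k] Y 0) =
      G.comap (a 0) ⊓ (b 0).ker) (s : Bool) (j : ℕ) :
    finrank k (doubleKer b a g h₁ c₁ (1 + j) (1 + j + (!s).toNat)) =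
      finrank k (pairSub (a 0 ∘ₗ (b 0).ker.subtype) g (flag b a s j 1) G) +
        finrank k (chainKer b a 1 h₁ 1 c₁) +
        finrank k (chainKer b a 1 (1 + j) 1 (1 + j + (!s).toNat)) := by
  rw [← finrank_map_add_finrank_inf_ker _ (LinearMap.fst k (Q × ∀ i, Y i) (∀ i, Y i)),
    finrank_inf_ker_fst]
  congr 1
  · let S := (doubleKer b a g h₁ c₁ (1 + j) (1 + j + (!s).toNat)).map
      (LinearMap.fst k (Q × ∀ i, Y i) (∀ i, Y i))
    have hS : ∀ q u, (q, u) ∈ S ↔ u ∈ chainKer b a 0 h₁ 0 c₁ ∧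
        a 0 (u 0) + g q ∈ flag b a s j 1 := by
      intro q u
      rw [mem_flag_iff]
      constructor
      · rintro ⟨⟨⟨q, u⟩, w⟩, ⟨h1, h2⟩, h3⟩
        cases h3
        exact ⟨h1, w, h2⟩
      · rintro ⟨h1, w, h2⟩
        exact ⟨((q, u), w), ⟨h1, h2⟩, rfl⟩
    change finrank k S = _
    rw [← finrank_map_add_finrank_inf_ker S
      (LinearMap.prodMap LinearMap.id (LinearMap.proj 0 : (∀ i, Y i) →ₗ[k] Y 0))]
    congr 1
    · let E : (b 0).ker × Q →ₗ[k] Q × Y 0 :=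
        LinearMap.prod (LinearMap.snd k _ _) ((b 0).ker.subtype ∘ₗ LinearMap.fst k _ _)
      have hE : Function.Injective E := by
        rintro ⟨p, q⟩ ⟨p', q'⟩ h
        have h' : (q, (p : Y 0)) = (q', (p' : Y 0)) := h
        simp only [Prod.mk.injEq] at h'
        rw [h'.1, Subtype.ext h'.2]
      rw [LinearEquiv.finrank_eq (Submodule.equivMapOfInjective E hE (pairSub _ _ _ _))]
      refine finrank_congr (Submodule.ext fun ⟨q, p⟩ => ?_)
      constructor
      · rintro ⟨⟨q, u⟩, h, h'⟩
        cases h'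
        have h := (hS q u).1 h
        have hu : u 0 ∈ G.comap (a 0) ⊓ (b 0).ker := hG ▸ ⟨u, h.1, rfl⟩
        exact ⟨(⟨u 0, hu.2⟩, q), mem_pairSub.2 ⟨h.2, hu.1⟩, rfl⟩
      · rintro ⟨⟨p, q⟩, h, h'⟩
        cases h'
        have h := mem_pairSub.1 h
        have hp : (p : Y 0) ∈ G.comap (a 0) ⊓ (b 0).ker := ⟨h.2, p.2⟩
        rw [← hG] at hp
        obtain ⟨u, hu, hup⟩ := hp
        have hup : u 0 = p := hup
        refine ⟨(q, u), (hS q u).2 ⟨hu, ?_⟩, ?_⟩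
        · rw [hup]; exact h.1
        · simp only [LinearMap.prodMap_apply, LinearMap.id_apply, LinearMap.proj_apply, hup]
          rfl
    · rw [LinearEquiv.finrank_eq (Submodule.equivMapOfInjective (LinearMap.inr k Q (∀ i, Y i))
        LinearMap.inr_injective (chainKer b a 1 h₁ 1 c₁)),
        ← chainKer_inf_ker_proj (lo := 0) (Or.inl rfl)]
      refine finrank_congr (Submodule.ext fun ⟨q, u⟩ => ?_)
      rw [Submodule.mem_inf, hS, LinearMap.mem_ker]
      simp only [LinearMap.prodMap_apply, LinearMap.id_apply, LinearMap.proj_apply,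
        Prod.mk_eq_zero, Submodule.mem_map, Submodule.mem_inf, LinearMap.mem_ker,
        LinearMap.inr_apply, Prod.mk.injEq]
      constructor
      · rintro ⟨⟨h1, h2⟩, rfl, h3⟩
        exact ⟨u, ⟨h1, h3⟩, rfl, rfl⟩
      · rintro ⟨u', ⟨h1, h2⟩, rfl, rfl⟩
        refine ⟨⟨h1, ?_⟩, rfl, h2⟩
        simp [h2]
  · refine finrank_congr (Submodule.ext fun w => ?_)
    rw [Submodule.mem_comap, LinearMap.inr_apply]
    change ((0, 0), w) ∈ _ ↔ _
    rw [mem_doubleKer]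
    exact ⟨fun h => ⟨h.2.1, fun c hc hc' => by simpa using h.2.2 c hc hc'⟩,
      fun h => ⟨Submodule.zero_mem _, h.1, fun c hc hc' => by simpa using h.2 c hc hc'⟩⟩

end Branch

end ChainKernels

end TypeD

end

noncomputable section

namespace TypeD

open Module

/-! ### Kernel dimensions determine the maps. -/

section Reconstruction

variable {k : Type*} [Field k] {X Y : ℕ → Type*} [∀ i, AddCommGroup (X i)] [∀ i, Module k (X i)]
  [∀ i, AddCommGroup (Y i)] [∀ i, Module k (Y i)]
  [Module.Finite k (∀ i, Y i)]
  {b b' : ∀ i, Y i →ₗ[k] X i} {a a' : ∀ i, Y i →ₗ[k] X (i + 1)}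

theorem finrank_comap_flag_congr {s : Bool} {j l : ℕ}
    (h : finrank k (chainKer b a l (l + 1 + j) (l + 1) (l + 1 + j + (!s).toNat)) =
      finrank k (chainKer b' a' l (l + 1 + j) (l + 1) (l + 1 + j + (!s).toNat)))
    (h' : finrank k (chainKer b a (l + 1) (l + 1 + j) (l + 1) (l + 1 + j + (!s).toNat)) =
      finrank k (chainKer b' a' (l + 1) (l + 1 + j) (l + 1) (l + 1 + j + (!s).toNat))) :
    finrank k ((flag b a s j (l + 1)).comap (a l)) =
      finrank k ((flag b' a' s j (l + 1)).comap (a' l)) := by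
  have e := finrank_map_add_finrank_inf_ker
    (chainKer b a l (l + 1 + j) (l + 1) (l + 1 + j + (!s).toNat))
    (LinearMap.proj l : (∀ i, Y i) →ₗ[k] Y l)
  have e' := finrank_map_add_finrank_inf_ker
    (chainKer b' a' l (l + 1 + j) (l + 1) (l + 1 + j + (!s).toNat))
    (LinearMap.proj l : (∀ i, Y i) →ₗ[k] Y l)
  rw [map_proj_chainKer_succ, chainKer_inf_ker_proj (Or.inr rfl)] at e e'
  omega

theorem finrank_comap_flag_inf_ker_congr {s : Bool} {j l : ℕ}
    (h : finrank k (chainKer b a l (l + 1 + j) l (l + 1 + j + (!s).toNat)) =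
      finrank k (chainKer b' a' l (l + 1 + j) l (l + 1 + j + (!s).toNat)))
    (h' : finrank k (chainKer b a (l + 1) (l + 1 + j) (l + 1) (l + 1 + j + (!s).toNat)) =
      finrank k (chainKer b' a' (l + 1) (l + 1 + j) (l + 1) (l + 1 + j + (!s).toNat))) :
    finrank k ((flag b a s j (l + 1)).comap (a l) ⊓ (b l).ker : Submodule k (Y l)) =
      finrank k ((flag b' a' s j (l + 1)).comap (a' l) ⊓ (b' l).ker : Submodule k (Y l)) := by
  have e := finrank_map_add_finrank_inf_ker
    (chainKer b a l (l + 1 + j) l (l + 1 + j + (!s).toNat))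
    (LinearMap.proj l : (∀ i, Y i) →ₗ[k] Y l)
  have e' := finrank_map_add_finrank_inf_ker
    (chainKer b' a' l (l + 1 + j) l (l + 1 + j + (!s).toNat))
    (LinearMap.proj l : (∀ i, Y i) →ₗ[k] Y l)
  rw [map_proj_chainKer, chainKer_inf_ker_proj (Or.inl rfl)] at e e'
  omega

theorem finrank_comap_subtype {M : Type*} [AddCommGroup M] [Module k M] (A B : Submodule k M) :
    finrank k (A.comap B.subtype) = finrank k (A ⊓ B : Submodule k M) := by
  rw [LinearEquiv.finrank_eq (Submodule.equivMapOfInjective B.subtype B.injective_subtype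
    (A.comap B.subtype)), Submodule.map_comap_subtype, inf_comm]

variable [∀ i, Module.Finite k (X i)] [∀ i, Module.Finite k (Y i)]
  {Q : Type*} [AddCommGroup Q] [Module k Q] [Module.Finite k Q] {g g' : Q →ₗ[k] X 1}

/-- The dimensions of the kernels of the zigzag matrices determine the maps up to isomorphism,
apart from the ends `Y 0` and `X 0`, of which only the kernel of `b 0` is considered. -/
theorem exists_equiv_of_finrank_kernels {n : ℕ} (hn : 1 ≤ n) (hX : Subsingleton (X (n + 1)))
    (hb : ∀ s lo hi, lo < hi → hi ≤ n + 1 →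
      finrank k (chainKer b a lo hi lo (hi + (!s).toNat)) =
        finrank k (chainKer b' a' lo hi lo (hi + (!s).toNat)))
    (ha : ∀ s lo hi, 1 ≤ lo → lo < hi → hi ≤ n + 1 →
      finrank k (chainKer b a lo hi (lo + 1) (hi + (!s).toNat)) =
        finrank k (chainKer b' a' lo hi (lo + 1) (hi + (!s).toNat)))
    (hg : ∀ s hi, 1 ≤ hi → hi ≤ n + 1 → finrank k (primeKer b a g hi (hi + (!s).toNat)) =
        finrank k (primeKer b' a' g' hi (hi + (!s).toNat)))
    (hα : ∀ s i hi, 1 ≤ i → i ≤ n → i + s.toNat ≤ hi → hi ≤ n + 1 →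
      finrank k (doubleKer b a g hi i hi (hi + (!s).toNat)) =
        finrank k (doubleKer b' a' g' hi i hi (hi + (!s).toNat)))
    (hβ : ∀ s i hi, 1 ≤ i → i < hi → hi ≤ n + 1 →
      finrank k (doubleKer b a g hi (hi + (!s).toNat) i (i + 1)) =
        finrank k (doubleKer b' a' g' hi (hi + (!s).toNat) i (i + 1))) :
    ∃ (φP : (b 0).ker ≃ₗ[k] (b' 0).ker) (φQ : Q ≃ₗ[k] Q) (φX : ∀ l, X l ≃ₗ[k] X l)
      (φY : ∀ l, Y l ≃ₗ[k] Y l),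
      (∀ p : (b 0).ker, φX 1 (a 0 p) = a' 0 (φP p)) ∧ (∀ q, φX 1 (g q) = g' (φQ q)) ∧
      ∀ l, 1 ≤ l → l ≤ n → ∀ y, φX l (b l y) = b' l (φY l y) ∧
        φX (l + 1) (a l y) = a' l (φY l y) := by
  -- The empty range of rows is included because it occurs as a fibre for flags of length 0.
  have hb' : ∀ s lo hi, lo ≤ hi → hi ≤ n + 1 →
      finrank k (chainKer b a lo hi lo (hi + (!s).toNat)) =
        finrank k (chainKer b' a' lo hi lo (hi + (!s).toNat)) := by
    intro s lo hi h h'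
    rcases h.eq_or_lt with rfl | hlt
    · have : ∀ (b : ∀ i, Y i →ₗ[k] X i) (a : ∀ i, Y i →ₗ[k] X (i + 1)),
          chainKer b a lo lo lo (lo + (!s).toNat) = ⊥ := fun b a =>
        (Submodule.eq_bot_iff _).2 fun y hy => funext fun i => hy.1 i (by omega)
      rw [this, this, finrank_bot]
    · exact hb s lo hi hlt h'
  have hY : ∀ s j l, 1 ≤ l → l + j < 1 + n →
      finrank k ((flag b a s j (l + 1)).comap (a l)) =
        finrank k ((flag b' a' s j (l + 1)).comap (a' l)) := fun s j l hl hl' =>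
    finrank_comap_flag_congr (ha _ _ _ hl (by omega) (by omega)) (hb' _ _ _ (by omega) (by omega))
  have hXd : ∀ s j l, 1 ≤ l → l + j ≤ 1 + n →
      finrank k (flag b a s j l) = finrank k (flag b' a' s j l) := by
    intro s j l hl hl'
    cases j with
    | zero => cases s <;> rfl
    | succ j =>
      -- A flag of positive length is an image under `b l`, so its dimension is that of the preimage
      -- minus that of the part in the kernel of `b l`.
      have e := finrank_map_add_finrank_inf_ker ((flag b a s j (l + 1)).comap (a l)) (b l)
      have e' := finrank_map_add_finrank_inf_ker ((flag b' a' s j (l + 1)).comap (a' l)) (b' l)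
      have e1 := hY s j l hl (by omega)
      have e2 : finrank k ((flag b a s j (l + 1)).comap (a l) ⊓ (b l).ker : Submodule k (Y l)) =
          finrank k ((flag b' a' s j (l + 1)).comap (a' l) ⊓ (b' l).ker : Submodule k (Y l)) :=
        finrank_comap_flag_inf_ker_congr (hb _ _ _ (by omega) (by omega))
          (hb' _ _ _ (by omega) (by omega))
      rw [← e1, ← e2] at e'
      exact Nat.add_right_cancel (e.trans e'.symm)
  have hP : ∀ s j, j ≤ n →
      finrank k ((flag b a s j 1).comap (a 0 ∘ₗ (b 0).ker.subtype)) =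
        finrank k ((flag b' a' s j 1).comap (a' 0 ∘ₗ (b' 0).ker.subtype)) := by
    intro s j hj
    rw [Submodule.comap_comp, Submodule.comap_comp, finrank_comap_subtype, finrank_comap_subtype]
    exact finrank_comap_flag_inf_ker_congr (hb _ _ _ (by omega) (by omega))
      (hb' _ _ _ (by omega) (by omega))
  have hQ : ∀ s j, j ≤ n →
      finrank k ((flag b a s j 1).comap g) = finrank k ((flag b' a' s j 1).comap g') := by
    intro s j hj
    have e := finrank_primeKer (b := b) (a := a) (g := g) s j
    have e' := finrank_primeKer (b := b') (a := a') (g := g') s j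
    have e1 := hg s (1 + j) (by omega) (by omega)
    have e2 := hb' s 1 (1 + j) (by omega) (by omega)
    omega
  -- The kernels of ⟦α_{l+1}, δ⟧: F is the flag given by δ, and G ends freely, after length l. The
  -- rows of M below the columns that cut out G are surplus and are removed by
  -- `map_proj_chainKer_of_le`.
  have hPQα : ∀ s j l, l < n → j ≤ n → l + s.toNat ≤ j →
      finrank k (pairSub (a 0 ∘ₗ (b 0).ker.subtype) g (flag b a s j 1) (flag b a true l 1)) =
        finrank k (pairSub (a' 0 ∘ₗ (b' 0).ker.subtype) g' (flag b' a' s j 1)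
          (flag b' a' true l 1)) := by
    intro s j l hl hj h
    have key : ∀ (b : ∀ i, Y i →ₗ[k] X i) (a : ∀ i, Y i →ₗ[k] X (i + 1)),
        (chainKer b a 0 (1 + j) 0 (l + 1)).map (LinearMap.proj 0 : (∀ i, Y i) →ₗ[k] Y 0) =
          (flag b a true l 1).comap (a 0) ⊓ (b 0).ker := fun b a => by
      rw [map_proj_chainKer_of_le (by omega) (by omega)]
      have := map_proj_chainKer (b := b) (a := a) true l 0
      rw [show l + 1 = 0 + 1 + l by omega]
      exact this
    have e := finrank_doubleKer (g := g) (key b a) s j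
    have e' := finrank_doubleKer (g := g') (key b' a') s j
    have e1 := hα s (l + 1) (1 + j) (by omega) (by omega) (by omega) (by omega)
    have e2 := hb' s 1 (1 + j) (by omega) (by omega)
    have e3 := finrank_chainKer_congr_of_le (b' := b') (a' := a') (lo := 1) (hi := 1 + j) (clo := 1)
      (i := l + 1)
      (by omega) (by omega) (hb' true 1 (l + 1) (by omega) (by omega))
    omega
  -- The kernels of ⟦β_{j+1}, δ⟧: now G is given by δ, and F ends in zero after length j.
  have hPQβ : ∀ s j l, j < l → l ≤ n →
      finrank k (pairSub (a 0 ∘ₗ (b 0).ker.subtype) g (flag b a false j 1) (flag b a s l 1)) =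
        finrank k (pairSub (a' 0 ∘ₗ (b' 0).ker.subtype) g' (flag b' a' false j 1)
          (flag b' a' s l 1)) := by
    intro s j l hl hj
    have key : ∀ (b : ∀ i, Y i →ₗ[k] X i) (a : ∀ i, Y i →ₗ[k] X (i + 1)),
        (chainKer b a 0 (1 + l) 0 (1 + l + (!s).toNat)).map
          (LinearMap.proj 0 : (∀ i, Y i) →ₗ[k] Y 0) =
          (flag b a s l 1).comap (a 0) ⊓ (b 0).ker := fun b a =>
      map_proj_chainKer (b := b) (a := a) s l 0
    have e := finrank_doubleKer (g := g) (key b a) false j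
    have e' := finrank_doubleKer (g := g') (key b' a') false j
    have e1 : finrank k (doubleKer b a g (1 + l) (1 + l + (!s).toNat) (1 + j)
        (1 + j + (!false).toNat)) = finrank k (doubleKer b' a' g' (1 + l) (1 + l + (!s).toNat)
        (1 + j) (1 + j + (!false).toNat)) := hβ s (1 + j) (1 + l) (by omega) (by omega) (by omega)
    have e2 := hb' false 1 (1 + j) (by omega) (by omega)
    have e3 := hb' s 1 (1 + l) (by omega) (by omega)
    omega
  -- For F = G the two conditions decouple into f p ∈ F and g q ∈ F.
  have hdiag : ∀ (b : ∀ i, Y i →ₗ[k] X i) (a : ∀ i, Y i →ₗ[k] X (i + 1)) (g : Q →ₗ[k] X 1)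
      (F : Submodule k (X 1)), finrank k (pairSub (a 0 ∘ₗ (b 0).ker.subtype) g F F) =
      finrank k (F.comap (a 0 ∘ₗ (b 0).ker.subtype)) + finrank k (F.comap g) := by
    intro b a g F
    rw [← finrank_pairSub, inf_eq_left.2 (Submodule.comap_mono le_sup_left)]
  obtain ⟨φP, φQ, φU, hφP, hφQ, hφ⟩ := exists_equiv_of_branch (a 0 ∘ₗ (b 0).ker.subtype) g
    (a' 0 ∘ₗ (b' 0).ker.subtype) g' (flagPairs_finite b b' a a' n 1)
    (flagPairs_isChain b b' a a' n 1) (bot_mem_flagPairs b b' a a' n 1)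
    (top_mem_flagPairs b b' a a' n 1)
    (by
      rintro _ ⟨⟨s, j⟩, hj, rfl⟩
      have : j ≤ n := hj
      exact hXd s j 1 le_rfl (by omega))
    (by
      rintro _ ⟨⟨s, j⟩, hj, rfl⟩
      exact hP s j hj)
    (by
      rintro _ ⟨⟨s, j⟩, hj, rfl⟩
      exact hQ s j hj)
    (by
      rintro _ ⟨⟨s, j⟩, hj', rfl⟩ _ ⟨⟨t, l⟩, hl', rfl⟩ hle
      have hj : j ≤ n := hj'
      have hl : l ≤ n := hl'
      clear hj' hl'
      change finrank k (pairSub _ g (flag b a s j 1) (flag b a t l 1)) =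
        finrank k (pairSub _ g' (flag b' a' s j 1) (flag b' a' t l 1))
      have hd : ∀ s j, j ≤ n →
          finrank k (pairSub (a 0 ∘ₗ (b 0).ker.subtype) g (flag b a s j 1) (flag b a s j 1)) =
          finrank k (pairSub (a' 0 ∘ₗ (b' 0).ker.subtype) g' (flag b' a' s j 1)
            (flag b' a' s j 1)) := fun s j h => by
        rw [hdiag, hdiag, hP s j h, hQ s j h]
      by_cases hpq : FlagLE (s, j) (t, l)
      · cases s <;> cases t
        · rcases (show j ≤ l from hpq).eq_or_lt with rfl | hlt
          · exact hd _ _ hj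
          · exact hPQβ false j l hlt hl
        · rcases Nat.lt_or_ge j l with hlt | hge
          · exact hPQβ true j l hlt hl
          -- For l = n there is no α_{n+1}; but X (n + 1) is zero, so ending freely there is the
          -- same as ending in zero, and F = G.
          · rcases hl.eq_or_lt with rfl | hln
            · obtain rfl : j = l := by omega
              have hX' : Subsingleton (X (1 + j)) := by rwa [Nat.add_comm]
              have e := flag_eq_of_subsingleton b a true false j 1 hX'
              have e' := flag_eq_of_subsingleton b' a' true false j 1 hX'
              rw [e, e']
              exact hd _ _ hj
            · exact hPQα false j l hln hj (by simpa using hge)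
        · exact hpq.elim
        · rcases (show l ≤ j from hpq).eq_or_lt with rfl | hlt
          · exact hd _ _ hj
          · exact hPQα true j l (by omega) hj (by simpa using hlt)
      -- The inclusion `hle` may hold against the order of the indices; then the subspaces coincide.
      · have hqp := (FlagLE.total (s, j) (t, l)).resolve_left hpq
        have e1 := le_antisymm hle.1 (flag_mono b a hqp 1)
        have e2 := le_antisymm hle.2 (flag_mono b' a' hqp 1)
        dsimp only at e1 e2
        rw [← e1, ← e2]
        exact hd _ _ hj)
  obtain ⟨φX, φY, h1, h2⟩ := exists_equiv_along_arm b b' a a' n 1 φU hφ hXd hY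
  refine ⟨φP, φQ, φX, φY, ?_, ?_, fun l hl hl' => h2 l hl (by omega)⟩
  · intro p
    rw [h1]
    exact hφP p
  · intro q
    rw [h1]
    exact hφQ q

end Reconstruction

end TypeD

end

noncomputable section

namespace TypeD

open Module Matrix

/-! ### The spaces and block maps of a representation of `Q^*(n)`. -/

section StarSpaces

open StarVertex StarArrow

variable {k : Type*} [Field k] {n : ℕ} {d : StarVertex n → ℕ}

/-- The space at the vertex `x_i`; it is zero for `i > n`. -/
abbrev XSpace (k : Type*) (d : StarVertex n → ℕ) (i : ℕ) : Type _ :=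
  ∀ r : {r : Fin (n + 1) // (r : ℕ) = i}, Fin (d (x r)) → k

/-- The space at the vertex `y_i`; it is zero for `i > n`. -/
abbrev YSpace (k : Type*) (d : StarVertex n → ℕ) (i : ℕ) : Type _ :=
  ∀ r : {r : Fin (n + 1) // (r : ℕ) = i}, Fin (d (y r)) → k

/-- The block of the matrices `A` and `B` in the row `p` and the column `q`. -/
def starBlock (V : Rep k (StarVertex n) d) (p q : StarVertex n) :
    Matrix (Fin (d p)) (Fin (d q)) k :=
  (arrowEntry k p q).sum fun l t => t • evalPath V l

/-- The map of the spaces with the indices `i` and `c` given by the blocks of `A`. -/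
def blockMap (V : Rep k (StarVertex n) d) (i c : ℕ) : YSpace k d i →ₗ[k] XSpace k d c :=
  LinearMap.pi fun r => ∑ r' : {r : Fin (n + 1) // (r : ℕ) = i},
    (starBlock V (y r') (x r)).vecMulLinear ∘ₗ LinearMap.proj r'

theorem blockMap_apply (V : Rep k (StarVertex n) d) (i c : ℕ) (u : YSpace k d i)
    (r : {r : Fin (n + 1) // (r : ℕ) = c}) :
    blockMap V i c u r = ∑ r' : {r : Fin (n + 1) // (r : ℕ) = i},
      u r' ᵥ* starBlock V (y r') (x r) := by
  simp [blockMap]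

/-- The map `β_i`. -/
def betaMap (V : Rep k (StarVertex n) d) (i : ℕ) : YSpace k d i →ₗ[k] XSpace k d i :=
  blockMap V i i

/-- The map `α_{i+1}`. -/
def alphaMap (V : Rep k (StarVertex n) d) (i : ℕ) : YSpace k d i →ₗ[k] XSpace k d (i + 1) :=
  blockMap V i (i + 1)

/-- The map `α_1'`. -/
def primeMap (V : Rep k (StarVertex n) d) : (Fin (d yPrime) → k) →ₗ[k] XSpace k d 1 :=
  LinearMap.pi fun r => (starBlock V yPrime (x r)).vecMulLinear

theorem starBlock_eq_zero (V : Rep k (StarVertex n) d) {i j : Fin (n + 1)} (h : i ≠ j)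
    (h' : (j : ℕ) ≠ i + 1) : starBlock V (y i) (x j) = 0 := by
  simp [starBlock, arrowEntry, h, h']

theorem starBlock_yPrime_eq_zero (V : Rep k (StarVertex n) d) {j : Fin (n + 1)} (h : j ≠ 1) :
    starBlock V yPrime (x j) = 0 := by
  simp [starBlock, arrowEntry, h]

theorem evalPath_toPath (V : Rep k (StarVertex n) d) {p q : StarVertex n} (a : p ⟶ q) :
    evalPath V a.toPath = V a := by
  simp [Quiver.Hom.toPath, evalPath]

theorem starBlock_beta (V : Rep k (StarVertex n) d) (i : Fin (n + 1)) :
    starBlock V (y i) (x i) = V (p := y i) (q := x i) ⟨beta i, rfl, rfl⟩ := by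
  simp [starBlock, arrowEntry, evalPath_toPath]

theorem starBlock_alpha (V : Rep k (StarVertex n) d) (i : Fin n) :
    starBlock V (y i.castSucc) (x i.succ) =
      V (p := y i.castSucc) (q := x i.succ) ⟨alpha i, rfl, rfl⟩ := by
  have h : i.castSucc ≠ i.succ := by simp [Fin.ext_iff]
  simp [starBlock, arrowEntry, evalPath_toPath, h]

theorem starBlock_alphaPrime (V : Rep k (StarVertex n) d) :
    starBlock V yPrime (x 1) = V (p := yPrime) (q := x 1) ⟨alphaPrime, rfl, rfl⟩ := by
  simp [starBlock, arrowEntry, evalPath_toPath]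

/-- All blocks of A off its two diagonals vanish, so the at most two terms of `column` make up the
whole block column. -/
theorem column_apply (V : Rep k (StarVertex n) d) (u : ∀ i, YSpace k d i) (r : Fin (n + 1)) :
    column (betaMap V) (alphaMap V) r u ⟨r, rfl⟩ =
      ∑ r' : Fin (n + 1), u r' ⟨r', rfl⟩ ᵥ* starBlock V (y r') (x r) := by
  have key : ∀ i : ℕ, blockMap V i r (u i) ⟨r, rfl⟩ = ∑ r' : Fin (n + 1),
      if (r' : ℕ) = i then u r' ⟨r', rfl⟩ ᵥ* starBlock V (y r') (x r) else 0 := by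
    intro i
    rw [blockMap_apply, ← Finset.sum_filter,
      Finset.sum_subtype (p := fun r' : Fin (n + 1) => (r' : ℕ) = i)
      (Finset.univ.filter fun r' : Fin (n + 1) => (r' : ℕ) = i) (by simp)]
    refine Finset.sum_congr rfl ?_
    rintro ⟨r', rfl⟩ -
    rfl
  obtain ⟨c, hc⟩ := r
  cases c with
  | zero =>
    refine (key 0).trans (Finset.sum_congr rfl fun r' _ => ?_)
    split_ifs with h
    · rfl
    · rw [starBlock_eq_zero V (fun e => h (congrArg Fin.val e)) (by simp), Matrix.vecMul_zero]
  | succ c =>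
    refine (congrArg₂ (· + ·) (key c) (key (c + 1))).trans ?_
    rw [← Finset.sum_add_distrib]
    refine Finset.sum_congr rfl fun r' _ => ?_
    split_ifs with h h'
    · omega
    · simp
    · simp
    · rw [starBlock_eq_zero V (fun e => ?_) (fun e => ?_), Matrix.vecMul_zero, add_zero]
      · exact absurd (congrArg Fin.val e) ‹_›
      · simp only [Nat.add_right_cancel_iff] at e
        omega

theorem forall_column_eq_zero_iff (f : ∀ c, XSpace k d c) (clo chi : ℕ) :
    (∀ c, clo ≤ c → c < chi → f c = 0) ↔
      ∀ r : Fin (n + 1), clo ≤ r → (r : ℕ) < chi → f r ⟨r, rfl⟩ = 0 := by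
  constructor
  · intro h r h1 h2
    rw [h r h1 h2]
    rfl
  · intro h c h1 h2
    funext ⟨r, hr⟩
    subst hr
    exact h r h1 h2

/-- Extension of a family of vectors by zero. -/
def extendRows (k : Type*) [Field k] (d : StarVertex n → ℕ) (ρ : Fin (n + 1) → StarVertex n)
    (P : Fin (n + 1) → Prop) [DecidablePred P] :
    ((Σ i : {r // P r}, Fin (d (ρ i))) → k) →ₗ[k] ∀ r, Fin (d (ρ r)) → k where
  toFun v r t := if h : P r then v ⟨⟨r, h⟩, t⟩ else 0
  map_add' v w := by
    funext r t
    by_cases h : P r <;> simp [h]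
  map_smul' c v := by
    funext r t
    by_cases h : P r <;> simp [h]

variable {ρ : Fin (n + 1) → StarVertex n} {P : Fin (n + 1) → Prop} [DecidablePred P]

theorem extendRows_of_mem (v : (Σ i : {r // P r}, Fin (d (ρ i))) → k) {r : Fin (n + 1)} (h : P r) :
    extendRows k d ρ P v r = fun t => v ⟨⟨r, h⟩, t⟩ := by
  funext t
  simp [extendRows, h]

theorem extendRows_of_not_mem (v : (Σ i : {r // P r}, Fin (d (ρ i))) → k) {r : Fin (n + 1)}
    (h : ¬ P r) : extendRows k d ρ P v r = 0 := by
  funext t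
  simp [extendRows, h]

theorem extendRows_injective : Function.Injective (extendRows k d ρ P) := by
  intro v w h
  funext ⟨⟨r, hr⟩, t⟩
  have := congrFun (congrFun h r) t
  rwa [extendRows_of_mem v hr, extendRows_of_mem w hr] at this

theorem exists_extendRows_eq {z : ∀ r, Fin (d (ρ r)) → k} (hz : ∀ r, ¬ P r → z r = 0) :
    extendRows k d ρ P (fun p => z p.1 p.2) = z := by
  funext r
  by_cases h : P r
  · rw [extendRows_of_mem _ h]
  · rw [extendRows_of_not_mem _ h, hz r h]

theorem sum_extendRows {β : Type*} [Fintype {r // P r}] (v : (Σ i : {r // P r}, Fin (d (ρ i))) → k)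
    (M : ∀ r, Matrix (Fin (d (ρ r))) β k) :
    ∑ i : {r // P r}, (fun t => v ⟨i, t⟩) ᵥ* M i = ∑ r, extendRows k d ρ P v r ᵥ* M r := by
  have : ∀ r, extendRows k d ρ P v r ᵥ* M r =
      if P r then extendRows k d ρ P v r ᵥ* M r else 0 := by
    intro r
    split_ifs with h
    · rfl
    · rw [extendRows_of_not_mem v h, Matrix.zero_vecMul]
  rw [Finset.sum_congr rfl fun r _ => this r, ← Finset.sum_filter,
    Finset.sum_subtype (p := P) (Finset.univ.filter P) (by simp)]
  refine Finset.sum_congr rfl ?_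
  rintro ⟨r, hr⟩ -
  rw [extendRows_of_mem v hr]

/-- A family of vectors at the vertices `y_0, …, y_n`. -/
def yFamily (k : Type*) [Field k] (d : StarVertex n → ℕ) :
    (∀ r, Fin (d (y r)) → k) →ₗ[k] ∀ i, YSpace k d i where
  toFun z _ r := z r
  map_add' _ _ := rfl
  map_smul' _ _ := rfl

theorem yFamily_eq (u : ∀ i, YSpace k d i) : yFamily k d (fun r => u r ⟨r, rfl⟩) = u := by
  funext i ⟨r, hr⟩
  subst hr
  rfl

theorem yFamily_eq_zero_iff {z : ∀ r, Fin (d (y r)) → k} {Q : ℕ → Prop} :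
    (∀ i, Q i → yFamily k d z i = 0) ↔ ∀ r : Fin (n + 1), Q r → z r = 0 := by
  constructor
  · intro h r hr
    exact congrFun (h r hr) ⟨r, rfl⟩
  · intro h i hi
    funext ⟨r, hr⟩
    subst hr
    exact h r hi

theorem yFamily_injective : Function.Injective (yFamily k d) := fun _ _ h =>
  funext fun r => congrFun (congrFun h r) ⟨r, rfl⟩

instance : Module.Finite k (∀ i, YSpace k d i) :=
  Module.Finite.of_surjective (yFamily k d) fun u => ⟨_, yFamily_eq u⟩

/-- A family of vectors at the vertices `y_0', y_1, …, y_n`. -/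
def bFamily (k : Type*) [Field k] (d : StarVertex n → ℕ) :
    (∀ r, Fin (d (rowB r)) → k) →ₗ[k] (Fin (d yPrime) → k) × ∀ i, YSpace k d i :=
  LinearMap.prod (LinearMap.proj 0) (yFamily k d ∘ₗ
    { toFun := fun z => Fin.cases 0 fun i => z i.succ
      map_add' := fun z w => by
        funext r
        exact Fin.cases (add_zero _).symm (fun i => rfl) r
      map_smul' := fun c z => by
        funext r
        exact Fin.cases (smul_zero c).symm (fun i => rfl) r })

end StarSpaces

end TypeD

end

noncomputable section

namespace TypeD

open Module Matrix

/-! ### Left kernels of the matrices [γ, δ]. -/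

section StarKernels

open StarVertex StarArrow

variable {k : Type*} [Field k] {n : ℕ} {d : StarVertex n → ℕ}

theorem bFamily_snd_zero (z : ∀ r, Fin (d (rowB r)) → k) : (bFamily k d z).2 0 = 0 := by
  funext ⟨r, hr⟩
  obtain rfl : r = 0 := Fin.ext hr
  rfl

theorem bFamily_injective : Function.Injective (bFamily k d) := by
  intro z w h
  funext r
  refine Fin.cases ?_ (fun i => ?_) r
  · exact congrArg Prod.fst h
  · exact congrFun (congrFun (congrArg Prod.snd h) i.succ) ⟨i.succ, rfl⟩

/-- The inverse of `bFamily`. -/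
def ofPrime (q : Fin (d yPrime) → k) (w : ∀ i, YSpace k d i) : ∀ r, Fin (d (rowB r)) → k :=
  Fin.cases q fun i => w i.succ ⟨i.succ, rfl⟩

theorem bFamily_ofPrime (q : Fin (d yPrime) → k) {w : ∀ i, YSpace k d i} (h : w 0 = 0) :
    bFamily k d (ofPrime q w) = (q, w) := by
  refine Prod.ext rfl (funext fun i => funext fun ⟨r, hr⟩ => ?_)
  subst hr
  refine Fin.cases ?_ (fun i => rfl) r
  exact (congrFun h ⟨0, rfl⟩).symm

theorem ofPrime_eq_zero {q : Fin (d yPrime) → k} {w : ∀ i, YSpace k d i} {r : Fin (n + 1)}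
    (h : 1 ≤ (r : ℕ)) (hw : w r = 0) : ofPrime q w r = 0 := by
  induction r using Fin.cases with
  | zero => simp at h
  | succ i => exact congrFun hw ⟨i.succ, rfl⟩

theorem bFamily_snd_eq_zero (z : ∀ r, Fin (d (rowB r)) → k) {i : ℕ}
    (h : ∀ r : Fin (n + 1), (r : ℕ) = i → 1 ≤ i → z r = 0) : (bFamily k d z).2 i = 0 := by
  funext ⟨r, hr⟩
  subst hr
  induction r using Fin.cases with
  | zero => rfl
  | succ i => exact h i.succ rfl (by simp)

/-- The component at `x_c` of the image of a family of vectors at `y_0', y_1, …, y_n`. -/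
def primeColumn (V : Rep k (StarVertex n) d) (p : (Fin (d yPrime) → k) × ∀ i, YSpace k d i)
    (c : ℕ) : XSpace k d c :=
  column (betaMap V) (alphaMap V) c p.2 + Pi.single (M := XSpace k d) 1 (primeMap V p.1) c

theorem primeColumn_apply (hn : n ≠ 0) (V : Rep k (StarVertex n) d)
    (z : ∀ r, Fin (d (rowB r)) → k) (r : Fin (n + 1)) :
    primeColumn V (bFamily k d z) r ⟨r, rfl⟩ =
      ∑ r' : Fin (n + 1), z r' ᵥ* starBlock V (rowB r') (x r) := by
  have := NeZero.mk hn
  have e0 : (bFamily k d z).2 (0 : Fin (n + 1)) ⟨0, rfl⟩ = 0 :=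
    congrFun (bFamily_snd_zero z) ⟨0, rfl⟩
  have e1 : column (betaMap V) (alphaMap V) r (bFamily k d z).2 ⟨r, rfl⟩ =
      ∑ i : Fin n, z i.succ ᵥ* starBlock V (rowB i.succ) (x r) := by
    refine (column_apply V _ r).trans ((Fin.sum_univ_succ _).trans ?_)
    refine Eq.trans (congrArg₂ (· + ·) ?_ rfl) (zero_add _)
    exact (congrArg (· ᵥ* starBlock V (y 0) (x r)) e0).trans (Matrix.zero_vecMul _)
  refine Eq.trans ?_ (Fin.sum_univ_succ _).symm
  refine (congrArg₂ (· + ·) e1 ?_).trans (add_comm _ _)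
  change _ = z 0 ᵥ* starBlock V yPrime (x r)
  by_cases h : r = 1
  · subst h
    have : ∀ (c : ℕ) (h : ((1 : Fin (n + 1)) : ℕ) = c),
        (Pi.single (M := XSpace k d) 1 (primeMap V (bFamily k d z).1) c) ⟨1, h⟩ =
          z 0 ᵥ* starBlock V yPrime (x 1) := by
      intro c h
      -- The numeral 1 of `Fin (n + 1)` is 1 modulo n + 1, hence has value 1 only because n ≠ 0.
      obtain rfl : c = 1 := h.symm.trans (Nat.mod_eq_of_lt (by omega : 1 < n + 1))
      rw [Pi.single_eq_same]
      rfl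
    exact this _ rfl
  · refine Eq.trans (congrFun (Pi.single_eq_of_ne (fun h' => h (Fin.ext ?_)) _) _)
      ((congrArg (z 0 ᵥ* ·) (starBlock_yPrime_eq_zero V h)).trans (Matrix.vecMul_zero _)).symm
    exact h'.trans (Nat.mod_eq_of_lt (by omega)).symm

/-- Rank-nullity for v ↦ v A, with row rank equal to column rank. -/
theorem finrank_ker_vecMulLinear_congr {m l : Type*} [Fintype m] [Fintype l]
    {A B : Matrix m l k} (h : A.rank = B.rank) :
    finrank k A.vecMulLinear.ker = finrank k B.vecMulLinear.ker := by
  have key : ∀ A : Matrix m l k, A.rank + finrank k A.vecMulLinear.ker = finrank k (m → k) := by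
    intro A
    rw [← LinearMap.finrank_range_add_finrank_ker A.vecMulLinear, ← Matrix.rank_transpose,
      Matrix.rank, Matrix.mulVecLin_transpose]
  have e1 := key A
  have e2 := key B
  omega

/-- The scheme for identifying matrix kernels: J rewrites a coefficient vector of the matrix as
families of vectors at the vertices, and the equations of K pull back to those of the matrix. -/
theorem finrank_eq_finrank_ker {M N L : Type*} [AddCommGroup M] [Module k M] [AddCommGroup N]
    [Module k N] [AddCommGroup L] [Module k L] {J : M →ₗ[k] N} (hJ : Function.Injective J)
    {K : Submodule k N} (hK : ∀ z ∈ K, ∃ v, J v = z) {f : M →ₗ[k] L}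
    (hf : ∀ v, J v ∈ K ↔ f v = 0) : finrank k f.ker = finrank k K := by
  have e : f.ker.map J = K := by
    ext z
    constructor
    · rintro ⟨v, hv, rfl⟩
      exact (hf v).2 hv
    · intro hz
      obtain ⟨v, rfl⟩ := hK z hz
      exact ⟨v, (hf v).1 hz, rfl⟩
  rw [← e, LinearEquiv.finrank_eq (Submodule.equivMapOfInjective J hJ f.ker)]

theorem vecMul_eval_apply {Q : Type*} [Quiver Q] (Φ : QMatrix k Q) {d : Q → ℕ} (V : Rep k Q d)
    (v : (Σ i, Fin (d (Φ.row i))) → k) (j : Φ.κ) (s : Fin (d (Φ.col j))) :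
    (v ᵥ* Φ.eval V) ⟨j, s⟩ =
      (∑ i, (fun t => v ⟨i, t⟩) ᵥ* ((Φ.entry i j).sum fun l t => t • evalPath V l)) s := by
  rw [Matrix.vecMul, dotProduct, Fintype.sum_sigma, Finset.sum_apply]
  rfl

theorem vecMulLinear_eval_eq_zero_iff {Q : Type*} [Quiver Q] (Φ : QMatrix k Q) {d : Q → ℕ}
    (V : Rep k Q d) (v : (Σ i, Fin (d (Φ.row i))) → k) {f : ∀ j : Φ.κ, Fin (d (Φ.col j)) → k}
    (hf : ∀ j : Φ.κ, ∑ i, (fun t => v ⟨i, t⟩) ᵥ*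
      ((Φ.entry i j).sum fun l t => t • evalPath V l) = f j) :
    (Φ.eval V).vecMulLinear v = 0 ↔ ∀ j : Φ.κ, f j = 0 := by
  rw [Matrix.vecMulLinear_apply]
  constructor
  · intro h j
    funext s
    rw [← hf, ← vecMul_eval_apply, h]
    rfl
  · intro h
    funext ⟨j, s⟩
    rw [vecMul_eval_apply, hf, h]
    rfl

/-- A rectangular submatrix of `A`. -/
def rectangle (k : Type*) [Field k] (n : ℕ) (lo hi clo chi : ℕ) : QMatrix k (StarVertex n) where
  ι := {r : Fin (n + 1) // lo ≤ r ∧ r ≤ hi}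
  κ := {c : Fin (n + 1) // clo ≤ c ∧ c ≤ chi}
  row := fun r => y r
  col := fun c => x c
  entry := fun _ _ => arrowEntry k _ _

theorem finrank_ker_rectangle (V : Rep k (StarVertex n) d) (lo hi clo chi : ℕ) :
    finrank k ((rectangle k n lo hi clo chi).eval V).vecMulLinear.ker =
      finrank k (chainKer (betaMap V) (alphaMap V) lo (hi + 1) clo (chi + 1)) := by
  let P : Fin (n + 1) → Prop := fun r => lo ≤ r ∧ r ≤ hi
  refine finrank_eq_finrank_ker
    (J := yFamily k d ∘ₗ extendRows k d y P) (yFamily_injective.comp extendRows_injective)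
    (fun u hu => ⟨fun p => u p.1 ⟨p.1, rfl⟩ p.2, ?_⟩) (fun v => ?_)
  · rw [LinearMap.comp_apply]
    refine Eq.trans (congrArg _ (exists_extendRows_eq (z := fun r => u r ⟨r, rfl⟩) fun r hr => ?_))
      (yFamily_eq u)
    have := hu.1 r (by simp only [P] at hr; omega)
    exact congrFun this ⟨r, rfl⟩
  · refine Iff.trans ?_ (vecMulLinear_eval_eq_zero_iff (rectangle k n lo hi clo chi) V v
      (f := fun c => column (betaMap V) (alphaMap V) c.1
        (yFamily k d (extendRows k d y P v)) ⟨c.1, rfl⟩) fun c => ?_).symm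
    · rw [LinearMap.comp_apply, mem_chainKer, forall_column_eq_zero_iff,
        yFamily_eq_zero_iff (Q := fun i => i < lo ∨ hi + 1 ≤ i)]
      refine ⟨fun h c => h.2 c.1 c.2.1 (Nat.lt_succ_of_le c.2.2), fun h => ⟨fun r hr => ?_,
        fun c hc hc' => h ⟨c, hc, Nat.le_of_lt_succ hc'⟩⟩⟩
      exact extendRows_of_not_mem v (by simp only [P]; omega)
    · exact (sum_extendRows v fun r => starBlock V (y r) (x c.1)).trans
        (column_apply V (yFamily k d (extendRows k d y P v)) c.1).symm

theorem finrank_ker_zigzag (V : Rep k (StarVertex n) d) {γ : StarArrow n} (δ : StarArrow n)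
    (h : γ ≠ alphaPrime) :
    finrank k ((zigzag k γ δ).eval V).vecMulLinear.ker =
      finrank k (chainKer (betaMap V) (alphaMap V) γ.rowIdx (δ.rowIdx + 1)
        γ.colIdx (δ.colIdx + 1)) := by
  cases γ with
  | alpha i => exact finrank_ker_rectangle V _ _ _ _
  | beta i => exact finrank_ker_rectangle V _ _ _ _
  | alphaPrime => exact absurd rfl h

variable [NeZero n]

theorem finrank_ker_zigzag_prime (V : Rep k (StarVertex n) d) (δ : StarArrow n) :
    finrank k ((zigzag k alphaPrime δ).eval V).vecMulLinear.ker =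
      finrank k (primeKer (betaMap V) (alphaMap V) (primeMap V) (δ.rowIdx + 1)
        (δ.colIdx + 1)) := by
  let P : Fin (n + 1) → Prop := fun r => 0 ≤ (r : ℕ) ∧ r ≤ δ.rowIdx
  refine finrank_eq_finrank_ker
    (J := bFamily k d ∘ₗ extendRows k d rowB P) (bFamily_injective.comp extendRows_injective)
    (fun p hu => ⟨fun t => ofPrime p.1 p.2 t.1 t.2, ?_⟩) (fun v => ?_)
  · obtain ⟨q, w⟩ := p
    rw [LinearMap.comp_apply]
    refine Eq.trans (congrArg _ (exists_extendRows_eq (z := ofPrime q w) fun r hr => ?_))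
      (bFamily_ofPrime q (hu.1 0 (by omega)))
    simp only [P] at hr
    exact ofPrime_eq_zero (by omega) (hu.1 r (by omega))
  · refine Iff.trans ?_ (vecMulLinear_eval_eq_zero_iff (zigzag k alphaPrime δ) V v
      (f := fun c => primeColumn V (bFamily k d (extendRows k d rowB P v)) c.1 ⟨c.1, rfl⟩)
      fun c => ?_).symm
    · refine Iff.trans (b := ∀ c, 1 ≤ c → c < δ.colIdx + 1 →
        primeColumn V (bFamily k d (extendRows k d rowB P v)) c = 0)
        ⟨fun h => h.2, fun h => ⟨fun i hi => ?_, h⟩⟩ ?_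
      · refine bFamily_snd_eq_zero _ fun r hr h1 => ?_
        exact extendRows_of_not_mem v (by simp only [P]; omega)
      · rw [forall_column_eq_zero_iff]
        exact ⟨fun h c => h c.1 c.2.1 (Nat.lt_succ_of_le c.2.2),
          fun h c hc hc' => h ⟨c, hc, Nat.le_of_lt_succ hc'⟩⟩
    · exact (sum_extendRows v fun r => starBlock V (rowB r) (x c.1)).trans
        (primeColumn_apply (NeZero.ne n) V _ _).symm

end StarKernels

end TypeD

end

noncomputable section

namespace TypeD

open Module Matrix

/-! ### Left kernels of the matrices ⟦γ, δ⟧. -/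

section DoubleKernels

open StarVertex StarArrow

variable {k : Type*} [Field k] {n : ℕ} {d : StarVertex n → ℕ}

/-- The coordinates indexed by the first summand. -/
def leftRows {ι κ : Type*} (e : ι ⊕ κ → ℕ) :
    ((Σ i, Fin (e i)) → k) →ₗ[k] (Σ i, Fin (e (Sum.inl i))) → k :=
  LinearMap.funLeft k k fun p => ⟨Sum.inl p.1, p.2⟩

/-- The coordinates indexed by the second summand. -/
def rightRows {ι κ : Type*} (e : ι ⊕ κ → ℕ) :
    ((Σ i, Fin (e i)) → k) →ₗ[k] (Σ i, Fin (e (Sum.inr i))) → k :=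
  LinearMap.funLeft k k fun p => ⟨Sum.inr p.1, p.2⟩

theorem eq_of_leftRows_of_rightRows {ι κ : Type*} {e : ι ⊕ κ → ℕ} {v w : (Σ i, Fin (e i)) → k}
    (h : leftRows e v = leftRows e w) (h' : rightRows e v = rightRows e w) : v = w := by
  funext ⟨i, t⟩
  cases i with
  | inl i => exact congrFun h ⟨i, t⟩
  | inr i => exact congrFun h' ⟨i, t⟩

theorem exists_leftRows_rightRows {ι κ : Type*} (e : ι ⊕ κ → ℕ)
    (v : (Σ i, Fin (e (Sum.inl i))) → k) (w : (Σ i, Fin (e (Sum.inr i))) → k) :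
    ∃ z, leftRows e z = v ∧ rightRows e z = w :=
  ⟨fun p => match p with
    | ⟨Sum.inl i, t⟩ => v ⟨i, t⟩
    | ⟨Sum.inr i, t⟩ => w ⟨i, t⟩, rfl, rfl⟩

section Truncate

variable {X Y : ℕ → Type*} [∀ i, AddCommGroup (X i)] [∀ i, Module k (X i)]
  [∀ i, AddCommGroup (Y i)] [∀ i, Module k (Y i)]
  {b : ∀ i, Y i →ₗ[k] X i} {a : ∀ i, Y i →ₗ[k] X (i + 1)}

/-- Replace the component in degree zero by zero. -/
def dropZero (k : Type*) [Field k] (Y : ℕ → Type*) [∀ i, AddCommGroup (Y i)]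
    [∀ i, Module k (Y i)] : (∀ i, Y i) →ₗ[k] ∀ i, Y i :=
  LinearMap.id - LinearMap.single k Y 0 ∘ₗ LinearMap.proj 0

theorem dropZero_zero (u : ∀ i, Y i) : dropZero k Y u 0 = 0 := by
  simp [dropZero]

theorem dropZero_of_ne (u : ∀ i, Y i) {i : ℕ} (h : i ≠ 0) : dropZero k Y u i = u i := by
  simp [dropZero, h]

theorem column_dropZero (u : ∀ i, Y i) {c : ℕ} (hc : 1 ≤ c) :
    column b a c (dropZero k Y u) + Pi.single (M := X) 1 (a 0 (u 0)) c = column b a c u := by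
  have h : dropZero k Y u = u - Pi.single 0 (u 0) := rfl
  rw [h, map_sub, column_single, Pi.single_eq_of_ne (show c ≠ 0 by omega)]
  simp

end Truncate

/-- The change of variables between ⟦γ, δ⟧ and `doubleKer`: the rows of u other than u_0 are
absorbed into the second family, while u_0 acts on it only through its image in X_1. -/
theorem column_add_primeColumn (V : Rep k (StarVertex n) d) (u w : ∀ i, YSpace k d i)
    (q : Fin (d yPrime) → k) {c : ℕ} (hc : 1 ≤ c) :
    column (betaMap V) (alphaMap V) c (dropZero k (YSpace k d) u + w) +
      Pi.single (M := XSpace k d) 1 (alphaMap V 0 (u 0) + primeMap V q) c =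
    column (betaMap V) (alphaMap V) c u + primeColumn V (q, w) c := by
  rw [← column_dropZero u hc, primeColumn, map_add, Pi.single_add, Pi.add_apply]
  abel

theorem primeColumn_neg (V : Rep k (StarVertex n) d) (w : ∀ i, YSpace k d i)
    (q : Fin (d yPrime) → k) (c : ℕ) :
    primeColumn V (-q, -w) c = - primeColumn V (q, w) c := by
  rw [primeColumn, primeColumn, map_neg, map_neg, Pi.single_neg, Pi.neg_apply, neg_add]

theorem yFamily_extendRows_eq_zero {P : Fin (n + 1) → Prop} [DecidablePred P]
    (v : (Σ i : {r // P r}, Fin (d (y i))) → k) {i : ℕ}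
    (h : ∀ r : Fin (n + 1), (r : ℕ) = i → ¬ P r) :
    yFamily k d (extendRows k d y P v) i = 0 := by
  funext ⟨r, hr⟩
  exact extendRows_of_not_mem v (h r hr)

theorem bFamily_extendRows_eq_zero {P : Fin (n + 1) → Prop} [DecidablePred P]
    (v : (Σ i : {r // P r}, Fin (d (rowB i))) → k) {i : ℕ}
    (h : ∀ r : Fin (n + 1), (r : ℕ) = i → 1 ≤ i → ¬ P r) :
    (bFamily k d (extendRows k d rowB P v)).2 i = 0 :=
  bFamily_snd_eq_zero _ fun r hr h1 => extendRows_of_not_mem v (h r hr h1)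

theorem exists_yFamily_extendRows {P : Fin (n + 1) → Prop} [DecidablePred P]
    {u : ∀ i, YSpace k d i} (h : ∀ r : Fin (n + 1), ¬ P r → u r = 0) :
    ∃ v, yFamily k d (extendRows k d y P v) = u :=
  ⟨_, (congrArg _ (exists_extendRows_eq (z := fun r => u r ⟨r, rfl⟩)
    fun r hr => congrFun (h r hr) ⟨r, rfl⟩)).trans (yFamily_eq u)⟩

theorem exists_bFamily_extendRows {P : Fin (n + 1) → Prop} [DecidablePred P] (h0 : P 0)
    (q : Fin (d yPrime) → k) {w : ∀ i, YSpace k d i} (hw : w 0 = 0)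
    (h : ∀ r : Fin (n + 1), ¬ P r → w r = 0) :
    ∃ v, bFamily k d (extendRows k d rowB P v) = (q, w) := by
  refine ⟨_, (congrArg _ (exists_extendRows_eq (z := ofPrime q w) fun r hr => ?_)).trans
    (bFamily_ofPrime q hw)⟩
  refine ofPrime_eq_zero (Nat.one_le_iff_ne_zero.2 fun e => hr ?_) (h r hr)
  obtain rfl : r = 0 := Fin.ext e
  exact h0

theorem sum_vecMul_zero {ι : Type*} [Fintype ι] (V : Rep k (StarVertex n) d)
    {p : ι → StarVertex n} {q : StarVertex n} (w : ∀ i, Fin (d (p i)) → k) :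
    ∑ i, w i ᵥ* ((0 : Quiver.Path (p i) q →₀ k).sum fun l t => t • evalPath V l) = 0 := by
  simp

theorem sum_sumType_eq_add {ι κ M : Type*} [Fintype ι] [Fintype κ] [AddCommMonoid M]
    {f : ι ⊕ κ → M} {a b : M} (h : ∑ i, f (.inl i) = a) (h' : ∑ i, f (.inr i) = b) :
    ∑ i, f i = a + b := by
  rw [Fintype.sum_sum_type, h, h']

theorem sum_sumType_eq_left {ι κ M : Type*} [Fintype ι] [Fintype κ] [AddCommMonoid M]
    {f : ι ⊕ κ → M} {a : M} (h : ∑ i, f (.inl i) = a) (h' : ∑ i, f (.inr i) = 0) :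
    ∑ i, f i = a := by
  rw [sum_sumType_eq_add h h', add_zero]

theorem sum_sumType_eq_right {ι κ M : Type*} [Fintype ι] [Fintype κ] [AddCommMonoid M]
    {f : ι ⊕ κ → M} {b : M} (h : ∑ i, f (.inl i) = 0) (h' : ∑ i, f (.inr i) = b) :
    ∑ i, f i = b := by
  rw [sum_sumType_eq_add h h', zero_add]

variable [NeZero n]

/-- Let u be the coefficients of the rows of M and (q, w) those of N. Before column i, the columns
of M and N vanish separately if and only if that of M and the sum of both vanish. So the sum
vanishes in every column from 1 on, and that of M before i; replacing w by `dropZero` u + w turns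
this into `doubleKer`. -/
theorem finrank_ker_doubleAlpha (V : Rep k (StarVertex n) d) {i : ℕ} (hi : 1 ≤ i)
    (δ : StarArrow n) (hδ : i ≤ δ.colIdx + 1) :
    finrank k ((doubleAlpha k i δ).eval V).vecMulLinear.ker =
      finrank k (doubleKer (betaMap V) (alphaMap V) (primeMap V) (δ.rowIdx + 1) i
        (δ.rowIdx + 1) (δ.colIdx + 1)) := by
  let P : Fin (n + 1) → Prop := fun r => (r : ℕ) ≤ δ.rowIdx
  let e := fun r => d ((doubleAlpha k i δ).row r)
  let U : ((Σ r, Fin (e r)) → k) →ₗ[k] ∀ i, YSpace k d i :=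
    yFamily k d ∘ₗ extendRows k d y P ∘ₗ leftRows e
  let B : ((Σ r, Fin (e r)) → k) →ₗ[k] (Fin (d yPrime) → k) × ∀ i, YSpace k d i :=
    bFamily k d ∘ₗ extendRows k d rowB P ∘ₗ rightRows e
  let J := ((LinearMap.fst k _ _ ∘ₗ B).prod U).prod
    (dropZero k (YSpace k d) ∘ₗ U + LinearMap.snd k _ _ ∘ₗ B)
  have hU : ∀ v r, r < 0 ∨ δ.rowIdx + 1 ≤ r → U v r = 0 := fun v r hr =>
    yFamily_extendRows_eq_zero (P := P) (leftRows e v) fun r' hr' => by simp only [P]; omega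
  have hB : ∀ v r, r < 1 ∨ δ.rowIdx + 1 ≤ r → (B v).2 r = 0 := fun v r hr =>
    bFamily_extendRows_eq_zero (P := P) (rightRows e v) fun r' hr' h1 => by simp only [P]; omega
  refine finrank_eq_finrank_ker (J := J) (fun v w h => ?_) (fun z hz => ?_) (fun v => ?_)
  · have h1 : (B v).1 = (B w).1 := congrArg (fun z => z.1.1) h
    have h2 : U v = U w := congrArg (fun z => z.1.2) h
    have h3 : dropZero k (YSpace k d) (U v) + (B v).2 = dropZero k (YSpace k d) (U w) + (B w).2 :=
      congrArg Prod.snd h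
    rw [h2] at h3
    have h4 : B v = B w := Prod.ext h1 (add_left_cancel h3)
    exact eq_of_leftRows_of_rightRows (extendRows_injective (yFamily_injective h2))
      (extendRows_injective (bFamily_injective h4))
  · obtain ⟨⟨q, u⟩, w⟩ := z
    rw [mem_doubleKer, mem_chainKer] at hz
    obtain ⟨⟨h1, h2⟩, h3, h4⟩ := hz
    obtain ⟨v₁, hv₁⟩ := exists_yFamily_extendRows (P := P) (u := u)
      fun r hr => h1 r (by simp only [P] at hr; omega)
    obtain ⟨v₂, hv₂⟩ := exists_bFamily_extendRows (P := P) (by simp [P]) q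
      (w := w - dropZero k (YSpace k d) u)
      (by rw [Pi.sub_apply, dropZero_zero, h3 0 (by omega), sub_zero])
      (fun r hr => by
        simp only [P] at hr
        rw [Pi.sub_apply, dropZero_of_ne _ (by omega), h3 r (by omega), h1 r (by omega), sub_zero])
    obtain ⟨v, rfl, rfl⟩ := exists_leftRows_rightRows e v₁ v₂
    refine ⟨v, ?_⟩
    change (((B v).1, U v), dropZero k (YSpace k d) (U v) + (B v).2) = _
    have e1 : U v = u := hv₁
    have e2 : B v = _ := hv₂
    rw [e1, e2, add_sub_cancel]
  · refine Iff.trans ?_ (vecMulLinear_eval_eq_zero_iff (doubleAlpha k i δ) V v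
      (f := fun j => match j with
        | .inl c => column (betaMap V) (alphaMap V) c.1 (U v) ⟨c.1, rfl⟩
        | .inr (.inl c) => primeColumn V (B v) c.1 ⟨c.1, rfl⟩
        | .inr (.inr c) => (column (betaMap V) (alphaMap V) c.1 (U v) +
            primeColumn V (B v) c.1) ⟨c.1, rfl⟩) ?_).symm
    · refine Iff.trans (b := (∀ c, 0 ≤ c → c < i → column (betaMap V) (alphaMap V) c (U v) = 0) ∧
        (∀ c, 1 ≤ c → c < i → primeColumn V (B v) c = 0) ∧
        ∀ c, i ≤ c → c < δ.colIdx + 1 →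
          column (betaMap V) (alphaMap V) c (U v) + primeColumn V (B v) c = 0) ?_ ?_
      · have key : ∀ c, 1 ≤ c → column (betaMap V) (alphaMap V) c (J v).2 +
            Pi.single (M := XSpace k d) 1
              (alphaMap V 0 ((J v).1.2 0) + primeMap V (J v).1.1) c =
            column (betaMap V) (alphaMap V) c (U v) + primeColumn V (B v) c :=
          fun c hc => column_add_primeColumn V (U v) (B v).2 (B v).1 hc
        constructor
        · rintro ⟨⟨-, h2⟩, -, h4⟩
          have h2 : ∀ c, 0 ≤ c → c < i → column (betaMap V) (alphaMap V) c (U v) = 0 := h2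
          refine ⟨h2, fun c h1 hc => ?_, fun c h1 hc => ?_⟩
          · have := h4 c h1 (by omega)
            rw [key c h1] at this
            rwa [h2 c (by omega) hc, zero_add] at this
          · rw [← key c (by omega)]
            exact h4 c (by omega) hc
        · rintro ⟨h1, h2, h3⟩
          refine ⟨⟨hU v, h1⟩, fun r hr => ?_, fun c hc hc' => ?_⟩
          · change dropZero k (YSpace k d) (U v) r + (B v).2 r = 0
            rw [hB v r hr, add_zero]
            rcases Nat.eq_zero_or_pos r with rfl | h0
            · exact dropZero_zero _
            · rw [dropZero_of_ne _ (by omega), hU v r (by omega)]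
          · rw [key c hc]
            rcases Nat.lt_or_ge c i with h | h
            · rw [h1 c (by omega) h, h2 c hc h, add_zero]
            · exact h3 c h hc'
      · rw [forall_column_eq_zero_iff, forall_column_eq_zero_iff, forall_column_eq_zero_iff
          (fun c => column (betaMap V) (alphaMap V) c (U v) + primeColumn V (B v) c)]
        constructor
        · rintro ⟨h1, h2, h3⟩ (c | c | c)
          · exact h1 c.1 (by omega) c.2
          · exact h2 c.1 c.2.1 c.2.2
          · exact h3 c.1 c.2.1 (Nat.lt_succ_of_le c.2.2)
        · exact fun h => ⟨fun c _ hc => h (.inl ⟨c, hc⟩),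
            fun c hc hc' => h (.inr (.inl ⟨c, hc, hc'⟩)),
            fun c hc hc' => h (.inr (.inr ⟨c, hc, Nat.le_of_lt_succ hc'⟩))⟩
    · have eU := fun c => (sum_extendRows (P := P) (leftRows e v)
        fun r => starBlock V (y r) (x c)).trans (column_apply V (U v) c).symm
      have eB := fun c => (sum_extendRows (P := P) (rightRows e v)
        fun r => starBlock V (rowB r) (x c)).trans (primeColumn_apply (NeZero.ne n) V _ c).symm
      rintro (c | c | c)
      · exact sum_sumType_eq_left (eU c.1) (sum_vecMul_zero V _)
      · exact sum_sumType_eq_right (sum_vecMul_zero V _) (eB c.1)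
      · exact sum_sumType_eq_add (eU c.1) (eB c.1)

/-- Let U and B be the coefficients of the rows of M and N before y_i, and T those of the shared
rows. The columns of U + T and of B + T vanish if and only if those of U + T and of the difference U
− B do, where for columns beyond i the latter is automatic because rows before i do not reach them.
The difference explains the sign in front of the component in Q. -/
theorem finrank_ker_doubleBeta (V : Rep k (StarVertex n) d) {i : ℕ} (hi : 1 ≤ i)
    (δ : StarArrow n) (hδ : i ≤ δ.colIdx) (hδ' : i ≤ δ.rowIdx + 1) :
    finrank k ((doubleBeta k i δ).eval V).vecMulLinear.ker =
      finrank k (doubleKer (betaMap V) (alphaMap V) (primeMap V) (δ.rowIdx + 1) (δ.colIdx + 1)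
        i (i + 1)) := by
  let P : Fin (n + 1) → Prop := fun r => (r : ℕ) < i
  let R : Fin (n + 1) → Prop := fun r => i ≤ (r : ℕ) ∧ (r : ℕ) ≤ δ.rowIdx
  let e := fun r => d ((doubleBeta k i δ).row r)
  let U : ((Σ r, Fin (e r)) → k) →ₗ[k] ∀ i, YSpace k d i :=
    yFamily k d ∘ₗ extendRows k d y P ∘ₗ leftRows e
  let B : ((Σ r, Fin (e r)) → k) →ₗ[k] (Fin (d yPrime) → k) × ∀ i, YSpace k d i :=
    bFamily k d ∘ₗ extendRows k d rowB P ∘ₗ leftRows _ ∘ₗ rightRows e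
  let T : ((Σ r, Fin (e r)) → k) →ₗ[k] ∀ i, YSpace k d i :=
    yFamily k d ∘ₗ extendRows k d y R ∘ₗ rightRows _ ∘ₗ rightRows e
  let J := ((-(LinearMap.fst k _ _ ∘ₗ B)).prod (U + T)).prod
    (dropZero k (YSpace k d) ∘ₗ U - LinearMap.snd k _ _ ∘ₗ B)
  have hU : ∀ v r, i ≤ r → U v r = 0 := fun v r hr =>
    yFamily_extendRows_eq_zero (P := P) (leftRows e v) fun r' hr' => by simp only [P]; omega
  have hB : ∀ v r, r < 1 ∨ i ≤ r → (B v).2 r = 0 := fun v r hr =>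
    bFamily_extendRows_eq_zero (P := P) (leftRows _ (rightRows e v)) fun r' hr' h1 => by
      simp only [P]; omega
  have hT : ∀ v r, r < i ∨ δ.rowIdx + 1 ≤ r → T v r = 0 := fun v r hr =>
    yFamily_extendRows_eq_zero (P := R) (rightRows _ (rightRows e v)) fun r' hr' => by
      simp only [R]; omega
  refine finrank_eq_finrank_ker (J := J) ?_ (fun z hz => ?_) (fun v => ?_)
  · rw [← LinearMap.ker_eq_bot, LinearMap.ker_eq_bot']
    intro v h
    have h1 : -(B v).1 = 0 := congrArg (fun z => z.1.1) h
    have h2 : U v + T v = 0 := congrArg (fun z => z.1.2) h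
    have h3 : dropZero k (YSpace k d) (U v) - (B v).2 = 0 := congrArg Prod.snd h
    have hU0 : U v = 0 := by
      funext r
      rcases Nat.lt_or_ge r i with hr | hr
      · have := congrFun h2 r
        rwa [Pi.add_apply, hT v r (Or.inl hr), add_zero] at this
      · exact hU v r hr
    rw [hU0, zero_add] at h2
    rw [hU0, map_zero, zero_sub, neg_eq_zero] at h3
    have hB0 : B v = 0 := Prod.ext (neg_eq_zero.1 h1) h3
    refine eq_of_leftRows_of_rightRows (extendRows_injective (yFamily_injective ?_))
      (eq_of_leftRows_of_rightRows (extendRows_injective (bFamily_injective ?_))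
        (extendRows_injective (yFamily_injective ?_)))
    · exact hU0.trans (U.map_zero).symm
    · exact hB0.trans (B.map_zero).symm
    · exact h2.trans (T.map_zero).symm
  · obtain ⟨⟨q, u⟩, w⟩ := z
    rw [mem_doubleKer, mem_chainKer] at hz
    obtain ⟨⟨h1, h2⟩, h3, h4⟩ := hz
    obtain ⟨v₁, hv₁⟩ := exists_yFamily_extendRows (P := P)
      (u := fun r => if r < i then u r else 0) fun r hr => if_neg hr
    obtain ⟨v₃, hv₃⟩ := exists_yFamily_extendRows (P := R)
      (u := fun r => if r < i then 0 else u r) fun r hr => by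
        simp only [R] at hr
        split_ifs
        · rfl
        · exact h1 r (by omega)
    obtain ⟨v₂, hv₂⟩ := exists_bFamily_extendRows (P := P) (by simp only [P, Fin.val_zero]; omega)
      (-q) (w := dropZero k (YSpace k d) (fun r => if r < i then u r else 0) - w)
      (by rw [Pi.sub_apply, dropZero_zero, h3 0 (by omega), sub_zero])
      (fun r hr => by
        simp only [P] at hr
        rw [Pi.sub_apply, dropZero_of_ne _ (by omega), if_neg hr, h3 r (by omega), sub_zero])
    obtain ⟨v', rfl, rfl⟩ := exists_leftRows_rightRows (fun r => e (Sum.inr r)) v₂ v₃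
    obtain ⟨v, rfl, rfl⟩ := exists_leftRows_rightRows e v₁ v'
    refine ⟨v, ?_⟩
    change ((-(B v).1, U v + T v), dropZero k (YSpace k d) (U v) - (B v).2) = _
    have e1 : U v = _ := hv₁
    have e2 : B v = _ := hv₂
    have e3 : T v = _ := hv₃
    rw [e1, e2, e3, neg_neg, sub_sub_cancel]
    congr 2
    funext r
    rw [Pi.add_apply]
    split_ifs
    · exact add_zero _
    · exact zero_add _
  · refine Iff.trans ?_ (vecMulLinear_eval_eq_zero_iff (doubleBeta k i δ) V v
      (f := fun j => match j with
        | .inl c => (column (betaMap V) (alphaMap V) c.1 (U v) +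
            column (betaMap V) (alphaMap V) c.1 (T v)) ⟨c.1, rfl⟩
        | .inr c => (primeColumn V (B v) c.1 +
            column (betaMap V) (alphaMap V) c.1 (T v)) ⟨c.1, rfl⟩) ?_).symm
    · refine Iff.trans (b := (∀ c, 0 ≤ c → c < δ.colIdx + 1 →
          column (betaMap V) (alphaMap V) c (U v) + column (betaMap V) (alphaMap V) c (T v) = 0) ∧
        ∀ c, 1 ≤ c → c < δ.colIdx + 1 →
          primeColumn V (B v) c + column (betaMap V) (alphaMap V) c (T v) = 0) ?_ ?_
      · have key : ∀ c, 1 ≤ c → column (betaMap V) (alphaMap V) c (J v).2 +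
            Pi.single (M := XSpace k d) 1
              (alphaMap V 0 ((J v).1.2 0) + primeMap V (J v).1.1) c =
            column (betaMap V) (alphaMap V) c (U v) - primeColumn V (B v) c := by
          intro c hc
          have e1 := column_add_primeColumn V (U v) (-(B v).2) (-(B v).1) hc
          rw [primeColumn_neg, ← sub_eq_add_neg, ← sub_eq_add_neg] at e1
          have e2 : (J v).1.2 0 = U v 0 := by
            change U v 0 + T v 0 = _
            rw [hT v 0 (by omega), add_zero]
          rw [← e1, e2]
          rfl
        constructor
        · rintro ⟨⟨-, h2⟩, -, h4⟩
          have h2 : ∀ c, 0 ≤ c → c < δ.colIdx + 1 → column (betaMap V) (alphaMap V) c (U v) +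
              column (betaMap V) (alphaMap V) c (T v) = 0 := fun c h h' => by
            rw [← map_add]
            exact h2 c h h'
          refine ⟨h2, fun c h1 hc => ?_⟩
          rw [← h2 c (by omega) hc]
          congr 1
          rcases Nat.lt_or_ge i c with h | h
          · rw [column_eq_zero (hU v c h.le) fun j hj => hU v j (by omega), primeColumn,
              column_eq_zero (hB v c (Or.inr h.le)) fun j hj => hB v j (by omega),
              Pi.single_eq_of_ne (by omega), add_zero]
          · have := h4 c h1 (by omega)
            rw [key c h1] at this
            exact (sub_eq_zero.1 this).symm
        · rintro ⟨h1, h2⟩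
          refine ⟨⟨fun r hr => ?_, fun c hc hc' => ?_⟩, fun r hr => ?_, fun c hc hc' => ?_⟩
          · change U v r + T v r = 0
            rw [hU v r (by omega), hT v r (by omega), add_zero]
          · change column (betaMap V) (alphaMap V) c (U v + T v) = 0
            rw [map_add]
            exact h1 c hc hc'
          · change dropZero k (YSpace k d) (U v) r - (B v).2 r = 0
            rw [hB v r hr, sub_zero]
            rcases Nat.eq_zero_or_pos r with rfl | h0
            · exact dropZero_zero _
            · rw [dropZero_of_ne _ (by omega), hU v r (by omega)]
          · rw [key c hc, sub_eq_zero]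
            exact add_right_cancel ((h1 c (by omega) (by omega)).trans
              (h2 c hc (by omega)).symm)
      · rw [forall_column_eq_zero_iff (fun c => column (betaMap V) (alphaMap V) c (U v) +
            column (betaMap V) (alphaMap V) c (T v)),
          forall_column_eq_zero_iff (fun c => primeColumn V (B v) c +
            column (betaMap V) (alphaMap V) c (T v))]
        constructor
        · rintro ⟨h1, h2⟩ (c | c)
          · exact h1 c.1 (by omega) (Nat.lt_succ_of_le c.2)
          · exact h2 c.1 c.2.1 (Nat.lt_succ_of_le c.2.2)
        · exact fun h => ⟨fun c _ hc => h (.inl ⟨c, Nat.le_of_lt_succ hc⟩),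
            fun c hc hc' => h (.inr ⟨c, hc, Nat.le_of_lt_succ hc'⟩)⟩
    · have eU := fun c => (sum_extendRows (P := P) (leftRows e v)
        fun r => starBlock V (y r) (x c)).trans (column_apply V (U v) c).symm
      have eB := fun c => (sum_extendRows (P := P) (leftRows _ (rightRows e v))
        fun r => starBlock V (rowB r) (x c)).trans (primeColumn_apply (NeZero.ne n) V _ c).symm
      have eT := fun c => (sum_extendRows (P := R) (rightRows _ (rightRows e v))
        fun r => starBlock V (y r) (x c)).trans (column_apply V (T v) c).symm
      rintro (c | c)
      · exact sum_sumType_eq_add (eU c.1)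
          (sum_sumType_eq_right (sum_vecMul_zero V _) (eT c.1))
      · exact sum_sumType_eq_right (sum_vecMul_zero V _)
          (sum_sumType_eq_add (eB c.1) (eT c.1))

end DoubleKernels

end TypeD

end

noncomputable section

namespace TypeD

open Module Matrix

/-! ### Columns with zero spaces do not matter. -/

section KernelCongruence

variable {k : Type*} [Field k] {X Y : ℕ → Type*} [∀ i, AddCommGroup (X i)] [∀ i, Module k (X i)]
  [∀ i, AddCommGroup (Y i)] [∀ i, Module k (Y i)]
  {b b' : ∀ i, Y i →ₗ[k] X i} {a a' : ∀ i, Y i →ₗ[k] X (i + 1)}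
  {Q : Type*} [AddCommGroup Q] [Module k Q] {g g' : Q →ₗ[k] X 1}

theorem chainKer_congr_of_subsingleton {lo hi clo chi : ℕ}
    (h : ∀ c, clo ≤ c → c < chi → Subsingleton (X c)) :
    chainKer b a lo hi clo chi = chainKer b' a' lo hi clo chi := by
  ext y
  rw [mem_chainKer, mem_chainKer]
  exact and_congr_right fun _ => forall₃_congr fun c h1 h2 =>
    have := h c h1 h2
    ⟨fun _ => Subsingleton.elim _ _, fun _ => Subsingleton.elim _ _⟩

theorem primeKer_of_subsingleton {hi chi : ℕ} (h : Subsingleton (X chi)) :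
    primeKer b a g hi (chi + 1) = primeKer b a g hi chi := by
  ext p
  refine and_congr_right fun _ => ⟨fun h2 c hc hc' => h2 c hc (by omega), fun h2 c hc hc' => ?_⟩
  rcases Nat.lt_or_ge c chi with hlt | hge
  · exact h2 c hc hlt
  · obtain rfl : c = chi := by omega
    exact Subsingleton.elim _ _

theorem doubleKer_of_subsingleton_left {h₁ c₁ h₂ c₂ : ℕ} (h : Subsingleton (X c₁)) :
    doubleKer b a g h₁ (c₁ + 1) h₂ c₂ = doubleKer b a g h₁ c₁ h₂ c₂ := by
  ext ⟨⟨q, u⟩, w⟩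
  rw [mem_doubleKer, mem_doubleKer, chainKer_of_subsingleton h]

theorem doubleKer_of_subsingleton_right {h₁ c₁ h₂ c₂ : ℕ} (h : Subsingleton (X c₂)) :
    doubleKer b a g h₁ c₁ h₂ (c₂ + 1) = doubleKer b a g h₁ c₁ h₂ c₂ := by
  ext p
  refine and_congr_right fun _ => and_congr_right fun _ =>
    ⟨fun h2 c hc hc' => h2 c hc (by omega), fun h2 c hc hc' => ?_⟩
  rcases Nat.lt_or_ge c c₂ with hlt | hge
  · exact h2 c hc hlt
  · obtain rfl : c = c₂ := by omega
    exact Subsingleton.elim _ _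

end KernelCongruence

/-! ### From rank functions to kernel dimensions. -/

section RankFunctions

open StarVertex StarArrow

namespace StarArrow

variable {n : ℕ}

theorem pos_eq (a : StarArrow n) : a.pos = a.rowIdx + a.colIdx := by
  cases a with
  | alpha i =>
    simp only [pos, rowIdx, colIdx]
    omega
  | beta i =>
    simp only [pos, rowIdx, colIdx]
    omega
  | alphaPrime => rfl

theorem le_of_pos_le {a b : StarArrow n} (ha : a ≠ alphaPrime) (hb : b ≠ alphaPrime)
    (h : a.pos ≤ b.pos) : a ≤ b := by
  rcases h.eq_or_lt with h | h
  · exact Or.inl (eq_of_pos_eq h ha hb)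
  · exact Or.inr ⟨h, fun e => hb e.2⟩

theorem alphaPrime_le {a : StarArrow n} (h : 1 < a.pos) : alphaPrime ≤ a :=
  Or.inr ⟨h, fun e => by simp at e⟩

/-- The pair (hi, s) encodes the lower right corner in row hi − 1: it is β_{hi−1} for s = true and
α_{hi} for s = false. Only α_{n+1} is missing; there β_n serves, as the additional column belongs to
X_{n+1} = 0. -/
theorem exists_corner (s : Bool) {hi : ℕ} (h : 1 ≤ hi) (h' : hi ≤ n + 1) :
    ∃ δ : StarArrow n, δ ≠ alphaPrime ∧ δ.rowIdx + 1 = hi ∧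
      (δ.colIdx + 1 = hi + (!s).toNat ∨
        δ.colIdx + 1 = n + 1 ∧ hi + (!s).toNat = n + 1 + 1) := by
  by_cases hs : s = true ∨ hi = n + 1
  · refine ⟨beta ⟨hi - 1, by omega⟩, by simp, by simp only [rowIdx]; omega, ?_⟩
    simp only [colIdx]
    cases s <;> simp at * <;> omega
  · refine ⟨alpha ⟨hi - 1, by omega⟩, by simp, by simp only [rowIdx]; omega, ?_⟩
    simp only [colIdx]
    cases s <;> simp at * <;> omega

end StarArrow

theorem subsingleton_xSpace {k : Type*} {n c : ℕ} {d : StarVertex n → ℕ} (h : n < c) :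
    Subsingleton (XSpace k d c) :=
  ⟨fun u w => funext fun r => absurd r.2 (by omega)⟩

variable {k : Type*} [Field k] {n : ℕ} [NeZero n] {d : StarVertex n → ℕ}

theorem finrank_chainKer_eq {V W : Rep k (StarVertex n) d}
    (h : ∀ f ∈ rankFunctions k n d, f V = f W) {γ δ : StarArrow n} (hγ : γ ≠ alphaPrime)
    (hδ : δ ≠ alphaPrime) (h0 : γ ≠ alpha 0) {lo clo : ℕ} (hr : γ.rowIdx = lo)
    (hc : γ.colIdx = clo) (hp : lo + clo ≤ δ.pos) :
    finrank k (chainKer (betaMap V) (alphaMap V) lo (δ.rowIdx + 1) clo (δ.colIdx + 1)) =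
      finrank k (chainKer (betaMap W) (alphaMap W) lo (δ.rowIdx + 1) clo (δ.colIdx + 1)) := by
  subst hr hc
  rw [← finrank_ker_zigzag V δ hγ, ← finrank_ker_zigzag W δ hγ]
  refine finrank_ker_vecMulLinear_congr ?_
  rw [← pos_eq] at hp
  exact Nat.cast_injective (R := ℤ)
    (h _ (Or.inl (Or.inl ⟨γ, δ, le_of_pos_le hγ hδ hp, h0, rfl⟩)))

theorem finrank_primeKer_eq {V W : Rep k (StarVertex n) d}
    (h : ∀ f ∈ rankFunctions k n d, f V = f W) {δ : StarArrow n} (hδ : alphaPrime ≤ δ) :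
    finrank k (primeKer (betaMap V) (alphaMap V) (primeMap V) (δ.rowIdx + 1) (δ.colIdx + 1)) =
      finrank k (primeKer (betaMap W) (alphaMap W) (primeMap W) (δ.rowIdx + 1)
        (δ.colIdx + 1)) := by
  rw [← finrank_ker_zigzag_prime V δ, ← finrank_ker_zigzag_prime W δ]
  refine finrank_ker_vecMulLinear_congr ?_
  exact Nat.cast_injective (R := ℤ) (h _ (Or.inl (Or.inl ⟨alphaPrime, δ, hδ, by simp, rfl⟩)))

/-- The arrow α_i has position 2i − 1, so `hp` says that it does not exceed δ. -/
theorem finrank_doubleKer_alpha_eq {V W : Rep k (StarVertex n) d}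
    (h : ∀ f ∈ rankFunctions k n d, f V = f W) {δ : StarArrow n} (hδ : δ ≠ alphaPrime) {i : ℕ}
    (hi : 1 ≤ i) (hi' : i ≤ n) (hp : 2 * i ≤ δ.pos + 1) (hc : i ≤ δ.colIdx + 1) :
    finrank k (doubleKer (betaMap V) (alphaMap V) (primeMap V) (δ.rowIdx + 1) i
        (δ.rowIdx + 1) (δ.colIdx + 1)) =
      finrank k (doubleKer (betaMap W) (alphaMap W) (primeMap W) (δ.rowIdx + 1) i
        (δ.rowIdx + 1) (δ.colIdx + 1)) := by
  rw [← finrank_ker_doubleAlpha V hi δ hc, ← finrank_ker_doubleAlpha W hi δ hc]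
  refine finrank_ker_vecMulLinear_congr ?_
  obtain ⟨j, rfl⟩ : ∃ j, i = j + 1 := ⟨i - 1, by omega⟩
  have := h _ (Or.inl (Or.inr ⟨alpha ⟨j, by omega⟩, δ, ?_, ?_, rfl⟩))
  · exact Nat.cast_injective (R := ℤ) this
  · exact le_of_pos_le (by simp) (by simp) (by simp [pos])
  · exact le_of_pos_le (by simp) hδ (by simp only [pos] at *; omega)

theorem finrank_doubleKer_beta_eq {V W : Rep k (StarVertex n) d}
    (h : ∀ f ∈ rankFunctions k n d, f V = f W) {δ : StarArrow n} (hδ : δ ≠ alphaPrime) {i : ℕ}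
    (hi : 1 ≤ i) (hi' : i ≤ n) (hp : 2 * i ≤ δ.pos) (hc : i ≤ δ.colIdx)
    (hr : i ≤ δ.rowIdx + 1) :
    finrank k (doubleKer (betaMap V) (alphaMap V) (primeMap V) (δ.rowIdx + 1) (δ.colIdx + 1)
        i (i + 1)) =
      finrank k (doubleKer (betaMap W) (alphaMap W) (primeMap W) (δ.rowIdx + 1) (δ.colIdx + 1)
        i (i + 1)) := by
  rw [← finrank_ker_doubleBeta V hi δ hc hr, ← finrank_ker_doubleBeta W hi δ hc hr]
  refine finrank_ker_vecMulLinear_congr ?_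
  have := h _ (Or.inl (Or.inr ⟨beta ⟨i, by omega⟩, δ, ?_, ?_, rfl⟩))
  · exact Nat.cast_injective (R := ℤ) this
  · exact le_of_pos_le (by simp) (by simp) (by simp only [pos, Fin.val_zero]; omega)
  · exact le_of_pos_le (by simp) hδ (by simp only [pos] at *; omega)

theorem finrank_chainKer_beta_corner_eq {V W : Rep k (StarVertex n) d}
    (h : ∀ f ∈ rankFunctions k n d, f V = f W) :
    ∀ (s : Bool) (lo hi : ℕ), lo < hi → hi ≤ n + 1 →
    finrank k (chainKer (betaMap V) (alphaMap V) lo hi lo (hi + (!s).toNat)) =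
      finrank k (chainKer (betaMap W) (alphaMap W) lo hi lo (hi + (!s).toNat)) := by
  have hX : Subsingleton (XSpace k d (n + 1)) := subsingleton_xSpace (Nat.lt_succ_self n)
  intro s lo hi hlo hhi
  obtain ⟨δ, hδ, rfl, hc⟩ := exists_corner (n := n) s (by omega) hhi
  have hp := δ.pos_eq
  have key := finrank_chainKer_eq h (γ := beta ⟨lo, by omega⟩) (lo := lo) (clo := lo)
    (by simp) hδ (by simp) rfl rfl (by omega)
  rcases hc with hc | ⟨h2, h3⟩
  · rwa [hc] at key
  · rw [h3, chainKer_of_subsingleton hX, chainKer_of_subsingleton hX]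
    rwa [h2] at key

theorem finrank_chainKer_alpha_corner_eq {V W : Rep k (StarVertex n) d}
    (h : ∀ f ∈ rankFunctions k n d, f V = f W) :
    ∀ (s : Bool) (lo hi : ℕ), 1 ≤ lo → lo < hi → hi ≤ n + 1 →
    finrank k (chainKer (betaMap V) (alphaMap V) lo hi (lo + 1) (hi + (!s).toNat)) =
      finrank k (chainKer (betaMap W) (alphaMap W) lo hi (lo + 1) (hi + (!s).toNat)) := by
  have hX : Subsingleton (XSpace k d (n + 1)) := subsingleton_xSpace (Nat.lt_succ_self n)
  intro s lo hi hlo hlohi hhi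
  -- In these cases no constrained column carries a nonzero space, and the kernel does not depend on
  -- the representation. Otherwise α_{lo+1} exists and is at most the corner.
  by_cases ht : lo = n ∨ (hi = lo + 1 ∧ s = true)
  · rw [chainKer_congr_of_subsingleton]
    intro c hc hc'
    rcases ht with rfl | ⟨rfl, rfl⟩
    · exact subsingleton_xSpace (by omega)
    · simp at hc'
      omega
  · obtain ⟨δ, hδ, rfl, hc⟩ := exists_corner (n := n) s (by omega) hhi
    have hp := δ.pos_eq
    have key := finrank_chainKer_eq h (γ := alpha ⟨lo, by omega⟩) (lo := lo) (clo := lo + 1)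
      (by simp) hδ (by simp [Fin.ext_iff]; omega) rfl rfl (by cases s <;> simp at * <;> omega)
    rcases hc with hc | ⟨h2, h3⟩
    · rwa [hc] at key
    · rw [h3, chainKer_of_subsingleton hX, chainKer_of_subsingleton hX]
      rwa [h2] at key

theorem finrank_primeKer_corner_eq {V W : Rep k (StarVertex n) d}
    (h : ∀ f ∈ rankFunctions k n d, f V = f W) :
    ∀ (s : Bool) (hi : ℕ), 1 ≤ hi → hi ≤ n + 1 →
    finrank k (primeKer (betaMap V) (alphaMap V) (primeMap V) hi (hi + (!s).toNat)) =
      finrank k (primeKer (betaMap W) (alphaMap W) (primeMap W) hi (hi + (!s).toNat)) := by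
  have hX : Subsingleton (XSpace k d (n + 1)) := subsingleton_xSpace (Nat.lt_succ_self n)
  intro s hi hhi hhi'
  -- With y_0' as the only row, s = false gives the matrix with the single block α_1', and s = true
  -- leaves no columns.
  by_cases hs : hi = 1
  · subst hs
    cases s with
    | false => exact finrank_primeKer_eq h (δ := alphaPrime) le_rfl
    | true =>
      rw [show primeKer (betaMap V) (alphaMap V) (primeMap V) 1 (1 + (!true).toNat) =
          primeKer (betaMap W) (alphaMap W) (primeMap W) 1 (1 + (!true).toNat) from
        Submodule.ext fun p => and_congr_right fun _ => forall₃_congr fun c h1 h2 =>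
          absurd h2 (not_lt.2 h1)]
  · obtain ⟨δ, hδ, rfl, hc⟩ := exists_corner (n := n) s hhi hhi'
    have hp := δ.pos_eq
    have key := finrank_primeKer_eq h (δ := δ) (alphaPrime_le (by omega))
    rcases hc with hc | ⟨h2, h3⟩
    · rwa [hc] at key
    · rw [h3, primeKer_of_subsingleton hX, primeKer_of_subsingleton hX]
      rwa [h2] at key

theorem finrank_doubleKer_alpha_corner_eq {V W : Rep k (StarVertex n) d}
    (h : ∀ f ∈ rankFunctions k n d, f V = f W) :
    ∀ (s : Bool) (i hi : ℕ), 1 ≤ i → i ≤ n → i + s.toNat ≤ hi → hi ≤ n + 1 →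
    finrank k (doubleKer (betaMap V) (alphaMap V) (primeMap V) hi i hi (hi + (!s).toNat)) =
      finrank k (doubleKer (betaMap W) (alphaMap W) (primeMap W) hi i hi (hi + (!s).toNat)) := by
  have hX : Subsingleton (XSpace k d (n + 1)) := subsingleton_xSpace (Nat.lt_succ_self n)
  intro s i hi h1 h2 h3 h4
  obtain ⟨δ, hδ, rfl, hc⟩ := exists_corner (n := n) s (by omega) h4
  have hp := δ.pos_eq
  have key := finrank_doubleKer_alpha_eq h hδ h1 h2 (by cases s <;> simp at * <;> omega)
    (by omega)
  rcases hc with hc | ⟨e2, e3⟩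
  · rwa [hc] at key
  · rw [e3, doubleKer_of_subsingleton_right hX, doubleKer_of_subsingleton_right hX]
    rwa [e2] at key

theorem finrank_doubleKer_beta_corner_eq {V W : Rep k (StarVertex n) d}
    (h : ∀ f ∈ rankFunctions k n d, f V = f W) :
    ∀ (s : Bool) (i hi : ℕ), 1 ≤ i → i < hi → hi ≤ n + 1 →
    finrank k (doubleKer (betaMap V) (alphaMap V) (primeMap V) hi (hi + (!s).toNat) i (i + 1)) =
      finrank k
        (doubleKer (betaMap W) (alphaMap W) (primeMap W) hi (hi + (!s).toNat) i (i + 1)) := by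
  have hX : Subsingleton (XSpace k d (n + 1)) := subsingleton_xSpace (Nat.lt_succ_self n)
  intro s i hi h1 h2 h3
  obtain ⟨δ, hδ, rfl, hc⟩ := exists_corner (n := n) s (by omega) h3
  have hp := δ.pos_eq
  have key := finrank_doubleKer_beta_eq h hδ h1 (by omega) (by omega) (by omega) (by omega)
  rcases hc with hc | ⟨e2, e3⟩
  · rwa [hc] at key
  · rw [e3, doubleKer_of_subsingleton_left hX, doubleKer_of_subsingleton_left hX]
    rwa [e2] at key

theorem exists_equiv_of_rankFunctions {V W : Rep k (StarVertex n) d}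
    (h : ∀ f ∈ rankFunctions k n d, f V = f W) :
    ∃ (φP : (betaMap V 0).ker ≃ₗ[k] (betaMap W 0).ker)
      (φQ : (Fin (d yPrime) → k) ≃ₗ[k] (Fin (d yPrime) → k))
      (φX : ∀ l, XSpace k d l ≃ₗ[k] XSpace k d l) (φY : ∀ l, YSpace k d l ≃ₗ[k] YSpace k d l),
      (∀ p : (betaMap V 0).ker, φX 1 (alphaMap V 0 p) = alphaMap W 0 (φP p)) ∧
      (∀ q, φX 1 (primeMap V q) = primeMap W (φQ q)) ∧
      ∀ l, 1 ≤ l → l ≤ n → ∀ y, φX l (betaMap V l y) = betaMap W l (φY l y) ∧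
        φX (l + 1) (alphaMap V l y) = alphaMap W l (φY l y) := by
  have hX : Subsingleton (XSpace k d (n + 1)) := subsingleton_xSpace (Nat.lt_succ_self n)
  have hn : 1 ≤ n := Nat.one_le_iff_ne_zero.2 (NeZero.ne n)
  exact exists_equiv_of_finrank_kernels hn hX (finrank_chainKer_beta_corner_eq h)
    (finrank_chainKer_alpha_corner_eq h) (finrank_primeKer_corner_eq h)
    (finrank_doubleKer_alpha_corner_eq h)
    (finrank_doubleKer_beta_corner_eq h)

end RankFunctions

end TypeD

end

noncomputable section

namespace TypeD

open Module Matrix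

/-! ### Recovering the end X_0 ← Y_0. -/

section EndVertices

variable {k : Type*} [Field k]

theorem sameOrbit_of_equiv {Q : Type*} [Quiver Q] {d : Q → ℕ} {V W : Rep k Q d}
    (Φ : ∀ z, (Fin (d z) → k) ≃ₗ[k] (Fin (d z) → k))
    (h : ∀ ⦃p q : Q⦄ (a : p ⟶ q) (v), Φ q (v ᵥ* V a) = Φ p v ᵥ* W a) : SameOrbit V W := by
  let g : ∀ z, GL (Fin (d z)) k := fun z =>
    -- `LinearMap.toMatrix'` describes the action on column vectors, hence the transpose.
    Matrix.GeneralLinearGroup.mkOfDetNeZero (LinearMap.toMatrix' (Φ z).toLinearMap)ᵀ (by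
      rw [Matrix.det_transpose, LinearMap.det_toMatrix']
      exact (LinearEquiv.isUnit_det' (Φ z)).ne_zero)
  have hg : ∀ z v, v ᵥ* (g z).val = Φ z v := fun z v => by
    change v ᵥ* (LinearMap.toMatrix' (Φ z).toLinearMap)ᵀ = _
    rw [Matrix.vecMul_transpose, LinearMap.toMatrix'_mulVec]
    rfl
  refine ⟨g, fun p q a => ?_⟩
  have key : V a * (g q).val = (g p).val * W a := by
    refine Matrix.ext_of_single_vecMul fun i => ?_
    rw [← Matrix.vecMul_vecMul, ← Matrix.vecMul_vecMul, hg, hg, h]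
  rw [Matrix.mul_assoc, key, ← Matrix.mul_assoc, ← Units.val_mul, inv_mul_cancel, Units.val_one,
    Matrix.one_mul]

open StarVertex StarArrow

variable {n : ℕ} {d : StarVertex n → ℕ}

/-- The space at `x_r`, seen as the space at the index `l = r`. -/
def xEquiv (k : Type*) [Field k] (d : StarVertex n → ℕ) {r : Fin (n + 1)} {l : ℕ}
    (h : (r : ℕ) = l) : XSpace k d l ≃ₗ[k] (Fin (d (x r)) → k) :=
  LinearEquiv.ofBijective (LinearMap.proj (⟨r, h⟩ : {r : Fin (n + 1) // (r : ℕ) = l}) :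
    XSpace k d l →ₗ[k] Fin (d (x r)) → k) (by
    subst h
    constructor
    · intro u w e
      funext ⟨r', hr⟩
      obtain rfl : r' = r := Fin.ext hr
      exact e
    · intro v
      exact ⟨fun r' => cast (by rw [Fin.ext r'.2]) v, rfl⟩)

/-- The space at `y_r`, seen as the space at the index `l = r`. -/
def yEquiv (k : Type*) [Field k] (d : StarVertex n → ℕ) {r : Fin (n + 1)} {l : ℕ}
    (h : (r : ℕ) = l) : YSpace k d l ≃ₗ[k] (Fin (d (y r)) → k) :=
  LinearEquiv.ofBijective (LinearMap.proj (⟨r, h⟩ : {r : Fin (n + 1) // (r : ℕ) = l}) :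
    YSpace k d l →ₗ[k] Fin (d (y r)) → k) (by
    subst h
    constructor
    · intro u w e
      funext ⟨r', hr⟩
      obtain rfl : r' = r := Fin.ext hr
      exact e
    · intro v
      exact ⟨fun r' => cast (by rw [Fin.ext r'.2]) v, rfl⟩)

theorem blockMap_eq (V : Rep k (StarVertex n) d) {i c : ℕ} {r s : Fin (n + 1)} (h : (r : ℕ) = i)
    (h' : (s : ℕ) = c) (u : YSpace k d i) :
    xEquiv k d h' (blockMap V i c u) = yEquiv k d h u ᵥ* starBlock V (y r) (x s) := by
  refine (blockMap_apply V i c u ⟨s, h'⟩).trans ?_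
  refine Fintype.sum_eq_single (⟨r, h⟩ : {r : Fin (n + 1) // (r : ℕ) = i}) fun r' hr' => ?_
  exact absurd (Subtype.ext (Fin.ext (r'.2.trans h.symm))) hr'

theorem bijective_alphaMap {V : Rep k (StarVertex n) d} {i : Fin n} {l : ℕ} (h : (i : ℕ) = l)
    (hV : Function.Bijective fun v => v ᵥ*
      V (p := y i.castSucc) (q := x i.succ) ⟨alpha i, rfl, rfl⟩) :
    Function.Bijective (alphaMap V l) := by
  have h1 : ((i.castSucc : Fin (n + 1)) : ℕ) = l := h
  have h2 : ((i.succ : Fin (n + 1)) : ℕ) = l + 1 := congrArg (· + 1) h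
  have e : xEquiv k d h2 ∘ alphaMap V l = (fun v => v ᵥ*
      V (p := y i.castSucc) (q := x i.succ) ⟨alpha i, rfl, rfl⟩) ∘ yEquiv k d h1 := by
    funext u
    exact (blockMap_eq V h1 h2 u).trans (congrArg (_ ᵥ* ·) (starBlock_alpha V i))
  rw [← (xEquiv k d h2).bijective.of_comp_iff', e]
  exact hV.comp (yEquiv k d h1).bijective

variable [NeZero n]

/-- If X_0 = 0, the isomorphism of ker β_0 is already one of Y_0. If α_1 is bijective, Y_0 takes
over the isomorphism of X_1; by injectivity of α_1 it restricts to the given one on ker β_0, so the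
kernels of β_0 correspond and it extends to X_0. -/
theorem exists_equiv_star {V W : Rep k (StarVertex n) d}
    (h : ∀ f ∈ rankFunctions k n d, f V = f W)
    (h0 : d (x 0) = 0 ∨ Function.Bijective (alphaMap V 0) ∧ Function.Bijective (alphaMap W 0)) :
    ∃ (φQ : (Fin (d yPrime) → k) ≃ₗ[k] (Fin (d yPrime) → k))
      (φX : ∀ l, XSpace k d l ≃ₗ[k] XSpace k d l) (φY : ∀ l, YSpace k d l ≃ₗ[k] YSpace k d l),
      (∀ q, φX 1 (primeMap V q) = primeMap W (φQ q)) ∧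
      ∀ l, l ≤ n → ∀ y, φX l (betaMap V l y) = betaMap W l (φY l y) ∧
        φX (l + 1) (alphaMap V l y) = alphaMap W l (φY l y) := by
  obtain ⟨φP, φQ, φX, φY, h1, h2, h3⟩ := exists_equiv_of_rankFunctions h
  suffices ∃ (ψX : XSpace k d 0 ≃ₗ[k] XSpace k d 0) (ψY : YSpace k d 0 ≃ₗ[k] YSpace k d 0),
      ∀ y, ψX (betaMap V 0 y) = betaMap W 0 (ψY y) ∧
        φX 1 (alphaMap V 0 y) = alphaMap W 0 (ψY y) by
    obtain ⟨ψX, ψY, h4⟩ := this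
    refine ⟨φQ, fun | 0 => ψX | l + 1 => φX (l + 1), fun | 0 => ψY | l + 1 => φY (l + 1), h2,
      fun l hl => ?_⟩
    cases l with
    | zero => exact h4
    | succ l => exact h3 (l + 1) (by omega) hl
  rcases h0 with h0 | ⟨hV, hW⟩
  · have : Subsingleton (XSpace k d 0) := by
      have : IsEmpty (Fin (d (x (0 : Fin (n + 1))))) := by
        rw [h0]
        infer_instance
      exact (xEquiv k d (r := 0) rfl).toEquiv.subsingleton
    have hker : ∀ b : YSpace k d 0 →ₗ[k] XSpace k d 0, b.ker = ⊤ := fun b =>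
      LinearMap.ker_eq_top.2 (LinearMap.ext fun _ => Subsingleton.elim _ _)
    refine ⟨LinearEquiv.refl k _, (LinearEquiv.ofTop _ (hker _)).symm ≪≫ₗ φP ≪≫ₗ
      LinearEquiv.ofTop _ (hker _), fun y => ⟨Subsingleton.elim _ _, ?_⟩⟩
    exact h1 ⟨y, by rw [hker]; trivial⟩
  · let eV := LinearEquiv.ofBijective _ hV
    let eW := LinearEquiv.ofBijective _ hW
    let ψY : YSpace k d 0 ≃ₗ[k] YSpace k d 0 := eV ≪≫ₗ φX 1 ≪≫ₗ eW.symm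
    have hψ : ∀ y, φX 1 (alphaMap V 0 y) = alphaMap W 0 (ψY y) := fun y =>
      (eW.apply_symm_apply _).symm
    have hP : ∀ p : (betaMap V 0).ker, ψY p = φP p := fun p =>
      hW.1 ((hψ p).symm.trans (h1 p))
    obtain ⟨ψX, h5, -⟩ := exists_filtered_colift (C := {⊥}) (betaMap V 0) (betaMap W 0) ψY rfl
      (Set.finite_singleton _) (Set.subsingleton_singleton.isChain) (Set.mem_singleton _) (by
        rintro _ rfl y
        rw [Prod.fst_bot, Prod.snd_bot, Submodule.mem_bot, Submodule.mem_bot]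
        constructor
        · intro hy
          rw [show ψY y = φP ⟨y, hy⟩ from hP ⟨y, hy⟩]
          exact (φP ⟨y, hy⟩).2
        · intro hy
          have e := hP (φP.symm ⟨ψY y, hy⟩)
          rw [LinearEquiv.apply_symm_apply] at e
          rw [← ψY.injective e]
          exact (φP.symm ⟨ψY y, hy⟩).2) (by
        rintro _ rfl
        simp)
    exact ⟨ψX, ψY, fun y => ⟨h5 y, hψ y⟩⟩

theorem sameOrbit_of_rankFunctions {V W : Rep k (StarVertex n) d}
    (h : ∀ f ∈ rankFunctions k n d, f V = f W)
    (h0 : d (x 0) = 0 ∨ Function.Bijective (alphaMap V 0) ∧ Function.Bijective (alphaMap W 0)) :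
    SameOrbit V W := by
  obtain ⟨φQ, φX, φY, h1, h2⟩ := exists_equiv_star h h0
  let Φ : ∀ z, (Fin (d z) → k) ≃ₗ[k] (Fin (d z) → k)
    | .x r => (xEquiv k d rfl).symm ≪≫ₗ φX r ≪≫ₗ xEquiv k d rfl
    | .y r => (yEquiv k d rfl).symm ≪≫ₗ φY r ≪≫ₗ yEquiv k d rfl
    | .yPrime => φQ
  have hX : ∀ {r : Fin (n + 1)} {l : ℕ} (h : (r : ℕ) = l) (u : XSpace k d l),
      Φ (x r) (xEquiv k d h u) = xEquiv k d h (φX l u) := by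
    rintro r l rfl u
    change xEquiv k d rfl (φX r ((xEquiv k d rfl).symm (xEquiv k d rfl u))) = _
    rw [LinearEquiv.symm_apply_apply]
  have hY : ∀ {r : Fin (n + 1)} {l : ℕ} (h : (r : ℕ) = l) (u : YSpace k d l),
      Φ (y r) (yEquiv k d h u) = yEquiv k d h (φY l u) := by
    rintro r l rfl u
    change yEquiv k d rfl (φY r ((yEquiv k d rfl).symm (yEquiv k d rfl u))) = _
    rw [LinearEquiv.symm_apply_apply]
  refine sameOrbit_of_equiv Φ ?_
  rintro _ _ ⟨a, rfl, rfl⟩ v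
  cases a with
  | beta i =>
    obtain ⟨u, rfl⟩ := (yEquiv k d (r := i) rfl).surjective v
    have e := fun (V : Rep k (StarVertex n) d) u => blockMap_eq V (r := i) (s := i) rfl rfl u
    simp only [starBlock_beta] at e
    refine (congrArg _ (e V u).symm).trans ((hX (r := i) rfl _).trans ?_)
    refine (congrArg _ (h2 i (by omega) u).1).trans ((e W _).trans ?_)
    rw [← hY]
    rfl
  | alpha i =>
    obtain ⟨u, rfl⟩ := (yEquiv k d (r := i.castSucc) (l := i) rfl).surjective v
    have e := fun (V : Rep k (StarVertex n) d) u => blockMap_eq V (i := i) (c := i + 1)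
      (r := i.castSucc) (s := i.succ) rfl rfl u
    simp only [starBlock_alpha] at e
    refine (congrArg _ (e V u).symm).trans ((hX (r := i.succ) (l := i + 1) rfl _).trans ?_)
    refine (congrArg _ (h2 i (by omega) u).2).trans ((e W _).trans ?_)
    rw [← hY]
    rfl
  | alphaPrime =>
    have hr : ((1 : Fin (n + 1)) : ℕ) = 1 :=
      Nat.mod_eq_of_lt (by have := NeZero.ne n; omega : 1 < n + 1)
    have e : ∀ (V : Rep k (StarVertex n) d) q, xEquiv k d hr (primeMap V q) =
        q ᵥ* V (p := yPrime) (q := x 1) ⟨alphaPrime, rfl, rfl⟩ := fun V q =>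
      congrArg (q ᵥ* ·) (starBlock_alphaPrime V)
    refine (congrArg _ (e V v).symm).trans ((hX hr _).trans ?_)
    exact (congrArg _ (h1 v)).trans (e W _)

end EndVertices

end TypeD

end

noncomputable section

namespace TypeD

open Module Matrix

/-! ### Orbits, transposition and invariance of ranks. -/

section Orbits

variable {k : Type*} [Field k] {Q : Type*} [Quiver Q] {d : Q → ℕ}

theorem SameOrbit.exists_equiv {V W : Rep k Q d} (h : SameOrbit V W) :
    ∃ Φ : ∀ z, (Fin (d z) → k) ≃ₗ[k] (Fin (d z) → k),
      ∀ ⦃p q : Q⦄ (a : p ⟶ q) (v), Φ q (v ᵥ* V a) = Φ p v ᵥ* W a := by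
  obtain ⟨g, hg⟩ := h
  refine ⟨fun z => LinearEquiv.ofLinearMap (g z).val.vecMulLinear (g z)⁻¹.val.vecMulLinear
    (LinearMap.ext fun v => ?_) (LinearMap.ext fun v => ?_), fun p q a v => ?_⟩
  · change (v ᵥ* (g z)⁻¹.val) ᵥ* (g z).val = v
    rw [Matrix.vecMul_vecMul, ← Units.val_mul, inv_mul_cancel, Units.val_one, Matrix.vecMul_one]
  · change (v ᵥ* (g z).val) ᵥ* (g z)⁻¹.val = v
    rw [Matrix.vecMul_vecMul, ← Units.val_mul, mul_inv_cancel, Units.val_one, Matrix.vecMul_one]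
  · change (v ᵥ* V a) ᵥ* (g q).val = (v ᵥ* (g p).val) ᵥ* W a
    rw [Matrix.vecMul_vecMul, Matrix.vecMul_vecMul, hg a, ← Matrix.mul_assoc, ← Matrix.mul_assoc,
      ← Units.val_mul, mul_inv_cancel, Units.val_one, Matrix.one_mul]

theorem SameOrbit.transposeRep {V W : Rep k Q d} (h : SameOrbit V W) :
    SameOrbit (transposeRep V) (transposeRep W) := by
  obtain ⟨g, hg⟩ := h
  refine ⟨fun z => ⟨((g z.unop)⁻¹).valᵀ, (g z.unop).valᵀ, ?_, ?_⟩, fun p q a => ?_⟩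
  · rw [← Matrix.transpose_mul, ← Units.val_mul, mul_inv_cancel, Units.val_one,
      Matrix.transpose_one]
  · rw [← Matrix.transpose_mul, ← Units.val_mul, inv_mul_cancel, Units.val_one,
      Matrix.transpose_one]
  · rw [TypeD.transposeRep, TypeD.transposeRep, hg a.unop, Matrix.transpose_mul,
      Matrix.transpose_mul, ← Matrix.mul_assoc]
    rfl

theorem sameOrbit_transposeRep_iff {V W : Rep k Q d} :
    SameOrbit (transposeRep V) (transposeRep W) ↔ SameOrbit V W := by
  refine ⟨fun h => ?_, SameOrbit.transposeRep⟩
  obtain ⟨g, hg⟩ := h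
  refine ⟨fun z => ⟨((g (.op z))⁻¹).valᵀ, (g (.op z)).valᵀ, ?_, ?_⟩, fun p q a => ?_⟩
  · rw [← Matrix.transpose_mul, ← Units.val_mul, mul_inv_cancel, Units.val_one,
      Matrix.transpose_one]
  · rw [← Matrix.transpose_mul, ← Units.val_mul, inv_mul_cancel, Units.val_one,
      Matrix.transpose_one]
  · have := congrArg Matrix.transpose (hg a.op)
    rw [Matrix.transpose_mul, Matrix.transpose_mul, ← Matrix.mul_assoc] at this
    exact this

theorem evalPath_eq {V W : Rep k Q d} {g : ∀ z : Q, GL (Fin (d z)) k}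
    (hg : ∀ ⦃p q : Q⦄ (a : p ⟶ q), W a = ((g p)⁻¹).val * V a * (g q).val) {p q : Q}
    (l : Quiver.Path p q) : (g p).val * evalPath W l = evalPath V l * (g q).val := by
  induction l with
  | nil => simp [evalPath]
  | cons l a ih =>
    rw [evalPath, evalPath, ← Matrix.mul_assoc, ih, hg a]
    simp only [Matrix.mul_assoc]
    rw [← Matrix.mul_assoc (g _).val, ← Units.val_mul, mul_inv_cancel, Units.val_one,
      Matrix.one_mul]

theorem isUnit_det_blockDiagonal' {ι : Type*} [Fintype ι] [DecidableEq ι] {m : ι → ℕ}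
    (g : ∀ i, GL (Fin (m i)) k) : IsUnit (Matrix.blockDiagonal' fun i => (g i).val).det := by
  refine Matrix.isUnit_det_of_right_inverse (B := Matrix.blockDiagonal' fun i => (g i)⁻¹.val) ?_
  rw [← Matrix.blockDiagonal'_mul, ← Matrix.blockDiagonal'_one]
  congr 1
  funext i
  rw [← Units.val_mul, mul_inv_cancel, Units.val_one]
  rfl

/-- Base change affects the matrix of a path only at its two ends, so the evaluations at V and W
differ by invertible block diagonal factors. -/
theorem SameOrbit.rankFun_eq {V W : Rep k Q d} (h : SameOrbit V W) (Φ : QMatrix k Q) :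
    Φ.rankFun d V = Φ.rankFun d W := by
  classical
  obtain ⟨g, hg⟩ := h
  let D : Matrix (Σ i : Φ.ι, Fin (d (Φ.row i))) (Σ i : Φ.ι, Fin (d (Φ.row i))) k :=
    Matrix.blockDiagonal' fun i => (g (Φ.row i)).val
  let E : Matrix (Σ j : Φ.κ, Fin (d (Φ.col j))) (Σ j : Φ.κ, Fin (d (Φ.col j))) k :=
    Matrix.blockDiagonal' fun j => (g (Φ.col j)).val
  have hD : IsUnit D.det := isUnit_det_blockDiagonal' _
  have hE : IsUnit E.det := isUnit_det_blockDiagonal' _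
  have key : D * Φ.eval W = Φ.eval V * E := by
    ext ⟨i, r⟩ ⟨j, c⟩
    rw [Matrix.mul_apply, Matrix.mul_apply, Fintype.sum_sigma, Fintype.sum_sigma,
      Fintype.sum_eq_single i, Fintype.sum_eq_single j]
    · simp only [D, E, Matrix.blockDiagonal'_apply_eq]
      have : (g (Φ.row i)).val * ((Φ.entry i j).sum fun l t => t • evalPath W l) =
          ((Φ.entry i j).sum fun l t => t • evalPath V l) * (g (Φ.col j)).val := by
        simp only [Finsupp.sum, Matrix.mul_sum, Matrix.sum_mul, Matrix.mul_smul, Matrix.smul_mul,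
          evalPath_eq hg]
      exact congrFun (congrFun this r) c
    · intro j' hj'
      refine Finset.sum_eq_zero fun s _ => ?_
      exact mul_eq_zero_of_right _ (Matrix.blockDiagonal'_apply_ne _ _ _ hj')
    · intro i' hi'
      refine Finset.sum_eq_zero fun s _ => ?_
      exact mul_eq_zero_of_left (Matrix.blockDiagonal'_apply_ne _ _ _ hi'.symm) _
  rw [QMatrix.rankFun, QMatrix.rankFun, ← Matrix.rank_mul_eq_left_of_isUnit_det E _ hE, ← key,
    Matrix.rank_mul_eq_right_of_isUnit_det D _ hD]

end Orbits

/-! ### Isomorphisms of V and of V*1. -/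

section Contraction

open StarVertex StarArrow

theorem StarArrow.tail_ne {n : ℕ} (a : StarArrow n) : a.tail ≠ x 0 := by
  cases a <;> simp [tail]

namespace StarContraction

variable {k : Type*} [Field k] {n : ℕ} [NeZero n] {Q : Type*} [Quiver Q]
  (c : StarContraction n Q) (d : Q → ℕ)

theorem starDim_eq {z : StarVertex n} (h : ¬ (beta 0 ∈ c.A ∧ z = x 0)) :
    c.starDim d z = d (c.ν z) := if_neg h

theorem starDim_x_zero (h : beta 0 ∈ c.A) : c.starDim d (x 0) = 0 := if_pos ⟨h, rfl⟩

theorem ν_tail_eq {a : StarArrow n} (h : a ∈ c.A) : c.ν a.tail = c.ν a.head :=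
  congrArg c.vert (Quot.sound ⟨a, h, rfl, rfl⟩)

theorem eq_beta_zero_of_head_eq {a : StarArrow n} (h : a.head = x 0) : a = beta 0 := by
  cases a with
  | alpha i => simp [head] at h
  | beta i => simpa [head] using h
  | alphaPrime =>
    simp only [head, StarVertex.x.injEq] at h
    have := congrArg Fin.val h
    rw [Fin.val_zero, show ((1 : Fin (n + 1)) : ℕ) = 1 from
      Nat.mod_eq_of_lt (by have := NeZero.ne n; omega : 1 < n + 1)] at this
    omega

variable {d}

/-- The vectors at `ν z`, seen at `z`. -/
def restrict (k : Type*) [Field k] (d : Q → ℕ) (z : StarVertex n) :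
    (Fin (d (c.ν z)) → k) →ₗ[k] (Fin (c.starDim d z) → k) :=
  LinearMap.funLeft k k (Fin.castLE (c.starDim_le d z))

theorem restrict_surjective (z : StarVertex n) : Function.Surjective (c.restrict k d z) :=
  LinearMap.funLeft_surjective_of_injective _ _ _ (Fin.castLE_injective _)

theorem restrict_bijective {z : StarVertex n} (h : ¬ (beta 0 ∈ c.A ∧ z = x 0)) :
    Function.Bijective (c.restrict k d z) := by
  refine ⟨LinearMap.funLeft_injective_of_surjective _ _ _ fun j => ?_, c.restrict_surjective z⟩
  exact ⟨⟨j, by rw [c.starDim_eq d h]; exact j.2⟩, rfl⟩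

theorem restrict_vecMul_extend (V : Rep k Q d) {a : StarArrow n} (h : a ∉ c.A)
    (f : Fin (d (c.ν a.tail)) → k) :
    c.restrict k d a.tail f ᵥ* c.extend V (p := a.tail) (q := a.head) ⟨a, rfl, rfl⟩ =
      c.restrict k d a.head (f ᵥ* V (c.arr (p := Quot.mk _ a.tail) (q := Quot.mk _ a.head)
        ⟨a, h, rfl, rfl⟩)) := by
  funext j
  have e := c.starDim_eq d (z := a.tail) fun h' => a.tail_ne h'.2
  refine Fintype.sum_equiv (finCongr e) _ _ fun i => ?_
  simp only [extend, h, dite_false, Matrix.of_apply]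
  rfl

theorem restrict_vecMul_extend_of_mem (V : Rep k Q d) {a : StarArrow n} (h : a ∈ c.A)
    (f : Fin (d (c.ν a.tail)) → k) :
    c.restrict k d a.tail f ᵥ* c.extend V (p := a.tail) (q := a.head) ⟨a, rfl, rfl⟩ =
      c.restrict k d a.head (f ∘ Fin.cast (congrArg d (c.ν_tail_eq h)).symm) := by
  funext j
  have e := c.starDim_eq d (z := a.tail) fun h' => a.tail_ne h'.2
  have hj : (j : ℕ) < c.starDim d a.tail := by
    rw [e, c.ν_tail_eq h]
    exact j.2.trans_le (c.starDim_le d _)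
  refine (Fintype.sum_eq_single (⟨j, hj⟩ : Fin (c.starDim d a.tail)) fun i hi => ?_).trans ?_
  · simp only [extend, h, dite_true, Matrix.of_apply]
    rw [if_neg fun e => hi (Fin.ext e), mul_zero]
  · simp only [extend, h, dite_true, Matrix.of_apply, if_true, mul_one]
    rfl

theorem sameOrbit_extend {V W : Rep k Q d} (h : SameOrbit V W) :
    SameOrbit (c.extend V) (c.extend W) := by
  obtain ⟨Φ, hΦ⟩ := h.exists_equiv
  have hΨ : ∀ z, ∃ Ψ : (Fin (c.starDim d z) → k) ≃ₗ[k] (Fin (c.starDim d z) → k),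
      ∀ f, Ψ (c.restrict k d z f) = c.restrict k d z (Φ (c.ν z) f) := by
    intro z
    by_cases hz : beta 0 ∈ c.A ∧ z = x 0
    · have : IsEmpty (Fin (c.starDim d z)) := by
        rw [hz.2, c.starDim_x_zero d hz.1]
        infer_instance
      exact ⟨LinearEquiv.refl k _, fun f => Subsingleton.elim _ _⟩
    · let e := LinearEquiv.ofBijective _ (c.restrict_bijective (k := k) (d := d) hz)
      refine ⟨e.symm ≪≫ₗ Φ (c.ν z) ≪≫ₗ e, fun f => ?_⟩
      exact congrArg (fun u => e (Φ (c.ν z) u)) (e.symm_apply_apply f)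
  choose Ψ hΨ using hΨ
  refine sameOrbit_of_equiv Ψ ?_
  rintro _ _ ⟨a, rfl, rfl⟩ v
  obtain ⟨f, rfl⟩ := c.restrict_surjective _ v
  by_cases h : a ∈ c.A
  · rw [c.restrict_vecMul_extend_of_mem V h, hΨ, hΨ, c.restrict_vecMul_extend_of_mem W h]
    congr 1
    have : ∀ {u w : Q} (e : u = w) (f : Fin (d u) → k),
        Φ w (f ∘ Fin.cast (congrArg d e).symm) = Φ u f ∘ Fin.cast (congrArg d e).symm := by
      rintro u _ rfl f
      rfl
    exact this (c.ν_tail_eq h) f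
  · rw [c.restrict_vecMul_extend V h, hΨ, hΨ, c.restrict_vecMul_extend W h]
    exact congrArg _ (hΦ _ f)

/-- An isomorphism commutes with the identity matrices at contracted arrows, so its components at
both ends of such an arrow agree and it descends to the contracted vertices. If β_0 is contracted,
the space at x_0 is zero and carries no information; the component at y_0 takes its place. -/
theorem sameOrbit_of_extend {V W : Rep k Q d} (h : SameOrbit (c.extend V) (c.extend W)) :
    SameOrbit V W := by
  classical
  obtain ⟨Ψ, hΨ⟩ := h.exists_equiv
  have hΓ : ∀ z, ∃ Γ : (Fin (d (c.ν z)) → k) ≃ₗ[k] (Fin (d (c.ν z)) → k),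
      ¬ (beta 0 ∈ c.A ∧ z = x 0) →
        ∀ f, Ψ z (c.restrict k d z f) = c.restrict k d z (Γ f) := by
    intro z
    by_cases hz : beta 0 ∈ c.A ∧ z = x 0
    · exact ⟨LinearEquiv.refl k _, fun h => absurd hz h⟩
    · let e := LinearEquiv.ofBijective _ (c.restrict_bijective (k := k) (d := d) hz)
      exact ⟨e ≪≫ₗ Ψ z ≪≫ₗ e.symm, fun _ f => (e.apply_symm_apply _).symm⟩
  choose Γ hΓ using hΓ
  -- Components at identified vertices live on spaces indexed by equal, but only propositionally
  -- equal, vertices of Q. Pairing each with its vertex allows them to be compared and passed to the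
  -- quotient.
  let Θ : StarVertex n → Σ u : Q, ((Fin (d u) → k) ≃ₗ[k] (Fin (d u) → k)) := fun z =>
    if beta 0 ∈ c.A ∧ z = x 0 then ⟨_, Γ (y 0)⟩ else ⟨_, Γ z⟩
  have hΘ : ∀ p q : StarVertex n, (∃ a ∈ c.A, a.tail = p ∧ a.head = q) → Θ p = Θ q := by
    rintro _ _ ⟨a, ha, rfl, rfl⟩
    have ht : ¬ (beta 0 ∈ c.A ∧ a.tail = x 0) := fun h' => a.tail_ne h'.2
    by_cases hq : beta 0 ∈ c.A ∧ a.head = x 0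
    · obtain rfl := eq_beta_zero_of_head_eq hq.2
      simp only [Θ]
      rw [if_neg ht, if_pos hq]
      rfl
    · simp only [Θ]
      rw [if_neg ht, if_neg hq]
      have key : ∀ f, Γ a.head (f ∘ Fin.cast (congrArg d (c.ν_tail_eq ha)).symm) =
          Γ a.tail f ∘ Fin.cast (congrArg d (c.ν_tail_eq ha)).symm := by
        intro f
        apply (c.restrict_bijective (k := k) (d := d) hq).1
        rw [← hΓ _ hq, ← c.restrict_vecMul_extend_of_mem V ha, hΨ, hΓ _ ht,
          c.restrict_vecMul_extend_of_mem W ha]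
      have ext : ∀ {u w : Q} (e : u = w) (S : (Fin (d u) → k) ≃ₗ[k] (Fin (d u) → k))
          (T : (Fin (d w) → k) ≃ₗ[k] (Fin (d w) → k)),
          (∀ f, T (f ∘ Fin.cast (congrArg d e).symm) = S f ∘ Fin.cast (congrArg d e).symm) →
          (⟨u, S⟩ : Σ u : Q, ((Fin (d u) → k) ≃ₗ[k] (Fin (d u) → k))) = ⟨w, T⟩ := by
        rintro u _ rfl S T h
        congr 1
        ext1 f
        exact (h f).symm
      exact ext (c.ν_tail_eq ha) _ _ key
  have hΦ : ∀ u, ∃ Φ : (Fin (d u) → k) ≃ₗ[k] (Fin (d u) → k), ∀ z, c.ν z = u → Θ z = ⟨u, Φ⟩ := by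
    intro u
    obtain ⟨z₀, hz₀⟩ : ∃ z, c.ν z = u := by
      obtain ⟨p, rfl⟩ := c.vert.surjective u
      obtain ⟨z, rfl⟩ := Quot.exists_rep p
      exact ⟨z, rfl⟩
    have h1 : ∀ z, c.ν z = u → Θ z = Θ z₀ := fun z hz =>
      congrArg (Quot.lift Θ hΘ) (c.vert.injective (hz.trans hz₀.symm))
    obtain ⟨z, hz, hz'⟩ : ∃ z, c.ν z = u ∧ Θ z = ⟨_, Γ z⟩ := by
      by_cases hz : beta 0 ∈ c.A ∧ z₀ = x 0
      · obtain ⟨hA, rfl⟩ := hz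
        refine ⟨y 0, (c.ν_tail_eq hA).trans hz₀, if_neg fun h' => ?_⟩
        simp at h'
      · exact ⟨z₀, hz₀, if_neg hz⟩
    subst hz
    exact ⟨Γ z, fun z' hz' => (h1 z' hz').trans ((h1 z rfl).symm.trans ‹_›)⟩
  choose Φ hΦ using hΦ
  have hΦΓ : ∀ z, ¬ (beta 0 ∈ c.A ∧ z = x 0) → Φ (c.ν z) = Γ z := by
    intro z hz
    have h1 := hΦ _ z rfl
    simp only [Θ] at h1
    rw [if_neg hz] at h1
    exact (eq_of_heq (Sigma.mk.inj h1).2).symm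
  refine sameOrbit_of_equiv Φ ?_
  intro u w a f
  obtain ⟨p, rfl⟩ := c.vert.surjective u
  obtain ⟨q, rfl⟩ := c.vert.surjective w
  obtain ⟨⟨a, ha, rfl, rfl⟩, rfl⟩ := c.arr.surjective a
  have ht : ¬ (beta 0 ∈ c.A ∧ a.tail = x 0) := fun h' => a.tail_ne h'.2
  have hq : ¬ (beta 0 ∈ c.A ∧ a.head = x 0) := fun h' =>
    ha (eq_beta_zero_of_head_eq h'.2 ▸ h'.1)
  have e1 := hΦΓ _ ht
  have e2 := hΦΓ _ hq
  apply (c.restrict_bijective (k := k) (d := d) hq).1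
  have key : c.restrict k d a.head (Γ a.head (f ᵥ* V (c.arr ⟨a, ha, rfl, rfl⟩))) =
      c.restrict k d a.head (Γ a.tail f ᵥ* W (c.arr ⟨a, ha, rfl, rfl⟩)) :=
    (hΓ _ hq _).symm.trans ((congrArg _ (c.restrict_vecMul_extend V ha f).symm).trans
      ((hΨ _ _).trans ((congrArg (· ᵥ* _) (hΓ _ ht f)).trans
        (c.restrict_vecMul_extend W ha _))))
  rw [← e1, ← e2] at key
  exact key

theorem bijective_alphaMap_extend (h : alpha 0 ∈ c.A) (h0 : beta 0 ∉ c.A) (V : Rep k Q d) :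
    Function.Bijective (alphaMap (c.extend V) 0) := by
  refine bijective_alphaMap (i := 0) (Nat.zero_mod n) ?_
  have ht : ¬ (beta 0 ∈ c.A ∧ (alpha 0 : StarArrow n).tail = x 0) := fun h' => h0 h'.1
  have hq : ¬ (beta 0 ∈ c.A ∧ (alpha 0 : StarArrow n).head = x 0) := fun h' => h0 h'.1
  have e := (c.restrict_bijective (k := k) (d := d) ht)
  have e' := (c.restrict_bijective (k := k) (d := d) hq)
  refine (Function.Bijective.of_comp_iff _ e).1 ?_
  have e3 := funext fun f => c.restrict_vecMul_extend_of_mem V h f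
  refine (Eq.mpr (congrArg Function.Bijective e3) (e'.comp ?_))
  exact (LinearEquiv.funCongrLeft k k
    (finCongr (congrArg d (c.ν_tail_eq h)).symm)).bijective

theorem sameOrbit_iff (V W : Rep k Q d) : SameOrbit V W ↔
    ∀ f ∈ rankFunctions k n (c.starDim d), f (c.extend V) = f (c.extend W) := by
  constructor
  · intro h f hf
    have h' := c.sameOrbit_extend h
    rcases hf with (⟨γ, δ, -, -, rfl⟩ | ⟨γ, δ, -, -, rfl⟩) | ⟨δ, -, rfl⟩ <;>
      exact h'.rankFun_eq _
  · intro h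
    refine c.sameOrbit_of_extend (sameOrbit_of_rankFunctions h ?_)
    by_cases h0 : beta 0 ∈ c.A
    · exact Or.inl (c.starDim_x_zero d h0)
    · have h1 : alpha 0 ∈ c.A := c.shape.elim (fun h => h.1) (fun h => absurd h.1 h0)
      exact Or.inr ⟨c.bijective_alphaMap_extend h1 h0 V, c.bijective_alphaMap_extend h1 h0 W⟩

end StarContraction

end Contraction

end TypeD

end

noncomputable section

namespace TypeD

/-! ### Existence of presentations. -/

section Presentations

open StarVertex StarArrow

variable {Q : Type*} [Quiver Q]

theorem nonempty_equiv_of_subsingleton {α β : Type*} [Subsingleton α] [Subsingleton β]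
    (h : Nonempty α ↔ Nonempty β) : Nonempty (α ≃ β) := by
  classical
  by_cases hα : Nonempty α
  · obtain ⟨a⟩ := hα
    obtain ⟨b⟩ := h.1 ⟨a⟩
    exact ⟨⟨fun _ => b, fun _ => a, fun _ => Subsingleton.elim _ _, fun _ => Subsingleton.elim _ _⟩⟩
  · have := not_nonempty_iff.1 hα
    have := not_nonempty_iff.1 (mt h.2 hα)
    exact ⟨Equiv.equivOfIsEmpty α β⟩

/-- A tree with the path `v_0, …, v_n` and a further vertex with an arrow to `v_1` is a contraction
of `Q^*(n)`. -/
theorem nonempty_starContraction {n : ℕ} [NeZero n] (v : ℕ → Q) (v' : Q)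
    (hv : ∀ i j, i ≤ n → j ≤ n → v i = v j → i = j) (hv' : ∀ i, i ≤ n → v i ≠ v')
    (hsurj : ∀ u, u = v' ∨ ∃ i, i ≤ n ∧ v i = u) (hsub : ∀ u w : Q, Subsingleton (u ⟶ w))
    (hedge : ∀ i, i < n → Nonempty (v i ⟶ v (i + 1)) ∨ Nonempty (v (i + 1) ⟶ v i))
    (hedge' : ∀ i, i < n → Nonempty (v i ⟶ v (i + 1)) → IsEmpty (v (i + 1) ⟶ v i))
    (hprime : Nonempty (v' ⟶ v 1))
    (honly : ∀ u w : Q, (u ⟶ w) → (u = v' ∧ w = v 1) ∨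
      ∃ i, i < n ∧ ((u = v i ∧ w = v (i + 1)) ∨ (u = v (i + 1) ∧ w = v i))) :
    Nonempty (StarContraction n Q) := by
  classical
  have hn : 1 ≤ n := Nat.one_le_iff_ne_zero.2 (NeZero.ne n)
  have h1 : ((1 : Fin (n + 1)) : ℕ) = 1 := Nat.mod_eq_of_lt (by omega : 1 < n + 1)
  -- Between x_i and x_{i+1} stands y_i. Contracting β_i leaves α_{i+1} as an arrow v_i → v_{i+1},
  -- contracting α_{i+1} leaves β_i as an arrow v_{i+1} → v_i. The last vertex y_n has only β_n,
  -- which is contracted in any case.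
  let R : ℕ → Prop := fun i => Nonempty (v i ⟶ v (i + 1)) ∨ i = n
  let A : Set (StarArrow n) := fun
    | .alpha i => ¬ R i
    | .beta i => R i
    | .alphaPrime => False
  let g : StarVertex n → Q := fun
    | .x i => v i
    | .y i => if R i then v i else v (i + 1)
    | .yPrime => v'
  have hg : ∀ p q : StarVertex n, (∃ a ∈ A, a.tail = p ∧ a.head = q) → g p = g q := by
    rintro _ _ ⟨a, ha, rfl, rfl⟩
    cases a with
    | alpha i => exact if_neg ha
    | beta i => exact if_pos ha
    | alphaPrime => exact ha.elim
  let V : Contracted A → Q := Quot.lift g hg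
  have hrep : ∀ p : Contracted A, p = Quot.mk _ yPrime ∨
      ∃ i : Fin (n + 1), p = Quot.mk _ (x i) := by
    intro p
    obtain ⟨z, rfl⟩ := Quot.exists_rep p
    cases z with
    | x i => exact Or.inr ⟨i, rfl⟩
    | y i =>
      by_cases hR : R i
      · exact Or.inr ⟨i, Quot.sound ⟨beta i, hR, rfl, rfl⟩⟩
      · have hi : (i : ℕ) < n := by
          have : (i : ℕ) ≠ n := fun e => hR (Or.inr e)
          omega
        exact Or.inr ⟨Fin.succ ⟨i, hi⟩, Quot.sound ⟨alpha ⟨i, hi⟩, hR, rfl, rfl⟩⟩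
    | yPrime => exact Or.inl rfl
  have hV : Function.Bijective V := by
    constructor
    · intro p q e
      rcases hrep p with rfl | ⟨i, rfl⟩ <;> rcases hrep q with rfl | ⟨j, rfl⟩
      · rfl
      · exact absurd e.symm (hv' j (by omega))
      · exact absurd e (hv' i (by omega))
      · rw [Fin.ext (hv i j (by omega) (by omega) e)]
    · intro u
      rcases hsurj u with rfl | ⟨i, hi, rfl⟩
      · exact ⟨Quot.mk _ yPrime, rfl⟩
      · exact ⟨Quot.mk _ (x ⟨i, by omega⟩), rfl⟩
  have hends : ∀ a : StarArrow n, a ∉ A →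
      (∃ i : Fin n, a = alpha i ∧ g a.tail = v i ∧ g a.head = v (i + 1)) ∨
      (∃ i : Fin (n + 1), (i : ℕ) < n ∧ a = beta i ∧ g a.tail = v (i + 1) ∧ g a.head = v i) ∨
      (a = alphaPrime ∧ g a.tail = v' ∧ g a.head = v 1) := by
    intro a ha
    cases a with
    | alpha i => exact Or.inl ⟨i, rfl, if_pos (not_not.1 ha), rfl⟩
    | beta i =>
      have : (i : ℕ) ≠ n := fun e => ha (Or.inr e)
      exact Or.inr (Or.inl ⟨i, by omega, rfl, if_neg ha, rfl⟩)
    | alphaPrime => exact Or.inr (Or.inr ⟨rfl, rfl, congrArg v h1⟩)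
  have hinj : ∀ a b : StarArrow n, a ∉ A → b ∉ A → g a.tail = g b.tail → g a.head = g b.head →
      a = b := by
    intro a b ha hb ht hh
    rcases hends a ha with ⟨i, e, e1, e2⟩ | ⟨i, hi, e, e1, e2⟩ | ⟨e, e1, e2⟩ <;>
      rcases hends b hb with ⟨j, f, f1, f2⟩ | ⟨j, hj, f, f1, f2⟩ | ⟨f, f1, f2⟩ <;>
      rw [e1, f1] at ht <;> rw [e2, f2] at hh <;> rw [e, f]
    · rw [Fin.ext (hv i j (by omega) (by omega) ht)]
    · have := hv _ _ (by omega) (by omega) ht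
      have := hv _ _ (by omega) (by omega) hh
      omega
    · exact absurd ht (hv' _ (by omega))
    · have := hv _ _ (by omega) (by omega) ht
      have := hv _ _ (by omega) (by omega) hh
      omega
    · rw [Fin.ext (hv i j (by omega) (by omega) hh)]
    · exact absurd ht (hv' _ (by omega))
    · exact absurd ht.symm (hv' _ (by omega))
    · exact absurd ht.symm (hv' _ (by omega))
  have hreal : ∀ a : StarArrow n, a ∉ A → Nonempty (g a.tail ⟶ g a.head) := by
    intro a ha
    rcases hends a ha with ⟨i, e, e1, e2⟩ | ⟨i, hi, e, e1, e2⟩ | ⟨e, e1, e2⟩ <;> rw [e1, e2]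
    · subst e
      exact (not_not.1 ha).resolve_right (by omega)
    · subst e
      exact (hedge i hi).resolve_left fun h => ha (Or.inl h)
    · exact hprime
  have hall : ∀ u w : Q, (u ⟶ w) → ∃ a : StarArrow n, a ∉ A ∧ g a.tail = u ∧ g a.head = w := by
    intro u w b
    rcases honly u w b with ⟨rfl, rfl⟩ | ⟨i, hi, ⟨rfl, rfl⟩ | ⟨rfl, rfl⟩⟩
    · exact ⟨alphaPrime, fun h => h, rfl, congrArg v h1⟩
    · have hR : R i := Or.inl ⟨b⟩
      exact ⟨alpha ⟨i, hi⟩, fun h => h hR, if_pos hR, rfl⟩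
    · have hR : ¬ R i := by
        rintro (h | h)
        · exact (hedge' i hi h).false b
        · omega
      exact ⟨beta ⟨i, by omega⟩, hR, if_neg hR, rfl⟩
  have harr : ∀ p q : Contracted A, Nonempty ((p ⟶ q) ≃ (V p ⟶ V q)) := by
    intro p q
    have : Subsingleton (p ⟶ q) := by
      constructor
      rintro ⟨a, ha, ha', ha''⟩ ⟨b, hb, hb', hb''⟩
      exact Subtype.ext (hinj a b ha hb (congrArg V (ha'.trans hb'.symm))
        (congrArg V (ha''.trans hb''.symm)))
    have := hsub (V p) (V q)
    refine nonempty_equiv_of_subsingleton ⟨?_, ?_⟩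
    · rintro ⟨a, ha, rfl, rfl⟩
      exact hreal a ha
    · rintro ⟨b⟩
      obtain ⟨a, ha, ht, hh⟩ := hall _ _ b
      exact ⟨⟨a, ha, hV.1 ht, hV.1 hh⟩⟩
  have h0 : ((0 : Fin n) : ℕ) = 0 := Nat.zero_mod n
  refine ⟨⟨A, Equiv.ofBijective V hV, fun {p q} => (harr p q).some, ?_⟩⟩
  change Xor (¬ R ((0 : Fin n) : ℕ)) (R 0)
  rw [h0]
  by_cases hR : R 0
  · exact Or.inr ⟨hR, fun h => h hR⟩
  · exact Or.inl ⟨hR, hR⟩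

/-- The edges of the Dynkin diagram `D_m` carry exactly one arrow each under the enumeration `e`
of the vertices, and there are no other arrows. -/
structure IsDynkinEnumeration {m : ℕ} (e : Fin m ≃ Q) : Prop where
  subsingleton : ∀ i j, Subsingleton (e i ⟶ e j)
  adj : ∀ i j, (e i ⟶ e j) → (dynkinD m).Adj i j
  nonempty : ∀ i j, (dynkinD m).Adj i j → Nonempty (e i ⟶ e j) ∨ Nonempty (e j ⟶ e i)
  isEmpty : ∀ i j, Nonempty (e i ⟶ e j) → IsEmpty (e j ⟶ e i)

theorem IsTypeD.exists_enumeration (hQ : IsTypeD Q) :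
    ∃ m, 4 ≤ m ∧ ∃ e : Fin m ≃ Q, IsDynkinEnumeration e := by
  obtain ⟨m, hm, e, he⟩ := hQ
  have hadj : ∀ i j, (e i ⟶ e j) → (dynkinD m).Adj i j := fun i j b => by
    by_contra h
    exact ((he i j).2 h).false b
  refine ⟨m, hm, e, ⟨fun i j => ⟨fun a b => ?_⟩, hadj, fun i j h => ?_, fun i j => ?_⟩⟩
  · obtain ⟨hu⟩ := (he i j).1 (hadj i j a)
    exact Sum.inl_injective ((hu.eq_default _).trans (hu.eq_default (Sum.inl b)).symm)
  · obtain ⟨hu⟩ := (he i j).1 h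
    rcases hu.default with a | a
    · exact Or.inl ⟨a⟩
    · exact Or.inr ⟨a⟩
  · rintro ⟨a⟩
    refine ⟨fun b => ?_⟩
    obtain ⟨hu⟩ := (he i j).1 (hadj i j a)
    have := (hu.eq_default (Sum.inl a)).trans (hu.eq_default (Sum.inr b)).symm
    simp at this

theorem IsDynkinEnumeration.op {m : ℕ} {e : Fin m ≃ Q} (h : IsDynkinEnumeration e) :
    IsDynkinEnumeration (e.trans Opposite.equivToOpposite) where
  subsingleton i j := by
    have := h.subsingleton j i
    exact (Quiver.Hom.opEquiv (X := e j) (Y := e i)).symm.subsingleton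
  adj i j a := (h.adj j i a.unop).symm
  nonempty i j hij := (h.nonempty i j hij).symm.imp (fun ⟨a⟩ => ⟨a.op⟩) (fun ⟨a⟩ => ⟨a.op⟩)
  isEmpty := fun i j ⟨a⟩ => ⟨fun b => (h.isEmpty j i ⟨a.unop⟩).false b.unop⟩

/-- The vertices x_0, x_1, x_2, … become 0, 2, 3, … of the diagram, with branch point x_1, and y_0'
becomes 1. -/
theorem IsDynkinEnumeration.nonempty_starContraction {n : ℕ} [NeZero n] (hn : 2 ≤ n)
    {e : Fin (n + 2) ≃ Q} (h : IsDynkinEnumeration e) {t : Fin (n + 2)} (ht1 : (t : ℕ) = 1)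
    (ht : Nonempty (e t ⟶ e ⟨2, by omega⟩)) : Nonempty (StarContraction n Q) := by
  -- The value 0 for n < i is a filler that keeps N inside `Fin (n + 2)`.
  let N : ℕ → Fin (n + 2) := fun i => ⟨if i = 0 ∨ n < i then 0 else i + 1, by
    split_ifs <;> omega⟩
  have hN0 : (N 0 : ℕ) = 0 := by simp [N]
  have hN : ∀ i, 1 ≤ i → i ≤ n → (N i : ℕ) = i + 1 := fun i h1 h2 => if_neg (by omega)
  have hNadj : ∀ i, i < n → (dynkinD (n + 2)).Adj (N i) (N (i + 1)) := by
    intro i hi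
    have e1 := hN (i + 1) (by omega) (by omega)
    rw [dynkinD, SimpleGraph.fromRel_adj, ne_eq, Fin.ext_iff, e1]
    rcases Nat.eq_zero_or_pos i with rfl | h0
    · rw [hN0]
      omega
    · rw [hN i h0 (by omega)]
      omega
  have hcases : ∀ j : Fin (n + 2), j = t ∨ ∃ i, i ≤ n ∧ N i = j := by
    intro j
    by_cases h1 : j = t
    · exact Or.inl h1
    · rw [Fin.ext_iff] at h1
      by_cases h2 : (j : ℕ) = 0
      · exact Or.inr ⟨0, by omega, Fin.ext (hN0.trans h2.symm)⟩
      · refine Or.inr ⟨j - 1, by omega, Fin.ext ?_⟩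
        rw [hN _ (by omega) (by omega)]
        omega
  have hN1 : N 1 = ⟨2, by omega⟩ := Fin.ext (hN 1 le_rfl (by omega))
  refine TypeD.nonempty_starContraction (fun i => e (N i)) (e t) ?_ ?_ ?_ ?_ ?_ ?_ ?_ ?_
  · intro i j hi hj hij
    have := congrArg Fin.val (e.injective hij)
    rcases Nat.eq_zero_or_pos i with rfl | h0 <;> rcases Nat.eq_zero_or_pos j with rfl | h0'
    · rfl
    · rw [hN0, hN j h0' hj] at this
      omega
    · rw [hN0, hN i h0 hi] at this
      omega
    · rw [hN i h0 hi, hN j h0' hj] at this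
      omega
  · intro i hi hit
    have := congrArg Fin.val (e.injective hit)
    rcases Nat.eq_zero_or_pos i with rfl | h0
    · rw [hN0] at this
      omega
    · rw [hN i h0 hi] at this
      omega
  · intro u
    obtain ⟨j, rfl⟩ := e.surjective u
    rcases hcases j with rfl | ⟨i, hi, rfl⟩
    · exact Or.inl rfl
    · exact Or.inr ⟨i, hi, rfl⟩
  · intro u w
    obtain ⟨i, rfl⟩ := e.surjective u
    obtain ⟨j, rfl⟩ := e.surjective w
    exact h.subsingleton i j
  · exact fun i hi => h.nonempty _ _ (hNadj i hi)
  · exact fun i hi h' => h.isEmpty _ _ h'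
  · rwa [hN1]
  · intro u w b
    obtain ⟨i, rfl⟩ := e.surjective u
    obtain ⟨j, rfl⟩ := e.surjective w
    have hij := h.adj i j b
    rw [dynkinD, SimpleGraph.fromRel_adj, ne_eq, Fin.ext_iff] at hij
    rcases hcases i with rfl | ⟨i, hi, rfl⟩
    · refine Or.inl ⟨rfl, congrArg e (Fin.ext ?_)⟩
      rw [hN1]
      simp only
      omega
    · rcases hcases j with rfl | ⟨j, hj, rfl⟩
      · have e1 : N i = ⟨2, by omega⟩ := Fin.ext (by simp only; omega)
        rw [e1] at b
        exact ((h.isEmpty _ _ ht).false b).elim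
      · refine Or.inr ?_
        rcases Nat.eq_zero_or_pos i with rfl | h0 <;> rcases Nat.eq_zero_or_pos j with rfl | h0'
        · omega
        · rw [hN0, hN j h0' hj] at hij
          obtain rfl : j = 1 := by omega
          exact ⟨0, by omega, Or.inl ⟨rfl, rfl⟩⟩
        · rw [hN0, hN i h0 hi] at hij
          obtain rfl : i = 1 := by omega
          exact ⟨0, by omega, Or.inr ⟨rfl, rfl⟩⟩
        · rw [hN i h0 hi, hN j h0' hj] at hij
          rcases (by omega : j = i + 1 ∨ i = j + 1) with rfl | rfl
          · exact ⟨i, by omega, Or.inl ⟨rfl, rfl⟩⟩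
          · exact ⟨j, by omega, Or.inr ⟨rfl, rfl⟩⟩

/-- Only the edge between 1 and 2 needs a prescribed direction, towards the branch point 2, and
passing to the opposite quiver reverses it. -/
theorem IsTypeD.exists_starContraction (hQ : IsTypeD Q) :
    ∃ (n : ℕ) (_ : NeZero n),
      Nonempty (StarContraction n Q) ∨ Nonempty (StarContraction n Qᵒᵖ) := by
  obtain ⟨m, hm, e, he⟩ := hQ.exists_enumeration
  obtain ⟨n, rfl⟩ : ∃ n, m = n + 2 := ⟨m - 2, by omega⟩
  have : NeZero n := ⟨by omega⟩
  refine ⟨n, this, ?_⟩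
  have hadj : (dynkinD (n + 2)).Adj ⟨1, by omega⟩ ⟨2, by omega⟩ := by
    rw [dynkinD, SimpleGraph.fromRel_adj]
    simp
  rcases he.nonempty _ _ hadj with h | h
  · exact Or.inl (he.nonempty_starContraction (by omega) rfl h)
  · obtain ⟨b⟩ := h
    exact Or.inr (he.op.nonempty_starContraction (by omega) (t := ⟨1, by omega⟩) rfl
      ⟨b.op⟩)

end Presentations

end TypeD

end

theorem proposition3p2 {k : Type*} [Field k] [Infinite k] {Q : Type*} [Quiver Q]
    (hQ : TypeD.IsTypeD Q) :
    (∃ (n : ℕ) (_ : NeZero n),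
      Nonempty (TypeD.StarContraction n Q) ∨ Nonempty (TypeD.StarContraction n Qᵒᵖ)) ∧
    (∀ (n : ℕ) [NeZero n] (c : TypeD.StarContraction n Q) (d : Q → ℕ) (V W : TypeD.Rep k Q d),
      TypeD.SameOrbit V W ↔
        ∀ f ∈ TypeD.rankFunctions k n (c.starDim d), f (c.extend V) = f (c.extend W)) ∧
    (∀ (n : ℕ) [NeZero n] (c : TypeD.StarContraction n Qᵒᵖ) (d : Q → ℕ) (V W : TypeD.Rep k Q d),
      TypeD.SameOrbit V W ↔
        ∀ f ∈ TypeD.rankFunctions k n (c.starDim fun z => d z.unop),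
          f (c.extend (TypeD.transposeRep V)) = f (c.extend (TypeD.transposeRep W))) :=
  ⟨hQ.exists_starContraction, fun _ _ c _ V W => c.sameOrbit_iff V W, fun _ _ c _ V W =>
    TypeD.sameOrbit_transposeRep_iff.symm.trans
      (c.sameOrbit_iff (TypeD.transposeRep V) (TypeD.transposeRep W))⟩
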